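/- Let $\Sigma$ (static symbols) and $\Pi$ (parameter symbols) be disjoint finite alphabets. The prev-encoding $\mathsf{prev}(T)\in(\Sigma\cup\mathbb N)^*$ of $T\in(\Sigma\cup\Pi)^*$ replaces each occurrence of a parameter symbol by the distance to its previous occurrence in $T$, or by $0$ if there is none; static symbols are kept. A pv-string is a string of the form $\mathsf{prev}(S)$ with $S\in(\Sigma\cup\Pi)^*$. Put $\mathsf Z(a,j)=0$ if $a\in\mathbb N$ and $a>j$, and $\mathsf Z(a,j)=a$ otherwise, and $\langle x\rangle[i]=\mathsf Z(x[i],i-1)$. For $w=\mathsf{prev}(T)$ let $\mathsf{PFactor}(w)=\{\langle x\rangle : x \text{ a factor of } w\}$, let $\mathsf{RPos}_w(x)$ be the set of all $i\in\{0,\dots,|w|\}$ with $|x|\le i$ and $x=\langle w[i-|x|+1:i]\rangle$, and let $[x]_w$ be the set of pv-strings $z$ with $\mathsf{RPos}_w(z)=\mathsf{RPos}_w(x)$. $\mathsf{PDAWG}(T)$ has the node set $V_w=\{[x]_w : x\in\mathsf{PFactor}(w)\}$, an edge from $u\in V_w$ to $v\in V_w$ with label $c\in\Sigma\cup\mathbb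 N$ iff $v=[(\max u)\,c]_w$, and for each node $u$ other than the source $[\varepsilon]_w$ the suffix link $\mathsf{SL}_w(u)=[\langle y[2:]\rangle]_w$ with $y=\min u$; here $\max u$ and $\min u$ are the longest and the shortest element of $u$. The sink is $[w]_w$. Let $\prec$ be the order $1\prec2\prec3\prec\cdots\prec0$ on $\mathbb N$. The following algorithm keeps a graph with edges $\mathsf{child}$, suffix links $\mathsf{SL}$ and numbers $\mathsf{len}$; $\mathsf{rex}(u)$ is the set of labels of the edges that leave $u$. There is a dummy node $\top$ with $\mathsf{len}(\top)=-1$, whose edges (to the source $\rho$, with all labels in $\Sigma\cup\{0\}$) are implicit. $\mathsf{Trans}(\top,j,c)=\rho$. For $u\ne\top$, $\mathsf{Trans}(u,j,c)=\mathsf{child}(u,c)$ if $c\neq0$; and for $c=0$, with $B=\{b\in\mathsf{rex}(u)\cap\mathbb N : b=0\text{ or }b>j\}$ and $b_0=\min_\prec B$, it is $\mathsf{Null}$ if $B=\emptyset$, $\mathsf{child}(u,b_0)$ if $|B|=1$, and $\mathsf{SL}(\mathsf{child}(u,b_0))$ if $|B|\ge2$. Algorithm. Start with the nodes $\top,\rho$,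 $\mathsf{len}(\rho)=0$, $\mathsf{SL}(\rho)=\top$, $\mathit{sink}=\rho$. For $i=1,2,\dots$ read $T[i]$ and let $a=\mathsf{prev}(T)[i]$ (found with a dictionary of last occurrences), then: 1. $u\leftarrow\mathit{sink}$; let $\mathit{sink}$ be a new node with $\mathsf{len}(\mathit{sink})=i$. 2. While $u\neq\top$ and $\mathsf{Trans}(u,\ell,\mathsf Z(a,\ell))=\mathsf{Null}$ for $\ell=\mathsf{len}(\mathsf{SL}(u))+1$: $\mathsf{child}(u,\mathsf Z(a,\mathsf{len}(u)))\leftarrow\mathit{sink}$, $u\leftarrow\mathsf{SL}(u)$. 3. If $\mathsf Z(a,\mathsf{len}(u))\in\mathsf{rex}(u)$: $k\leftarrow\mathsf{len}(u)+1$, $v\leftarrow\mathsf{child}(u,\mathsf Z(a,\mathsf{len}(u)))$. Otherwise: $k\leftarrow\min_\prec\{a,\max_\prec(\mathsf{rex}(u)\cap\mathbb N)\}$, $v\leftarrow\mathsf{Trans}(u,k-1,0)$, $\mathsf{child}(u,\mathsf Z(a,\mathsf{len}(u)))\leftarrow\mathit{sink}$, $u\leftarrow\mathsf{SL}(u)$.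 4. If $\mathsf{len}(v)=k$: $\mathsf{SL}(\mathit{sink})\leftarrow v$. Otherwise create a node $v'$ with $\mathsf{len}(v')=k$; while $\mathsf{child}(u,\mathsf Z(a,\mathsf{len}(u)))=v$: $\mathsf{child}(u,\mathsf Z(a,\mathsf{len}(u)))\leftarrow v'$, $u\leftarrow\mathsf{SL}(u)$; for each $b\in\mathsf{rex}(v)$ with $\mathsf Z(b,k)\ne0$: $\mathsf{child}(v',b)\leftarrow\mathsf{child}(v,b)$; if $\mathsf{Trans}(v,k,0)\ne\mathsf{Null}$: $\mathsf{child}(v',0)\leftarrow\mathsf{Trans}(v,k,0)$; finally $\mathsf{SL}(v')\leftarrow\mathsf{SL}(v)$, $\mathsf{SL}(v)\leftarrow v'$, $\mathsf{SL}(\mathit{sink})\leftarrow v'$. Cost model. The edges that leave a node, and the last occurrences of the parameter symbols, are kept in dictionaries (balanced search trees). An operation on a dictionary with $m$ entries (look-up, insertion, $\prec$-least $b\in\mathbb N$ with $b=0$ or $b>j$, $\prec$-greatest number) takes time $1+\lfloor\log_2(m+1)\rfloor$, traversing a dictionary takes time linear in its number of entries, and every other elementary operation on registers, nodes, links and numbers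 takes unit time. Space is the number of memory cells in use: a bounded number for each node and for each dictionary entry, plus a bounded number of registers. Theorem. There is an absolute constant $C$ such that for all finite $\Sigma,\Pi$ and all $T\in(\Sigma\cup\Pi)^*$ the algorithm processes $T$ online from left to right, the phase that handles $T[i]$ seeing no other input symbol, and for every $0\le j\le|T|$, after reading $T[1:j]$: (i) the data structure without $\top$ is isomorphic to $\mathsf{PDAWG}(T[1:j])$ (nodes, labelled edges, suffix links, source $\rho$ and $\mathit{sink}$), with $\mathsf{len}(u)=|\max u|$; (ii) the total time spent so far is at most $C\cdot\max(1,j)\cdot\max(1,|\Pi|)\cdot\max(1,\log_2(|\Sigma|+|\Pi|))$; (iii) the space in use never exceeded $C\cdot\max(1,j)$. In particular, $\mathsf{PDAWG}(T)$ for $|T|=n$ is constructed online in $O(n|\Pi|\log(|\Sigma|+|\Pi|))$ time and $O(n)$ space. -/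

import Mathlib

namespace PDAWG

/-! ### Parameterized strings, prev-encoding, re-encoding

`S` is the alphabet of static symbols, `P` the alphabet of parameter symbols. A p-string is a list
over `S ⊕ P`; a string over `Σ ∪ ℕ` is a list over `S ⊕ ℕ`. -/

section Strings

variable {S P : Type} [DecidableEq S] [DecidableEq P]

/-- The prev-code of the symbol `c` that follows the p-string `before`: a static symbol codes itself,
a parameter symbol is coded by the distance to its last occurrence, or by `0` if it is new. -/
def prevSymbol (before : List (S ⊕ P)) : S ⊕ P → S ⊕ ℕ
  | .inl x => .inl x
  | .inr p =>
      match before.reverse.findIdx? fun c => decide (c = .inr p) with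
      | some r => .inr (r + 1)
      | none => .inr 0

/-- The prev-encoding of a p-string. -/
def prev (T : List (S ⊕ P)) : List (S ⊕ ℕ) :=
  T.mapIdx fun j c => prevSymbol (T.take j) c

/-- `Z(a, j)`: a number larger than `j` is replaced by `0`. -/
def zeta (a : S ⊕ ℕ) (j : ℤ) : S ⊕ ℕ :=
  match a with
  | .inl x => .inl x
  | .inr m => if j < (m : ℤ) then .inr 0 else .inr m

/-- The re-encoding `⟨x⟩`. -/
def reenc (x : List (S ⊕ ℕ)) : List (S ⊕ ℕ) := x.mapIdx fun j a => zeta a (j : ℤ)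

variable (P) in
/-- `x` is a pv-string: the prev-encoding of some p-string. -/
def IsPV (x : List (S ⊕ ℕ)) : Prop := ∃ T : List (S ⊕ P), prev T = x

/-- The set of re-encoded factors of `w`. -/
def PFactor (w : List (S ⊕ ℕ)) : Set (List (S ⊕ ℕ)) := {y | ∃ x, x <:+: w ∧ y = reenc x}

/-- The set of end positions of `x` in `w`: all `i ≤ |w|` such that the factor of `w` of length `|x|`
that ends at position `i` exists and re-encodes to `x`. -/
def RPos (w x : List (S ⊕ ℕ)) : Set ℕ :=
  {i | x.length ≤ i ∧ i ≤ w.length ∧ x = reenc ((w.take i).drop (i - x.length))}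

variable (P) in
/-- The class `[x]` of pv-strings that have the same end positions in `w` as `x`. -/
def cls (w x : List (S ⊕ ℕ)) : Set (List (S ⊕ ℕ)) := {z | IsPV P z ∧ RPos w z = RPos w x}

/-- `y` is a longest element of `X`. -/
def IsLongest {α : Type} (X : Set (List α)) (y : List α) : Prop :=
  y ∈ X ∧ ∀ z ∈ X, z.length ≤ y.length

/-- `y` is a shortest element of `X`. -/
def IsShortest {α : Type} (X : Set (List α)) (y : List α) : Prop :=
  y ∈ X ∧ ∀ z ∈ X, y.length ≤ z.length

/-! ### The PDAWG of a p-string -/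

/-- The node set of the PDAWG of `T`. -/
def nodes (T : List (S ⊕ P)) : Set (Set (List (S ⊕ ℕ))) :=
  {u | ∃ x ∈ PFactor (prev T), u = cls P (prev T) x}

/-- The source `[ε]`. -/
def source (T : List (S ⊕ P)) : Set (List (S ⊕ ℕ)) := cls P (prev T) []

/-- The sink `[prev T]`. -/
def sink (T : List (S ⊕ P)) : Set (List (S ⊕ ℕ)) := cls P (prev T) (prev T)

/-- The labelled edges of the PDAWG of `T`: an edge `(u, c, v)` between nodes whenever
`v = [max u ⬝ c]`. -/
def IsEdge (T : List (S ⊕ P)) (u : Set (List (S ⊕ ℕ))) (c : S ⊕ ℕ) (v : Set (List (S ⊕ ℕ))) : Prop :=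
  u ∈ nodes T ∧ v ∈ nodes T ∧ ∃ y, IsLongest u y ∧ v = cls P (prev T) (y ++ [c])

/-- `v` is the suffix link of the non-source node `u`: `v = [⟨y[2:]⟩]` for `y = min u`. -/
def IsSuffixLink (T : List (S ⊕ P)) (u v : Set (List (S ⊕ ℕ))) : Prop :=
  u ∈ nodes T ∧ u ≠ source T ∧ ∃ y, IsShortest u y ∧ v = cls P (prev T) (reenc y.tail)

end Strings

/-! ### The order `≺` on the natural numbers: `1 ≺ 2 ≺ 3 ≺ ⋯ ≺ 0` -/

/-- Position of a number in the order `≺`: `0` is larger than every positive number. -/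
def precRank (m : ℕ) : WithTop ℕ := if m = 0 then ⊤ else (m : WithTop ℕ)

/-- The numbers that occur in a list of labels. -/
def numbers {S : Type} (L : List (S ⊕ ℕ)) : List ℕ := L.filterMap Sum.getRight?

/-- The `≺`-least number `b` in `L` that is `0` or larger than `i`. -/
def nextNumber {S : Type} (L : List (S ⊕ ℕ)) (i : ℤ) : Option ℕ :=
  ((numbers L).filter fun b : ℕ => b = 0 ∨ i < (b : ℤ)).argmin precRank

/-- The `≺`-greatest number in `L`. -/
def maxNumber {S : Type} (L : List (S ⊕ ℕ)) : Option ℕ := (numbers L).argmax precRank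

/-! ### A small imperative language with a time and space count

The store consists of finitely many registers, of linked nodes, and of dictionaries. A node carries a
number `len`, a pointer `SL`, and a dictionary from edge labels to nodes; one further dictionary is
indexed by parameter symbols. Programs are syntax that does not mention the alphabets. -/

/-- Types of expressions: node pointers (possibly null), integers, edge labels (possibly undefined),
truth values. -/
inductive Ty
  | node | num | lab | bool

/-- The values of each type. -/
abbrev Ty.Val (S : Type) : Ty → Type
  | .node => Option ℕ
  | .num => ℤ
  | .lab => Option (S ⊕ ℕ)
  | .bool => Bool

inductive NodeReg
  | top | root | sink | u | v | vNew
  deriving DecidableEq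

inductive NumReg
  | i | k
  deriving DecidableEq

inductive LabReg
  | a | b
  deriving DecidableEq

/-- Expressions. -/
inductive Exp : Ty → Type
  | nodeVar (x : NodeReg) : Exp .node
  | numVar (x : NumReg) : Exp .num
  | labVar (x : LabReg) : Exp .lab
  /- the null pointer -/
  | null : Exp .node
  /- the undefined label -/
  | undef : Exp .lab
  /- the label `0` -/
  | zero : Exp .lab
  | lit (z : ℤ) : Exp .num
  | add (m n : Exp .num) : Exp .num
  | sub (m n : Exp .num) : Exp .num
  /- `Z(l, n)` -/
  | zeta (l : Exp .lab) (n : Exp .num) : Exp .lab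
  /- a number as a label, and back -/
  | ofNum (n : Exp .num) : Exp .lab
  | toNum (l : Exp .lab) : Exp .num
  /- the fields of a node: its number, its link, dictionary look-up, the `≺`-least number `b` among
  the keys with `b = 0` or `b > n`, the `≺`-greatest number among the keys -/
  | len (e : Exp .node) : Exp .num
  | sl (e : Exp .node) : Exp .node
  | child (e : Exp .node) (l : Exp .lab) : Exp .node
  | next (e : Exp .node) (n : Exp .num) : Exp .lab
  | maxNum (e : Exp .node) : Exp .lab
  /- the input symbol, if it is static; its entry in the dictionary of parameter symbols -/
  | inputIsStatic : Exp .bool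
  | inputLab : Exp .lab
  | inputSeen : Exp .bool
  | inputLast : Exp .num
  | eqNode (e f : Exp .node) : Exp .bool
  | eqNum (m n : Exp .num) : Exp .bool
  | eqLab (l l' : Exp .lab) : Exp .bool
  /- `l ≺ l'`, for numbers -/
  | prec (l l' : Exp .lab) : Exp .bool
  | not (b : Exp .bool) : Exp .bool
  /- conditional expression; only the chosen branch is evaluated -/
  | ite {τ : Ty} (b : Exp .bool) (e f : Exp τ) : Exp τ

/-- Atomic instructions. -/
inductive Instr
  | setNode (x : NodeReg) (e : Exp .node)
  | setNum (x : NumReg) (n : Exp .num)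
  | setLab (x : LabReg) (l : Exp .lab)
  /- allocate a node and point `x` to it -/
  | newNode (x : NodeReg)
  | setLen (e : Exp .node) (n : Exp .num)
  | setSL (e f : Exp .node)
  | setChild (e : Exp .node) (l : Exp .lab) (f : Exp .node)
  /- store `n` in the dictionary of parameter symbols, at the input symbol -/
  | setLast (n : Exp .num)

/-- Commands. -/
inductive Cmd
  | atom (c : Instr)
  | seq (c d : Cmd)
  | cond (b : Exp .bool) (c d : Cmd)
  | skip
  | loop (b : Exp .bool) (c : Cmd)
  /- for each label `x` that has an entry in the dictionary of the node `e`, do `c` -/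
  | each (x : LabReg) (e : Exp .node) (c : Cmd)

infixr:60 " ;; " => Cmd.seq

/-- The store. The allocated nodes are the numbers below `size`. An `AList` (a list of entries with
distinct keys) describes the content of a dictionary; the costs below are those of a balanced search
tree with that content. -/
structure Store (S P : Type) where
  size : ℕ
  len : ℕ → ℤ
  sl : ℕ → Option ℕ
  table : ℕ → AList (fun _ : S ⊕ ℕ => ℕ)
  last : AList (fun _ : P => ℤ)
  input : Option (S ⊕ P)
  nodeReg : NodeReg → Option ℕ
  numReg : NumReg → ℤ
  labReg : LabReg → Option (S ⊕ ℕ)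

/-- The empty store. -/
def Store.empty (S P : Type) : Store S P where
  size := 0
  len := fun _ => 0
  sl := fun _ => none
  table := fun _ => ∅
  last := ∅
  input := none
  nodeReg := fun _ => none
  numReg := fun _ => 0
  labReg := fun _ => none

section Semantics

variable {S P : Type} [DecidableEq S] [DecidableEq P]

/-- Put a symbol of the input stream into the input register. -/
def Store.feed (s : Store S P) (c : S ⊕ P) : Store S P := { s with input := some c }

/-- Assignment to a label register. -/
def Store.setLab (s : Store S P) (x : LabReg) (l : Option (S ⊕ ℕ)) : Store S P :=
  { s with labReg := Function.update s.labReg x l }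

/-- The dictionary of a node (empty for the null pointer). -/
def Store.tableOf (s : Store S P) : Option ℕ → AList (fun _ : S ⊕ ℕ => ℕ)
  | none => ∅
  | some p => s.table p

/-- The number of memory cells in use: two cells (`len` and `SL`) for each node, two cells for each
dictionary entry, and eleven registers. -/
def Store.space (s : Store S P) : ℕ :=
  2 * s.size + ∑ p ∈ Finset.range s.size, 2 * (s.table p).entries.length
    + 2 * s.last.entries.length + 11

/-- The value of an expression. -/
def Exp.eval (s : Store S P) : {τ : Ty} → Exp τ → Ty.Val S τ
  | _, .nodeVar x => s.nodeReg x
  | _, .numVar x => s.numReg x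
  | _, .labVar x => s.labReg x
  | _, .null => none
  | _, .undef => none
  | _, .zero => some (.inr 0)
  | _, .lit z => z
  | _, .add m n => m.eval s + n.eval s
  | _, .sub m n => m.eval s - n.eval s
  | _, .zeta l n => (l.eval s).map fun a => PDAWG.zeta a (n.eval s)
  | _, .ofNum n => some (.inr (n.eval s).toNat)
  | _, .toNum l =>
      match l.eval s with
      | some (.inr m) => (m : ℤ)
      | _ => 0
  | _, .len e =>
      match e.eval s with
      | some p => s.len p
      | none => 0
  | _, .sl e => (e.eval s).bind s.sl
  | _, .child e l => (l.eval s).bind fun a => (s.tableOf (e.eval s)).lookup a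
  | _, .next e n => (nextNumber (s.tableOf (e.eval s)).keys (n.eval s)).map .inr
  | _, .maxNum e => (maxNumber (s.tableOf (e.eval s)).keys).map .inr
  | _, .inputIsStatic =>
      match s.input with
      | some (.inl _) => true
      | _ => false
  | _, .inputLab =>
      match s.input with
      | some (.inl x) => some (.inl x)
      | _ => none
  | _, .inputSeen =>
      match s.input with
      | some (.inr p) => (s.last.lookup p).isSome
      | _ => false
  | _, .inputLast =>
      match s.input with
      | some (.inr p) => (s.last.lookup p).getD 0
      | _ => 0
  | _, .eqNode e f => decide (e.eval s = f.eval s)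
  | _, .eqNum m n => decide (m.eval s = n.eval s)
  | _, .eqLab l l' => decide (l.eval s = l'.eval s)
  | _, .prec l l' =>
      match l.eval s, l'.eval s with
      | some (.inr m), some (.inr n) => decide (precRank m < precRank n)
      | _, _ => false
  | _, .not b => !(b.eval s)
  | _, .ite b e f => if b.eval s = true then e.eval s else f.eval s

/-- The time of one operation on a dictionary with `m` entries, kept as a balanced search tree. -/
def dictCost (m : ℕ) : ℕ := 1 + Nat.log 2 (m + 1)

/-- The time for evaluating an expression: one unit for each operation performed, plus the
dictionary costs. -/
def Exp.cost (s : Store S P) : {τ : Ty} → Exp τ → ℕ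
  | _, .nodeVar _ => 1
  | _, .numVar _ => 1
  | _, .labVar _ => 1
  | _, .null => 1
  | _, .undef => 1
  | _, .zero => 1
  | _, .lit _ => 1
  | _, .add m n => m.cost s + n.cost s + 1
  | _, .sub m n => m.cost s + n.cost s + 1
  | _, .zeta l n => l.cost s + n.cost s + 1
  | _, .ofNum n => n.cost s + 1
  | _, .toNum l => l.cost s + 1
  | _, .len e => e.cost s + 1
  | _, .sl e => e.cost s + 1
  | _, .child e l => e.cost s + l.cost s + dictCost (s.tableOf (e.eval s)).entries.length
  | _, .next e n => e.cost s + n.cost s + dictCost (s.tableOf (e.eval s)).entries.length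
  | _, .maxNum e => e.cost s + dictCost (s.tableOf (e.eval s)).entries.length
  | _, .inputIsStatic => 1
  | _, .inputLab => 1
  | _, .inputSeen => dictCost s.last.entries.length
  | _, .inputLast => dictCost s.last.entries.length
  | _, .eqNode e f => e.cost s + f.cost s + 1
  | _, .eqNum m n => m.cost s + n.cost s + 1
  | _, .eqLab l l' => l.cost s + l'.cost s + 1
  | _, .prec l l' => l.cost s + l'.cost s + 1
  | _, .not b => b.cost s + 1
  | _, .ite b e f => b.cost s + 1 + if b.eval s = true then e.cost s else f.cost s

/-- The effect of an instruction. Writing through a null pointer, or at an undefined label, or a null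
child, does nothing. -/
def Instr.effect (s : Store S P) : Instr → Store S P
  | .setNode x e => { s with nodeReg := Function.update s.nodeReg x (e.eval s) }
  | .setNum x n => { s with numReg := Function.update s.numReg x (n.eval s) }
  | .setLab x l => s.setLab x (l.eval s)
  | .newNode x =>
      { s with
        size := s.size + 1
        len := Function.update s.len s.size 0
        sl := Function.update s.sl s.size none
        table := Function.update s.table s.size ∅
        nodeReg := Function.update s.nodeReg x (some s.size) }
  | .setLen e n =>
      match e.eval s with
      | some p => { s with len := Function.update s.len p (n.eval s) }
      | none => s
  | .setSL e f =>
      match e.eval s with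
      | some p => { s with sl := Function.update s.sl p (f.eval s) }
      | none => s
  | .setChild e l f =>
      match e.eval s, l.eval s, f.eval s with
      | some p, some a, some q =>
          { s with table := Function.update s.table p ((s.table p).insert a q) }
      | _, _, _ => s
  | .setLast n =>
      match s.input with
      | some (.inr p) => { s with last := s.last.insert p (n.eval s) }
      | _ => s

/-- The time of an instruction. -/
def Instr.cost (s : Store S P) : Instr → ℕ
  | .setNode _ e => e.cost s + 1
  | .setNum _ n => n.cost s + 1
  | .setLab _ l => l.cost s + 1
  | .newNode _ => 1
  | .setLen e n => e.cost s + n.cost s + 1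
  | .setSL e f => e.cost s + f.cost s + 1
  | .setChild e l f =>
      e.cost s + l.cost s + f.cost s + dictCost (s.tableOf (e.eval s)).entries.length
  | .setLast n => n.cost s + dictCost s.last.entries.length

mutual

/-- `Exec c s s' t m`: the command `c`, started in the store `s`, halts in the store `s'` after time
`t`, and never occupies more than `m` memory cells on the way. -/
inductive Exec : Cmd → Store S P → Store S P → ℕ → ℕ → Prop
  | atom (c : Instr) (s : Store S P) :
      Exec (.atom c) s (c.effect s) (c.cost s) (max s.space (c.effect s).space)
  | seq {c d : Cmd} {s s₁ s₂ : Store S P} {t₁ t₂ m₁ m₂ : ℕ} :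
      Exec c s s₁ t₁ m₁ → Exec d s₁ s₂ t₂ m₂ → Exec (.seq c d) s s₂ (t₁ + t₂) (max m₁ m₂)
  | condTrue {b : Exp .bool} {c d : Cmd} {s s₁ : Store S P} {t m : ℕ} :
      b.eval s = true → Exec c s s₁ t m → Exec (.cond b c d) s s₁ (b.cost s + 1 + t) m
  | condFalse {b : Exp .bool} {c d : Cmd} {s s₁ : Store S P} {t m : ℕ} :
      b.eval s = false → Exec d s s₁ t m → Exec (.cond b c d) s s₁ (b.cost s + 1 + t) m
  | skip (s : Store S P) : Exec .skip s s 1 s.space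
  | loopTrue {b : Exp .bool} {c : Cmd} {s s₁ s₂ : Store S P} {t₁ t₂ m₁ m₂ : ℕ} :
      b.eval s = true → Exec c s s₁ t₁ m₁ → Exec (.loop b c) s₁ s₂ t₂ m₂ →
      Exec (.loop b c) s s₂ (b.cost s + 1 + t₁ + t₂) (max m₁ m₂)
  | loopFalse {b : Exp .bool} {c : Cmd} {s : Store S P} :
      b.eval s = false → Exec (.loop b c) s s (b.cost s + 1) s.space
  | each {x : LabReg} {e : Exp .node} {c : Cmd} {s s₁ : Store S P} {t m : ℕ} :
      ExecEach x c (s.tableOf (e.eval s)).keys s s₁ t m →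
      Exec (.each x e c) s s₁ (e.cost s + t) m

/-- Traversal of a dictionary with the given keys: run `c` once with `x` set to each of the keys. -/
inductive ExecEach : LabReg → Cmd → List (S ⊕ ℕ) → Store S P → Store S P → ℕ → ℕ → Prop
  | nil (x : LabReg) (c : Cmd) (s : Store S P) : ExecEach x c [] s s 1 s.space
  | cons {x : LabReg} {c : Cmd} {a : S ⊕ ℕ} {L : List (S ⊕ ℕ)} {s s₁ s₂ : Store S P}
      {t₁ t₂ m₁ m₂ : ℕ} :
      Exec c (s.setLab x (some a)) s₁ t₁ m₁ → ExecEach x c L s₁ s₂ t₂ m₂ →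
      ExecEach x c (a :: L) s s₂ (1 + t₁ + t₂) (max m₁ m₂)

end

end Semantics

/-! ### The construction algorithm -/

namespace Alg

def top : Exp .node := .nodeVar .top
def root : Exp .node := .nodeVar .root
def sink : Exp .node := .nodeVar .sink
def u : Exp .node := .nodeVar .u
def v : Exp .node := .nodeVar .v
def vNew : Exp .node := .nodeVar .vNew
def i : Exp .num := .numVar .i
def k : Exp .num := .numVar .k
def a : Exp .lab := .labVar .a
def b : Exp .lab := .labVar .b

/-- `child(e, l)`. The edges of the dummy node `⊤`, which all lead to the source, are not stored. -/
def child (e : Exp .node) (l : Exp .lab) : Exp .node :=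
  .ite (.eqNode e top) root (.child e l)

/-- `Trans(e, n, l)`. The number `next e n` is the only number `b` in `rex(e)` with `b = 0` or `b > n`
iff it is the `≺`-greatest number in `rex(e)`. -/
def trans (e : Exp .node) (n : Exp .num) (l : Exp .lab) : Exp .node :=
  .ite (.eqNode e top) root
    (.ite (.not (.eqLab l .zero)) (.child e l)
      (.ite (.eqLab (.next e n) .undef) .null
        (.ite (.eqLab (.next e n) (.maxNum e)) (.child e (.next e n))
          (.sl (.child e (.next e n))))))

/-- `len(SL(u)) + 1`, the length of the shortest element of `u`. -/
def minLen : Exp .num := .add (.len (.sl u)) (.lit 1)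

/-- `Z(a, len(u))`. -/
def aAtU : Exp .lab := .zeta a (.len u)

/-- `min_≺ {a, max_≺ (rex(u) ∩ ℕ)}`. -/
def lrsLen : Exp .num := .toNum (.ite (.prec a (.maxNum u)) a (.maxNum u))

/-- Initialisation: the dummy node, the source, and `sink ← ρ`. -/
def setup : Cmd :=
  .atom (.newNode .top) ;; .atom (.setLen top (.lit (-1))) ;;
  .atom (.newNode .root) ;; .atom (.setLen root (.lit 0)) ;; .atom (.setSL root top) ;;
  .atom (.setNode .sink root) ;; .atom (.setNum .i (.lit 0))

/-- `a ←` the prev-code of the `i`-th input symbol. -/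
def encode : Cmd :=
  .cond .inputIsStatic
    (.atom (.setLab .a .inputLab))
    (.cond .inputSeen
        (.atom (.setLab .a (.ofNum (.sub i .inputLast))))
        (.atom (.setLab .a .zero)) ;;
      .atom (.setLast i))

/-- In-coming edges of the new sink; afterwards `u` is the pre-LRS node. -/
def sinkEdges : Cmd :=
  .loop (.eqNode (trans u minLen (.zeta a minLen)) .null)
    (.atom (.setChild u aAtU sink) ;; .atom (.setNode .u (.sl u)))

/-- Find the LRS node `v` and the length `k` of the LRS. -/
def findLRS : Cmd :=
  .cond (.not (.eqNode (child u aAtU) .null))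
    (.atom (.setNum .k (.add (.len u) (.lit 1))) ;; .atom (.setNode .v (child u aAtU)))
    (.atom (.setNum .k lrsLen) ;; .atom (.setNode .v (trans u (.sub k (.lit 1)) .zero)) ;;
      .atom (.setChild u aAtU sink) ;; .atom (.setNode .u (.sl u)))

/-- Split the node `v`. -/
def split : Cmd :=
  .atom (.newNode .vNew) ;; .atom (.setLen vNew k) ;;
  .loop (.eqNode (child u aAtU) v)
    (.atom (.setChild u aAtU vNew) ;; .atom (.setNode .u (.sl u))) ;;
  .each .b v
    (.cond (.not (.eqLab (.zeta b k) .zero)) (.atom (.setChild vNew b (.child v b))) .skip) ;;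
  .cond (.not (.eqNode (trans v k .zero) .null))
    (.atom (.setChild vNew .zero (trans v k .zero))) .skip ;;
  .atom (.setSL vNew (.sl v)) ;; .atom (.setSL v vNew) ;; .atom (.setSL sink vNew)

/-- The body of the main loop: process one input symbol. -/
def extend : Cmd :=
  .atom (.setNum .i (.add i (.lit 1))) ;; encode ;;
  .atom (.setNode .u sink) ;;
  .atom (.newNode .sink) ;; .atom (.setLen sink i) ;;
  sinkEdges ;; findLRS ;;
  .cond (.eqNum (.len v) k) (.atom (.setSL sink v)) split

end Alg

/-! ### Runs and their result -/

section Runs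

variable {S P : Type} [DecidableEq S] [DecidableEq P]

/-- The run of the algorithm on the input stream `T`: `s j` is the store after the first `j` symbols
have been read, `t j` and `m j` are the time and the peak space of the phase that ends there. The
phase that leads from `s j` to `s (j + 1)` sees no input but the `(j + 1)`-st symbol. -/
def OnlineRun (T : List (S ⊕ P)) (s : ℕ → Store S P) (t m : ℕ → ℕ) : Prop :=
  Exec Alg.setup (Store.empty S P) (s 0) (t 0) (m 0) ∧
  ∀ (j : ℕ) (hj : j < T.length), Exec Alg.extend ((s j).feed T[j]) (s (j + 1)) (t (j + 1)) (m (j + 1))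

/-- The store holds the PDAWG of `T`: the allocated nodes other than the dummy node `⊤` are in
bijection with the nodes of the PDAWG, such that the dictionaries are exactly the labelled edges and
the pointers `SL` exactly the suffix links (with `SL(ρ) = ⊤`), `root` and `sink` point to the source
and the sink, and `len` is the length of the longest element. -/
def Holds (s : Store S P) (T : List (S ⊕ P)) : Prop :=
  ∃ (d r z : ℕ) (φ : ℕ → Set (List (S ⊕ ℕ))),
    d < s.size ∧ s.nodeReg .top = some d ∧
    Set.BijOn φ {p | p < s.size ∧ p ≠ d} (nodes T) ∧
    (r < s.size ∧ r ≠ d ∧ s.nodeReg .root = some r ∧ φ r = source T ∧ s.sl r = some d) ∧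
    (z < s.size ∧ z ≠ d ∧ s.nodeReg .sink = some z ∧ φ z = sink T) ∧
    (∀ p c q, p < s.size → p ≠ d →
      ((s.table p).lookup c = some q ↔ q < s.size ∧ q ≠ d ∧ IsEdge T (φ p) c (φ q))) ∧
    (∀ p q, p < s.size → p ≠ d → p ≠ r →
      (s.sl p = some q ↔ q < s.size ∧ q ≠ d ∧ IsSuffixLink T (φ p) (φ q))) ∧
    (∀ p y, p < s.size → p ≠ d → IsLongest (φ p) y → s.len p = (y.length : ℤ))

end Runs

end PDAWG

-- Two strings with a common end position in `w` are comparable: the shorter is a re-encoded suffix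
-- of the longer (`rsuf_of_mem_RPos`). Hence every class of occurring strings has a unique longest
-- element `x`, and its members are the re-encoded suffixes of `x` above one threshold length, the
-- length of the link (`IsLink.RPos_eq`). The proof names nodes by their longest strings and works
-- with `IsMax`, `IsLink` and `Occ`. `Graph` is the invariant of the data structure in these terms,
-- and `Inv.holds` translates it back to sets of strings.
--
-- Appending a letter `a` refines the classes by a single bit, whether a string is a re-encoded
-- suffix of `w ++ [a]` (`RPos_append_inj`). Let `r` be the longest such suffix that already occurs
-- in `w`. The only possible new longest strings are `w ++ [a]` and `r` (`IsLRS.isMax_cases`). The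
-- old class of `r` is cut at `r` if it has longer members; all other classes stay whole, and the
-- suffixes longer than `r` form the class of the sink. Edges of old nodes change only at suffixes
-- `x` of `w` with the label `Z(a, |x|)`: to the sink when `|x| ≥ |r|`, and to the node of `r` when
-- `x` with its label lies in the old class of `r`.
--
-- The delicate point is a transition by `0` from a suffix `y` of `x` in the class of `x`, when only
-- the edges of `x` are stored. Exactly the number labels of `x` that are `0` or exceed `|y|` turn
-- into `0` after `y`. If there is one such label, `y` followed by `0` has the same end positions as
-- `x` followed by that label. If there are several, it lies in the class that is the link of the
-- `≺`-least one (`IsRex.RPos_of_unique`, `IsRex.RPos_of_link`). The same comparison of labels gives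
-- the length of `r` when the old edges of a node do not contain `Z(a, |x|)` although its shortest
-- element does extend (`IsRex.isLRS`).
--
-- Time is amortised over breaks: lengths `l` such that the suffixes of `w` of lengths `l` and `l +
-- 1` lie in different classes. After appending a letter, a break `l + 1` comes from a break `l` or
-- is the distance to the last occurrence of some parameter symbol (`mem_breaks_snoc`), so that at
-- most `|Π| + 1` breaks appear in a phase. Both loops of a phase walk along nodes whose lengths are
-- breaks (or `|w|`), and apart from a bounded number each visited break disappears, because the
-- extended suffixes fall into the class of the sink or of `r` (`card_visited_le`).
--
-- Copying edges in a split costs at most `|Π| + 1` for the numbers. The static labels are paid by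
-- the entries of the new dictionary, whose total number is linear: an edge whose first start
-- position is not the least among the edges of its node is determined by that position
-- (`card_edges_le`). Thus there is no factor `|Σ|`; the alphabets otherwise enter only through the
-- logarithmic cost of dictionaries with at most `|Σ| + |Π| + 3` entries. `Inv.run_extend` combines
-- these charges into one potential inequality.

namespace PDAWG

-- Re-encoded suffixes, end positions, longest strings and links.

section Suffixes

variable {S : Type}

theorem zeta_zeta (a : S ⊕ ℕ) {j k : ℤ} (h : j ≤ k) : zeta (zeta a k) j = zeta a j := by
  rcases a with x | m
  · rfl
  · simp only [zeta]
    split_ifs <;> simp_all <;> omega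

theorem zeta_inl (x : S) (j : ℤ) : zeta (.inl x : S ⊕ ℕ) j = .inl x := rfl

theorem zeta_inr_zero (j : ℤ) : zeta (.inr 0 : S ⊕ ℕ) j = .inr 0 := by
  simp [zeta]

/-- A label of the form `Z(b, j)` is static or at most `j`. -/
theorem zeta_eq_inr {b : S ⊕ ℕ} {j : ℤ} {m : ℕ} (h : zeta b j = .inr m) :
    ∃ m', b = .inr m' ∧ ((m = 0 ∧ (m' = 0 ∨ j < m')) ∨ (m = m' ∧ 0 < m ∧ (m : ℤ) ≤ j)) := by
  rcases b with x | n
  · simp [zeta] at h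
  · refine ⟨n, rfl, ?_⟩
    simp only [zeta] at h
    split_ifs at h with h1 <;> simp at h <;> omega

theorem zeta_inr_eq_zero {m : ℕ} {j : ℤ} :
    zeta (.inr m : S ⊕ ℕ) j = .inr 0 ↔ m = 0 ∨ j < m := by
  simp only [zeta]
  split_ifs <;> simp <;> omega

theorem zeta_inr_of_le {m : ℕ} {j : ℤ} (h : (m : ℤ) ≤ j) : zeta (.inr m : S ⊕ ℕ) j = .inr m := by
  simp only [zeta]
  split_ifs <;> simp <;> omega

theorem reenc_length (x : List (S ⊕ ℕ)) : (reenc x).length = x.length := by simp [reenc]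

theorem reenc_snoc (x : List (S ⊕ ℕ)) (c : S ⊕ ℕ) :
    reenc (x ++ [c]) = reenc x ++ [zeta c x.length] := by
  simp [reenc, List.mapIdx_append]

/-- `x` is a re-encoded suffix of `y`. -/
def RSuf (x y : List (S ⊕ ℕ)) : Prop :=
  x.length ≤ y.length ∧ x = reenc (y.drop (y.length - x.length))

theorem RSuf.length_le {x y : List (S ⊕ ℕ)} (h : RSuf x y) : x.length ≤ y.length := h.1

theorem RSuf.nil (y : List (S ⊕ ℕ)) : RSuf [] y := by simp [RSuf, reenc]

theorem RSuf.snoc {x y : List (S ⊕ ℕ)} {c d : S ⊕ ℕ} :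
    RSuf (x ++ [c]) (y ++ [d]) ↔ RSuf x y ∧ c = zeta d x.length := by
  by_cases hle : x.length ≤ y.length
  · have e : (y ++ [d]).length - (x ++ [c]).length = y.length - x.length := by simp
    have e2 : (y.drop (y.length - x.length)).length = x.length := by simp; omega
    rw [RSuf, e, List.drop_append_of_le_length (by omega), reenc_snoc, e2, RSuf,
      List.length_append, List.length_append, List.length_singleton, List.length_singleton]
    have e3 : x ++ [c] = reenc (y.drop (y.length - x.length)) ++ [zeta d x.length] ↔
        x = reenc (y.drop (y.length - x.length)) ∧ c = zeta d x.length := by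
      simp
    rw [e3]
    constructor
    · rintro ⟨_, h⟩; exact ⟨⟨hle, h.1⟩, h.2⟩
    · rintro ⟨h1, h2⟩; exact ⟨by omega, h1.2, h2⟩
  · constructor
    · intro h; have := h.1; simp at this; omega
    · intro h; exact absurd h.1.1 hle

theorem rsuf_nil_iff {x : List (S ⊕ ℕ)} : RSuf x [] ↔ x = [] := by
  constructor
  · intro h; exact List.length_eq_zero_iff.1 (Nat.le_zero.1 h.1)
  · rintro rfl; exact RSuf.nil _

theorem RSuf.trans {x y z : List (S ⊕ ℕ)} (h1 : RSuf x y) (h2 : RSuf y z) : RSuf x z := by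
  induction x using List.reverseRecOn generalizing y z with
  | nil => exact RSuf.nil _
  | append_singleton x c ih =>
    rcases y.eq_nil_or_concat' with rfl | ⟨y, e, rfl⟩
    · simp [rsuf_nil_iff] at h1
    rcases z.eq_nil_or_concat' with rfl | ⟨z, f, rfl⟩
    · simp [rsuf_nil_iff] at h2
    rw [RSuf.snoc] at *
    refine ⟨ih h1.1 h2.1, ?_⟩
    rw [h1.2, h2.2, zeta_zeta]
    exact_mod_cast h1.1.1

theorem RSuf.of_le {x y z : List (S ⊕ ℕ)} (h1 : RSuf x z) (h2 : RSuf y z)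
    (h : x.length ≤ y.length) : RSuf x y := by
  induction x using List.reverseRecOn generalizing y z with
  | nil => exact RSuf.nil _
  | append_singleton x c ih =>
    rcases y.eq_nil_or_concat' with rfl | ⟨y, e, rfl⟩
    · simp at h
    rcases z.eq_nil_or_concat' with rfl | ⟨z, f, rfl⟩
    · simp [rsuf_nil_iff] at h1
    rw [RSuf.snoc] at *
    have h' : x.length ≤ y.length := by simpa using h
    refine ⟨ih h1.1 h2.1 h', ?_⟩
    rw [h1.2, h2.2, zeta_zeta]
    exact_mod_cast h'

theorem RSuf.eq_of_length {x y z : List (S ⊕ ℕ)} (h1 : RSuf x z) (h2 : RSuf y z)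
    (h : x.length = y.length) : x = y := by
  rw [h1.2, h2.2, h]

/-- The re-encoded suffix of length `l`. -/
def rsuf (y : List (S ⊕ ℕ)) (l : ℕ) : List (S ⊕ ℕ) := reenc (y.drop (y.length - l))

theorem rsuf_length {y : List (S ⊕ ℕ)} {l : ℕ} (h : l ≤ y.length) : (rsuf y l).length = l := by
  simp [rsuf, reenc_length]; omega

theorem rsuf_rsuf {y : List (S ⊕ ℕ)} {l : ℕ} (h : l ≤ y.length) : RSuf (rsuf y l) y := by
  refine ⟨by rw [rsuf_length h]; exact h, ?_⟩
  rw [rsuf_length h]; rfl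

theorem RSuf.eq_rsuf {x y : List (S ⊕ ℕ)} (h : RSuf x y) : x = rsuf y x.length := h.2

theorem rsuf_mono {y : List (S ⊕ ℕ)} {l m : ℕ} (h : l ≤ m) (hm : m ≤ y.length) :
    RSuf (rsuf y l) (rsuf y m) :=
  (rsuf_rsuf (h.trans hm)).of_le (rsuf_rsuf hm) (by rw [rsuf_length hm, rsuf_length (h.trans hm)]; exact h)

theorem rsuf_snoc {y : List (S ⊕ ℕ)} {l : ℕ} (h : l ≤ y.length) (a : S ⊕ ℕ) :
    rsuf (y ++ [a]) (l + 1) = rsuf y l ++ [zeta a l] := by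
  have h1 : RSuf (rsuf y l ++ [zeta a l]) (y ++ [a]) := by
    rw [RSuf.snoc, rsuf_length h]; exact ⟨rsuf_rsuf h, rfl⟩
  refine ((rsuf_rsuf (by simpa using h)).eq_of_length h1 ?_)
  rw [rsuf_length (by simpa using h)]; simp [rsuf_length h]

/-! ### End positions -/

theorem mem_RPos {w x : List (S ⊕ ℕ)} {i : ℕ} : i ∈ RPos w x ↔ i ≤ w.length ∧ RSuf x (w.take i) := by
  simp only [RPos, Set.mem_ofPred_eq, RSuf]
  constructor
  · rintro ⟨h1, h2, h3⟩
    have : (w.take i).length = i := by simp [h2]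
    rw [this]; exact ⟨h2, h1, h3⟩
  · rintro ⟨h2, h1, h3⟩
    have : (w.take i).length = i := by simp [h2]
    rw [this] at h1 h3; exact ⟨h1, h2, h3⟩

theorem length_le_of_mem_RPos {w x : List (S ⊕ ℕ)} {i : ℕ} (h : i ∈ RPos w x) : x.length ≤ i := h.1

theorem le_length_of_mem_RPos {w x : List (S ⊕ ℕ)} {i : ℕ} (h : i ∈ RPos w x) : i ≤ w.length := h.2.1

theorem RPos_mono {w x y : List (S ⊕ ℕ)} (h : RSuf x y) : RPos w y ⊆ RPos w x := by
  intro i hi; rw [mem_RPos] at *; exact ⟨hi.1, h.trans hi.2⟩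

/-- Both strings are re-encoded suffixes of the same prefix of `w`. This comparability is the source
of uniqueness of longest strings and of the chain structure of suffix links. -/
theorem rsuf_of_mem_RPos {w x y : List (S ⊕ ℕ)} {i : ℕ} (hx : i ∈ RPos w x) (hy : i ∈ RPos w y)
    (h : x.length ≤ y.length) : RSuf x y := by
  rw [mem_RPos] at *; exact hx.2.of_le hy.2 h

theorem eq_of_mem_RPos {w x y : List (S ⊕ ℕ)} {i : ℕ} (hx : i ∈ RPos w x) (hy : i ∈ RPos w y)
    (h : x.length = y.length) : x = y := by
  rw [mem_RPos] at *; exact hx.2.eq_of_length hy.2 h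

/-- With indices from `0`, `w[j]` is the letter that follows the prefix of length `j`. Questions
about labels thereby become comparisons of `Z(w[j], ·)` at different lengths. -/
theorem mem_RPos_snoc {w x : List (S ⊕ ℕ)} {c : S ⊕ ℕ} {i : ℕ} :
    i ∈ RPos w (x ++ [c]) ↔ ∃ (j : ℕ) (h : j < w.length), i = j + 1 ∧ j ∈ RPos w x ∧
      c = zeta w[j] x.length := by
  rcases i with _ | i
  · constructor
    · intro h; have := length_le_of_mem_RPos h; simp at this
    · rintro ⟨j, _, h, _⟩; omega
  · by_cases hi : i < w.length
    · rw [mem_RPos, List.take_succ_eq_append_getElem hi, RSuf.snoc]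
      constructor
      · rintro ⟨_, h1, h2⟩; exact ⟨i, hi, rfl, mem_RPos.2 ⟨hi.le, h1⟩, h2⟩
      · rintro ⟨j, hj, e, h1, h2⟩
        obtain rfl : i = j := by omega
        exact ⟨hi, (mem_RPos.1 h1).2, h2⟩
    · constructor
      · intro h; have := le_length_of_mem_RPos h; omega
      · rintro ⟨j, h, e, _⟩; omega

theorem succ_mem_RPos_snoc {w x : List (S ⊕ ℕ)} {c : S ⊕ ℕ} {j : ℕ} (h : j < w.length) :
    j + 1 ∈ RPos w (x ++ [c]) ↔ j ∈ RPos w x ∧ c = zeta w[j] x.length := by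
  rw [mem_RPos_snoc]
  constructor
  · rintro ⟨i, hi, e, h1, h2⟩
    obtain rfl : j = i := by omega
    exact ⟨h1, h2⟩
  · rintro ⟨h1, h2⟩; exact ⟨j, h, rfl, h1, h2⟩

theorem RPos_nil (w : List (S ⊕ ℕ)) : RPos w [] = {i | i ≤ w.length} := by
  ext i; rw [mem_RPos]; simp [RSuf.nil]

/-- `x` occurs in `w`. -/
def Occ (w x : List (S ⊕ ℕ)) : Prop := (RPos w x).Nonempty

theorem Occ.length_le {w x : List (S ⊕ ℕ)} (h : Occ w x) : x.length ≤ w.length := by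
  obtain ⟨i, hi⟩ := h; exact (length_le_of_mem_RPos hi).trans (le_length_of_mem_RPos hi)

theorem Occ.of_rsuf {w x y : List (S ⊕ ℕ)} (h : RSuf x y) (hy : Occ w y) : Occ w x :=
  hy.mono (RPos_mono h)

theorem occ_of_rsuf {w x : List (S ⊕ ℕ)} (h : RSuf x w) : Occ w x :=
  ⟨w.length, mem_RPos.2 ⟨le_rfl, by simpa using h⟩⟩

theorem length_mem_RPos {w x : List (S ⊕ ℕ)} : w.length ∈ RPos w x ↔ RSuf x w := by
  rw [mem_RPos]; simp

theorem mem_PFactor {w x : List (S ⊕ ℕ)} : x ∈ PFactor w ↔ Occ w x := by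
  constructor
  · rintro ⟨z, ⟨s, t, rfl⟩, rfl⟩
    refine ⟨(s ++ z).length, mem_RPos.2 ⟨by simp, ?_⟩⟩
    have e : List.take (s ++ z).length (s ++ z ++ t) = s ++ z := List.take_left
    rw [e]
    refine ⟨by simp [reenc_length], ?_⟩
    simp [reenc_length]
  · rintro ⟨i, hi⟩
    obtain ⟨h1, h2, h3⟩ := mem_RPos.1 hi
    refine ⟨_, ?_, h3⟩
    exact (List.drop_suffix _ _).isInfix.trans (List.take_prefix _ _).isInfix

/-- `x` is the longest string of its class. -/
def IsMax (w x : List (S ⊕ ℕ)) : Prop :=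
  Occ w x ∧ ∀ z, RPos w z = RPos w x → z.length ≤ x.length

theorem IsMax.eq {w x y : List (S ⊕ ℕ)} (hx : IsMax w x) (hy : IsMax w y)
    (h : RPos w x = RPos w y) : x = y := by
  obtain ⟨i, hi⟩ := hx.1
  exact eq_of_mem_RPos hi (h ▸ hi) (le_antisymm (hy.2 _ h) (hx.2 _ h.symm))

theorem IsMax.rsuf_of_eq {w x z : List (S ⊕ ℕ)} (hx : IsMax w x) (h : RPos w z = RPos w x) :
    RSuf z x := by
  obtain ⟨i, hi⟩ := hx.1
  exact rsuf_of_mem_RPos (h ▸ hi) hi (hx.2 _ h)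

theorem exists_isMax {w x : List (S ⊕ ℕ)} (hx : Occ w x) : ∃ y, IsMax w y ∧ RPos w y = RPos w x := by
  classical
  obtain ⟨i, hi⟩ := hx
  let Q : ℕ → Prop := fun n => ∃ z, RPos w z = RPos w x ∧ z.length = n
  have hb : ∀ n, Q n → n ≤ i := by
    rintro n ⟨z, hz, rfl⟩; exact length_le_of_mem_RPos (hz ▸ hi)
  have hQ : Q x.length := ⟨x, rfl, rfl⟩
  obtain ⟨z, hz, hl⟩ := Nat.findGreatest_spec (hb _ hQ) hQ
  refine ⟨z, ⟨⟨i, hz ▸ hi⟩, fun y hy => ?_⟩, hz⟩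
  rw [hl]
  exact Nat.le_findGreatest (hb _ ⟨y, hy.trans hz, rfl⟩) ⟨y, hy.trans hz, rfl⟩

theorem isMax_nil (w : List (S ⊕ ℕ)) : IsMax w [] := by
  refine ⟨occ_of_rsuf (RSuf.nil _), fun z hz => ?_⟩
  have : 0 ∈ RPos w z := by rw [hz, RPos_nil]; simp
  exact length_le_of_mem_RPos this

theorem isMax_self {w : List (S ⊕ ℕ)} (h : reenc w = w) : IsMax w w := by
  have hw : RSuf w w := ⟨le_rfl, by simp [h]⟩
  refine ⟨occ_of_rsuf hw, fun z hz => ?_⟩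
  have : w.length ∈ RPos w z := by rw [hz, length_mem_RPos]; exact hw
  exact length_le_of_mem_RPos this

/-- `y` is the longest re-encoded suffix of `x` outside the class of `x`. -/
structure IsLink (w x y : List (S ⊕ ℕ)) : Prop where
  rsuf : RSuf y x
  ne : RPos w y ≠ RPos w x
  eq_of_lt : ∀ z, RSuf z x → y.length < z.length → RPos w z = RPos w x

theorem Occ.refl {w x : List (S ⊕ ℕ)} (h : Occ w x) : RSuf x x := by
  obtain ⟨i, hi⟩ := h; exact rsuf_of_mem_RPos hi hi le_rfl

theorem IsLink.length_lt {w x y : List (S ⊕ ℕ)} (h : IsLink w x y) (hx : Occ w x) :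
    y.length < x.length := by
  refine lt_of_le_of_ne h.rsuf.1 fun e => h.ne ?_
  rw [h.rsuf.eq_of_length hx.refl e]

/-- The strings between the link of `x` and `x` belong to the class of `x`. -/
theorem IsLink.RPos_eq {w x y z : List (S ⊕ ℕ)} (h : IsLink w x y) (hz : RSuf z x) :
    RPos w z = RPos w x ↔ y.length < z.length := by
  refine ⟨fun e => ?_, h.eq_of_lt z hz⟩
  by_contra hl
  push Not at hl
  have : RSuf z y := hz.of_le h.rsuf hl
  exact h.ne (((RPos_mono this).trans e.subset).antisymm (RPos_mono h.rsuf))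

end Suffixes

end PDAWG

namespace PDAWG

-- Classes, edges and links after one more letter.

section Extension

variable {S : Type} {w : List (S ⊕ ℕ)} {a : S ⊕ ℕ}

theorem mem_RPos_append {x : List (S ⊕ ℕ)} {i : ℕ} :
    i ∈ RPos (w ++ [a]) x ↔ i ∈ RPos w x ∨ (i = w.length + 1 ∧ RSuf x (w ++ [a])) := by
  constructor
  · intro h
    rcases Nat.lt_or_ge w.length i with hi | hi
    · right
      have : i = w.length + 1 := by
        have := le_length_of_mem_RPos h; simp at this; omega
      refine ⟨this, ?_⟩
      subst this
      have e : w.length + 1 = (w ++ [a]).length := by simp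
      rwa [e, length_mem_RPos] at h
    · left
      rw [mem_RPos] at h ⊢
      rw [List.take_append_of_le_length hi] at h
      exact ⟨hi, h.2⟩
  · rintro (h | ⟨rfl, h⟩)
    · have hi := le_length_of_mem_RPos h
      rw [mem_RPos] at h ⊢
      rw [List.take_append_of_le_length hi]
      exact ⟨by simp; omega, h.2⟩
    · have e : w.length + 1 = (w ++ [a]).length := by simp
      rwa [e, length_mem_RPos]

theorem mem_RPos_append_of_le {x : List (S ⊕ ℕ)} {i : ℕ} (h : i ≤ w.length) :
    i ∈ RPos (w ++ [a]) x ↔ i ∈ RPos w x := by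
  rw [mem_RPos_append]
  constructor
  · rintro (h | h)
    · exact h
    · omega
  · exact Or.inl

/-- The only end position that can be new is `|w| + 1`, and it belongs exactly to the re-encoded
suffixes of `w ++ [a]`. So the partition into classes is refined by one bit. -/
theorem RPos_append_inj {x y : List (S ⊕ ℕ)} :
    RPos (w ++ [a]) x = RPos (w ++ [a]) y ↔
      RPos w x = RPos w y ∧ (RSuf x (w ++ [a]) ↔ RSuf y (w ++ [a])) := by
  constructor
  · intro h
    constructor
    · ext i
      by_cases hi : i ≤ w.length
      · rw [← mem_RPos_append_of_le (a := a) hi, h, mem_RPos_append_of_le hi]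
      · exact ⟨fun h => absurd (le_length_of_mem_RPos h) hi,
          fun h => absurd (le_length_of_mem_RPos h) hi⟩
    · rw [← length_mem_RPos, h, length_mem_RPos]
  · rintro ⟨h1, h2⟩
    ext i; rw [mem_RPos_append, mem_RPos_append, h1, h2]

theorem occ_append {x : List (S ⊕ ℕ)} : Occ (w ++ [a]) x ↔ Occ w x ∨ RSuf x (w ++ [a]) := by
  constructor
  · rintro ⟨i, hi⟩
    rcases mem_RPos_append.1 hi with h | h
    · exact Or.inl ⟨i, h⟩
    · exact Or.inr h.2
  · rintro (⟨i, hi⟩ | h)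
    · exact ⟨i, mem_RPos_append.2 (Or.inl hi)⟩
    · exact occ_of_rsuf h

variable (w a) in
/-- `r` is the longest re-encoded suffix of `w ⬝ a` that occurs in `w`. -/
structure IsLRS (r : List (S ⊕ ℕ)) : Prop where
  rsuf : RSuf r (w ++ [a])
  occ : Occ w r
  le : ∀ z, RSuf z (w ++ [a]) → Occ w z → z.length ≤ r.length

variable {r : List (S ⊕ ℕ)}

theorem IsLRS.rsuf_of_occ (h : IsLRS w a r) {z : List (S ⊕ ℕ)} (hz : RSuf z (w ++ [a]))
    (ho : Occ w z) : RSuf z r := hz.of_le h.rsuf (h.le z hz ho)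

theorem IsLRS.occ_iff (h : IsLRS w a r) {z : List (S ⊕ ℕ)} (hz : RSuf z (w ++ [a])) :
    Occ w z ↔ z.length ≤ r.length :=
  ⟨h.le z hz, fun hl => h.occ.of_rsuf (hz.of_le h.rsuf hl)⟩

theorem not_occ_iff {z : List (S ⊕ ℕ)} : ¬ Occ w z ↔ RPos w z = ∅ := Set.not_nonempty_iff_eq_empty

theorem not_occ_self : ¬ Occ w (w ++ [a]) := fun h => by
  have := h.length_le; simp at this

theorem RPos_append_eq_sink (ha : reenc (w ++ [a]) = w ++ [a]) {z : List (S ⊕ ℕ)} :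
    RPos (w ++ [a]) z = RPos (w ++ [a]) (w ++ [a]) ↔ RSuf z (w ++ [a]) ∧ ¬ Occ w z := by
  have hs : RSuf (w ++ [a]) (w ++ [a]) := ⟨le_rfl, by simp [ha]⟩
  rw [RPos_append_inj, not_occ_iff.1 not_occ_self, not_occ_iff]
  tauto

theorem IsMax.append {x : List (S ⊕ ℕ)} (h : IsMax w x) : IsMax (w ++ [a]) x :=
  ⟨occ_append.2 (Or.inl h.1), fun z hz => h.2 z (RPos_append_inj.1 hz).1⟩

theorem IsLRS.isMax (h : IsLRS w a r) : IsMax (w ++ [a]) r := by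
  refine ⟨occ_append.2 (Or.inl h.occ), fun z hz => ?_⟩
  have := RPos_append_inj.1 hz
  refine h.le z (this.2.2 h.rsuf) ?_
  have ho := h.occ
  rwa [Occ, ← this.1] at ho

/-- Two classes that meet the end positions of the longest repeated suffix. -/
theorem IsLRS.cases (h : IsLRS w a r) {x : List (S ⊕ ℕ)} (hx : RPos w r ⊆ RPos w x) :
    RSuf x (w ++ [a]) ∨ (RSuf r x ∧ r.length < x.length ∧ RPos w x = RPos w r) := by
  obtain ⟨i, hi⟩ := h.occ
  rcases Nat.lt_or_ge r.length x.length with hl | hl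
  · have := rsuf_of_mem_RPos hi (hx hi) hl.le
    exact Or.inr ⟨this, hl, (RPos_mono this).antisymm hx⟩
  · exact Or.inl ((rsuf_of_mem_RPos (hx hi) hi hl).trans h.rsuf)

/-- A suffix of `w ++ [a]` that occurs in `w` lies in an old class whose longest string either is
also a suffix, so that it remains the longest, or lies above `r` in the class of `r`, so that `r`
becomes the longest of the lower part. A suffix that does not occur in `w` belongs to the sink. For
a string that is no suffix, no longer string having it as a suffix is one either, and nothing
changes. -/
theorem IsLRS.isMax_cases (h : IsLRS w a r) (ha : reenc (w ++ [a]) = w ++ [a])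
    {x : List (S ⊕ ℕ)} (hx : IsMax (w ++ [a]) x) : IsMax w x ∨ x = w ++ [a] ∨ x = r := by
  by_cases hs : RSuf x (w ++ [a])
  · by_cases ho : Occ w x
    · obtain ⟨y, hy, hyx⟩ := exists_isMax ho
      rcases h.cases (x := y) (by rw [hyx]; exact RPos_mono (h.rsuf_of_occ hs ho)) with h1 | h1
      · left
        have := hx.eq hy.append (RPos_append_inj.2 ⟨hyx.symm, by simp [hs, h1]⟩)
        rwa [this]
      · right; right
        exact hx.eq h.isMax (RPos_append_inj.2 ⟨hyx.symm.trans h1.2.2, by simp [hs, h.rsuf]⟩)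
    · right; left
      exact hx.eq (isMax_self ha) ((RPos_append_eq_sink ha).2 ⟨hs, ho⟩)
  · left
    have ho : Occ w x := (occ_append.1 hx.1).resolve_right hs
    refine ⟨ho, fun z hz => ?_⟩
    by_contra hl
    push Not at hl
    obtain ⟨i, hi⟩ := ho
    have hxz : RSuf x z := rsuf_of_mem_RPos hi (hz ▸ hi) hl.le
    have hzs : ¬ RSuf z (w ++ [a]) := fun h => hs (hxz.trans h)
    have := hx.2 z (RPos_append_inj.2 ⟨hz, by simp [hs, hzs]⟩)
    omega

/-! Edges of the extended graph. -/

theorem edge_append_of_not {x y : List (S ⊕ ℕ)} (hy : IsMax w y) (h : RPos w x = RPos w y)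
    (hs : ¬ RSuf x (w ++ [a])) : RPos (w ++ [a]) x = RPos (w ++ [a]) y :=
  RPos_append_inj.2 ⟨h, by
    have : ¬ RSuf y (w ++ [a]) := fun h1 => hs ((hy.rsuf_of_eq h).trans h1)
    simp [hs, this]⟩

/-- Outside the old class of `r` a class that contains a suffix of `w ++ [a]` consists of such
suffixes only, so an edge keeps its target. -/
theorem IsLRS.edge_append_of_ne (h : IsLRS w a r) {x y : List (S ⊕ ℕ)} (hy : IsMax w y)
    (he : RPos w x = RPos w y) (hs : RSuf x (w ++ [a])) (hne : RPos w x ≠ RPos w r) :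
    RPos (w ++ [a]) x = RPos (w ++ [a]) y := by
  refine RPos_append_inj.2 ⟨he, ?_⟩
  have ho : Occ w x := by have := hy.1; rwa [Occ, ← he] at this
  have : RPos w r ⊆ RPos w y := by rw [← he]; exact RPos_mono (h.rsuf_of_occ hs ho)
  rcases h.cases this with h1 | h1
  · simp [hs, h1]
  · exact absurd (he.trans h1.2.2) hne

theorem IsLRS.edge_append_of_eq (h : IsLRS w a r) {x : List (S ⊕ ℕ)}
    (he : RPos w x = RPos w r) (hs : RSuf x (w ++ [a])) :
    RPos (w ++ [a]) x = RPos (w ++ [a]) r :=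
  RPos_append_inj.2 ⟨he, by simp [hs, h.rsuf]⟩

/-! Links of the extended graph. -/

/-- A string between the link and `x` could leave the class of `x` only by being a suffix of `w ++
[a]` while `x` is not. Then `x` would lie in the old class of `r`, above `r`, which `hne` excludes.
-/
theorem IsLRS.link_append (h : IsLRS w a r) {x y : List (S ⊕ ℕ)} (hx : Occ w x)
    (hl : IsLink w x y) (hne : RPos w x = RPos w r → x.length ≤ r.length) :
    IsLink (w ++ [a]) x y where
  rsuf := hl.rsuf
  ne := fun e => hl.ne (RPos_append_inj.1 e).1
  eq_of_lt := fun z hz hyz => by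
    have he := hl.eq_of_lt z hz hyz
    refine RPos_append_inj.2 ⟨he, ?_, hz.trans⟩
    intro hs
    have h1 : RPos w r ⊆ RPos w x := by
      rw [← he]; exact RPos_mono (h.rsuf_of_occ hs (hx.of_rsuf hz))
    rcases h.cases h1 with h2 | h2
    · exact h2
    · have := hne h2.2.2; omega

/-- The old class of `r` is cut directly above `r`: longer members occur in `w`, hence by maximality
of `r` are not suffixes of `w ++ [a]`. -/
theorem IsLRS.link_split (h : IsLRS w a r) {x : List (S ⊕ ℕ)} (hx : IsMax w x)
    (he : RPos w x = RPos w r) (hlt : r.length < x.length) : IsLink (w ++ [a]) x r where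
  rsuf := hx.rsuf_of_eq he.symm
  ne := fun e => by
    have := h.le x ((RPos_append_inj.1 e).2.1 h.rsuf) hx.1; omega
  eq_of_lt := fun z hz hlz => by
    have hxr := hx.rsuf_of_eq he.symm
    have hrz : RSuf r z := hxr.of_le hz hlz.le
    have hzx : RPos w z = RPos w x :=
      ((RPos_mono hrz).trans he.symm.subset).antisymm (RPos_mono hz)
    refine RPos_append_inj.2 ⟨hzx, ⟨fun hs => ?_, hz.trans⟩⟩
    have := h.le z hs (hx.1.of_rsuf hz); omega

/-- The lower part of the cut class contains all its short members, so it inherits the old link. -/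
theorem IsLRS.link_lrs (h : IsLRS w a r) {x y : List (S ⊕ ℕ)} (hx : IsMax w x)
    (he : RPos w x = RPos w r) (hl : IsLink w x y) : IsLink (w ++ [a]) r y := by
  have hxr := hx.rsuf_of_eq he.symm
  refine ⟨hl.rsuf.of_le hxr ((hl.RPos_eq hxr).1 he.symm).le,
    fun e => hl.ne ((RPos_append_inj.1 e).1.trans he.symm), fun z hz hlz => ?_⟩
  exact RPos_append_inj.2 ⟨(hl.eq_of_lt z (hz.trans hxr) hlz).trans he,
    by simp [h.rsuf, hz.trans h.rsuf]⟩

theorem IsLRS.link_sink (h : IsLRS w a r) (ha : reenc (w ++ [a]) = w ++ [a]) :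
    IsLink (w ++ [a]) (w ++ [a]) r := by
  refine ⟨h.rsuf, fun e => ((RPos_append_eq_sink ha).1 e).2 h.occ, fun z hz hlz => ?_⟩
  refine (RPos_append_eq_sink ha).2 ⟨hz, fun ho => ?_⟩
  have := h.le z hz ho; omega

/-! ### Transitions -/

theorem mem_numbers {L : List (S ⊕ ℕ)} {m : ℕ} : m ∈ numbers L ↔ .inr m ∈ L := by
  simp only [numbers, List.mem_filterMap]
  constructor
  · rintro ⟨x, hx, h⟩
    rcases x with x | n
    · simp at h
    · simp at h; exact h ▸ hx
  · intro h; exact ⟨_, h, rfl⟩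

theorem precRank_injective : Function.Injective precRank := by
  intro m n h
  simp only [precRank] at h
  split_ifs at h with h1 h2 h2
  · omega
  · exact absurd h.symm (WithTop.coe_ne_top (a := n))
  · exact absurd h (WithTop.coe_ne_top (a := m))
  · exact_mod_cast h

theorem precRank_le {m n : ℕ} : precRank m ≤ precRank n ↔ n = 0 ∨ (m ≠ 0 ∧ m ≤ n) := by
  simp only [precRank]
  split_ifs with h1 h2 h2
  · simp [h2]
  · subst h1
    simp only [top_le_iff, ne_eq, not_true_eq_false, false_and, or_false]
    exact ⟨fun h => absurd h (WithTop.coe_ne_top (a := n)), fun h => absurd h h2⟩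
  · simp [h2]
  · simp only [h1, h2, ne_eq, not_false_eq_true, true_and, false_or]; exact_mod_cast Iff.rfl

theorem precRank_lt {m n : ℕ} : precRank m < precRank n ↔ m ≠ 0 ∧ (n = 0 ∨ m < n) := by
  rw [← not_le, precRank_le]; omega

theorem nextNumber_eq_none {L : List (S ⊕ ℕ)} {i : ℤ} :
    nextNumber L i = none ↔ ∀ b : ℕ, .inr b ∈ L → ¬ (b = 0 ∨ i < b) := by
  rw [nextNumber, List.argmin_eq_none, List.filter_eq_nil_iff]
  simp [mem_numbers]

theorem nextNumber_eq_some {L : List (S ⊕ ℕ)} {i : ℤ} {b : ℕ} (h : nextNumber L i = some b) :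
    .inr b ∈ L ∧ (b = 0 ∨ i < b) ∧
      ∀ c : ℕ, .inr c ∈ L → (c = 0 ∨ i < c) → precRank b ≤ precRank c := by
  have h1 := List.argmin_mem h
  rw [List.mem_filter, mem_numbers] at h1
  refine ⟨h1.1, by simpa using h1.2, fun c hc hc2 => ?_⟩
  exact List.le_of_mem_argmin (by rw [List.mem_filter, mem_numbers]; simpa [hc] using hc2) h

theorem maxNumber_eq_some {L : List (S ⊕ ℕ)} {b : ℕ} (h : maxNumber L = some b) :
    .inr b ∈ L ∧ ∀ c : ℕ, .inr c ∈ L → precRank c ≤ precRank b := by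
  refine ⟨mem_numbers.1 (List.argmax_mem h), fun c hc => ?_⟩
  exact List.le_of_mem_argmax (mem_numbers.2 hc) h

theorem exists_maxNumber {L : List (S ⊕ ℕ)} {b : ℕ} (h : .inr b ∈ L) : ∃ m, maxNumber L = some m := by
  rw [← Option.ne_none_iff_exists']
  intro e
  rw [maxNumber, List.argmax_eq_none] at e
  have := mem_numbers.2 h
  rw [e] at this; simp at this

section Trans

variable {L : List (S ⊕ ℕ)} {x y : List (S ⊕ ℕ)}

/-- The labels in `L` are those that can follow `x` in `w`. -/
def IsRex (w x : List (S ⊕ ℕ)) (L : List (S ⊕ ℕ)) : Prop := ∀ c, c ∈ L ↔ Occ w (x ++ [c])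

theorem IsRex.zeta_mem (hL : IsRex w x L) {i : ℕ} (h : i < w.length) (hi : i ∈ RPos w x) :
    zeta w[i] x.length ∈ L :=
  (hL _).2 ⟨i + 1, (succ_mem_RPos_snoc h).2 ⟨hi, rfl⟩⟩

theorem IsRex.exists (hL : IsRex w x L) {c : S ⊕ ℕ} (hc : c ∈ L) :
    ∃ (i : ℕ) (h : i < w.length), i ∈ RPos w x ∧ c = zeta w[i] x.length := by
  obtain ⟨i, hi⟩ := (hL c).1 hc
  obtain ⟨j, hj, _, h1, h2⟩ := mem_RPos_snoc.1 hi
  exact ⟨j, hj, h1, h2⟩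

/-- Whether a letter becomes `0` at the smaller length can be read off from its value at the larger
one. This is why the dictionary of the longest string of a node serves all members of the class. -/
theorem zeta_eq_zero_iff {c : S ⊕ ℕ} {j k : ℕ} (h : j ≤ k) :
    zeta c j = .inr 0 ↔ ∃ b : ℕ, zeta c k = .inr b ∧ (b = 0 ∨ (j : ℤ) < b) := by
  rcases c with c | c
  · simp [zeta]
  · rw [zeta_inr_eq_zero]
    rcases Nat.lt_or_ge k c with h1 | h1
    · simp [zeta, h1]; omega
    · rw [zeta_inr_of_le (by exact_mod_cast h1)]; simp

theorem zeta_zero_iff {w x y : List (S ⊕ ℕ)} (hyx : y.length ≤ x.length)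
    (h : ∀ i < w.length, i ∈ RPos w y ↔ i ∈ RPos w x) {i : ℕ} (hi : i < w.length) :
    i + 1 ∈ RPos w (y ++ [Sum.inr 0]) ↔ i ∈ RPos w x ∧
      ∃ b : ℕ, zeta w[i] x.length = .inr b ∧ (b = 0 ∨ (y.length : ℤ) < b) := by
  rw [succ_mem_RPos_snoc hi, h i hi, ← zeta_eq_zero_iff hyx, eq_comm (a := Sum.inr 0)]

theorem IsRex.nextNumber_eq_none_iff (hL : IsRex w x L) (hyx : y.length ≤ x.length)
    (h : ∀ i < w.length, i ∈ RPos w y ↔ i ∈ RPos w x) :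
    nextNumber L y.length = none ↔ ¬ Occ w (y ++ [Sum.inr 0]) := by
  rw [nextNumber_eq_none]
  constructor
  · rintro hn ⟨i, hi⟩
    obtain ⟨j, hj, rfl, _⟩ := mem_RPos_snoc.1 hi
    obtain ⟨h1, b, h2, h3⟩ := (zeta_zero_iff hyx h hj).1 hi
    exact hn b (h2 ▸ hL.zeta_mem hj h1) h3
  · intro hn b hb h3
    obtain ⟨i, hi, h1, h2⟩ := hL.exists hb
    exact hn ⟨i + 1, (zeta_zero_iff hyx h hi).2 ⟨h1, b, h2.symm, h3⟩⟩

/-- The least admissible number is also the `≺`-greatest label, so it is the only label of `x` that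
turns into `0` after `y`. -/
theorem IsRex.RPos_of_unique (hL : IsRex w x L) (hyx : y.length ≤ x.length)
    (h : ∀ i < w.length, i ∈ RPos w y ↔ i ∈ RPos w x) {b : ℕ}
    (hn : nextNumber L y.length = some b) (hm : maxNumber L = some b) :
    RPos w (y ++ [Sum.inr 0]) = RPos w (x ++ [Sum.inr b]) := by
  obtain ⟨h1, h2, h3⟩ := nextNumber_eq_some hn
  obtain ⟨_, h4⟩ := maxNumber_eq_some hm
  ext i
  rcases i with _ | i
  · constructor <;> intro h <;> have := length_le_of_mem_RPos h <;> simp at this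
  by_cases hi : i < w.length
  · rw [zeta_zero_iff hyx h hi, succ_mem_RPos_snoc hi]
    refine and_congr_right fun hx => ?_
    constructor
    · rintro ⟨c, hc, hc2⟩
      have hcL : .inr c ∈ L := hc ▸ hL.zeta_mem hi hx
      rw [hc, precRank_injective (le_antisymm (h3 c hcL hc2) (h4 c hcL))]
    · intro e; exact ⟨b, e.symm, h2⟩
  · constructor <;> intro h <;> have := le_length_of_mem_RPos h <;> omega

/-- The admissible labels of `x` merge into `0` after every suffix of `x` of length from `|y|` to `b
- 1`, while from length `b` on the label `b` stays separate. Hence the suffix of length `b - 1`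
followed by `0` is the longest string outside the class of `x ++ [b]`, that is, its link. -/
theorem IsRex.RPos_of_link (hL : IsRex w x L) (hyx : RSuf y x)
    (h : ∀ i < w.length, i ∈ RPos w y ↔ i ∈ RPos w x) {b : ℕ}
    (hn : nextNumber L y.length = some b) (hm : maxNumber L ≠ some b)
    {q z : List (S ⊕ ℕ)} (hq : IsMax w q) (hqx : RPos w (x ++ [Sum.inr b]) = RPos w q)
    (hz : IsLink w q z) : RPos w (y ++ [Sum.inr 0]) = RPos w z := by
  obtain ⟨h1, h2, h3⟩ := nextNumber_eq_some hn
  obtain ⟨m, hm'⟩ := exists_maxNumber h1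
  obtain ⟨h4, h5⟩ := maxNumber_eq_some hm'
  have hmb : m ≠ b := fun e => hm (e ▸ hm')
  have hlt : precRank b < precRank m :=
    lt_of_le_of_ne (h5 b h1) fun e => hmb (precRank_injective e).symm
  have hb0 : b ≠ 0 := (precRank_lt.1 hlt).1
  have hjb : y.length < b := by have := h2.resolve_left hb0; exact_mod_cast this
  have hbx : b ≤ x.length := by
    obtain ⟨i, hi, _, e⟩ := hL.exists h1
    obtain ⟨m', _, h6⟩ := zeta_eq_inr e.symm
    omega
  -- The string to be identified with the link is `rsuf x e ++ [0]`: `e` is the largest length at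
  -- which `b` is still replaced by `0`.
  obtain ⟨e, rfl⟩ : ∃ e, b = e + 1 := ⟨b - 1, by omega⟩
  -- the strings between `y` and `x`
  have hsx : ∀ l, y.length ≤ l → l ≤ x.length → ∀ i < w.length,
      i ∈ RPos w (rsuf x l) ↔ i ∈ RPos w x := by
    intro l hl hl2 i hi
    refine ⟨fun h6 => (h i hi).1 (RPos_mono ?_ h6), fun h6 => RPos_mono (rsuf_rsuf hl2) h6⟩
    exact hyx.of_le (rsuf_rsuf hl2) (by rw [rsuf_length hl2]; exact hl)
  have hqs : RSuf (x ++ [Sum.inr (e + 1)]) q := hq.rsuf_of_eq hqx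
  have hl1 : e ≤ x.length := by omega
  have ht : RSuf (rsuf x e ++ [Sum.inr 0]) (x ++ [Sum.inr (e + 1)]) := by
    rw [RSuf.snoc, rsuf_length hl1]
    exact ⟨rsuf_rsuf hl1, (zeta_inr_eq_zero.2 (Or.inr (by push_cast; omega))).symm⟩
  -- By minimality of `b = e + 1`, no label of `x` lies strictly above `|y|` and at most at `e`, so
  -- both lengths collect the same labels.
  have hty : RPos w (rsuf x e ++ [Sum.inr 0]) = RPos w (y ++ [Sum.inr 0]) := by
    ext i
    rcases i with _ | i
    · constructor <;> intro h <;> have := length_le_of_mem_RPos h <;> simp at this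
    by_cases hi : i < w.length
    · rw [zeta_zero_iff hyx.1 h hi, zeta_zero_iff (x := x) ((rsuf_length hl1).le.trans hl1)
        (hsx e (by omega) hl1) hi, rsuf_length hl1]
      refine and_congr_right fun hx => exists_congr fun c => and_congr_right fun hc => ?_
      constructor
      · rintro (h | h)
        · exact Or.inl h
        · right; omega
      · intro hc2
        have := precRank_le.1 (h3 c (hc ▸ hL.zeta_mem hi hx) hc2)
        omega
    · constructor <;> intro h <;> have := le_length_of_mem_RPos h <;> omega
  -- The `≺`-greatest label `m ≠ b` is also collected, which gives an end position not belonging to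
  -- `x ++ [b]`.
  have htq : RPos w (rsuf x e ++ [Sum.inr 0]) ≠ RPos w q := by
    rw [hty, ← hqx]
    intro he
    obtain ⟨i, hi, h6, h7⟩ := hL.exists h4
    have h8 : i + 1 ∈ RPos w (y ++ [Sum.inr 0]) :=
      (zeta_zero_iff hyx.1 h hi).2 ⟨h6, m, h7.symm, by
        have := (precRank_lt.1 hlt).2; omega⟩
    rw [he, succ_mem_RPos_snoc hi, ← h7] at h8
    exact hmb (Sum.inr_injective h8.2).symm
  rw [← hty]
  have htz : RSuf (rsuf x e ++ [Sum.inr 0]) q := ht.trans hqs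
  have h9 : (rsuf x e ++ [Sum.inr 0]).length ≤ z.length := by
    by_contra hc
    exact htq (hz.eq_of_lt _ htz (not_le.1 hc))
  -- A strictly longer link would lie in the class of `x ++ [b]`: either it has that string as a
  -- suffix, or it is a suffix of it long enough to keep the label `b` intact.
  rcases h9.lt_or_eq with h10 | h10
  · exfalso
    refine hz.ne ?_
    rw [← hqx]
    rcases Nat.lt_or_ge x.length z.length with h11 | h11
    · have h12 : RSuf (x ++ [Sum.inr (e + 1)]) z := hqs.of_le hz.rsuf (by simpa using h11)
      exact (RPos_mono h12).antisymm (by rw [hqx]; exact RPos_mono hz.rsuf)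
    · have h12 : RSuf z (x ++ [Sum.inr (e + 1)]) := hz.rsuf.of_le hqs (by simp; omega)
      rcases z.eq_nil_or_concat' with rfl | ⟨z, f, rfl⟩
      · simp at h10
      simp only [List.length_append, List.length_singleton, rsuf_length hl1] at h10 h11
      rw [RSuf.snoc] at h12
      obtain ⟨h12, h13⟩ := h12
      rw [zeta_inr_of_le (by push_cast; omega)] at h13
      subst h13
      have hzz := h12.eq_rsuf
      ext i
      rcases i with _ | i
      · constructor <;> intro h <;> have := length_le_of_mem_RPos h <;> simp at this
      by_cases hi : i < w.length
      · rw [succ_mem_RPos_snoc hi, succ_mem_RPos_snoc hi]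
        have := hsx z.length (by omega) (by omega) i hi
        rw [← hzz] at this
        rw [this]
        refine and_congr_right fun _ => ?_
        generalize w[i] = d
        rcases d with d | d
        · simp [zeta]
        · simp only [zeta]
          split_ifs <;> simp <;> omega
      · constructor <;> intro h <;> have := le_length_of_mem_RPos h <;> omega
  · rw [htz.eq_of_length hz.rsuf h10]

/-- No letter following `x` agrees with `a` at length `|x|`. So at a length `l` between `|y|` and
`|x|` an agreement is possible only if `a` and some label of `x` both turn into `0`, that is, if
each is `0` or exceeds `l`. The last such `l` is one less than the `≺`-minimum of `a` and the
`≺`-greatest label. -/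
theorem IsRex.isLRS (hL : IsRex w x L) (hxw : RSuf x w) (hyx : RSuf y x)
    (h : ∀ i < w.length, i ∈ RPos w y ↔ i ∈ RPos w x)
    (hy : Occ w (y ++ [zeta a y.length])) (hx : ¬ Occ w (x ++ [zeta a x.length])) :
    ∃ m n k : ℕ, a = .inr m ∧ maxNumber L = some n ∧
      k + 1 = (if precRank m < precRank n then m else n) ∧
      y.length ≤ k ∧ k < x.length ∧ zeta a k = .inr 0 ∧
      IsLRS w a (rsuf x k ++ [Sum.inr 0]) := by
  obtain ⟨i₀, hi₀⟩ := hy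
  obtain ⟨i₀, hi₀', rfl, hy1, hy2⟩ := mem_RPos_snoc.1 hi₀
  have hx1 : i₀ ∈ RPos w x := (h _ hi₀').1 hy1
  have hx2 : zeta a x.length ≠ zeta w[i₀] x.length := fun e =>
    hx ⟨i₀ + 1, (succ_mem_RPos_snoc hi₀').2 ⟨hx1, e⟩⟩
  have hzL := hL.zeta_mem hi₀' hx1
  have hxL : ∀ i (hi : i < w.length), i ∈ RPos w x → zeta w[i] x.length ≠ zeta a x.length :=
    fun i hi h1 e => hx ⟨i + 1, (succ_mem_RPos_snoc hi).2 ⟨h1, e.symm⟩⟩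
  rcases a with a | m
  · exfalso
    generalize w[i₀] = d at *
    rcases d with d | d
    · exact hx2 hy2
    · simp only [zeta] at hy2; split_ifs at hy2
  obtain ⟨d, hd⟩ : ∃ d : ℕ, w[i₀] = .inr d := by
    generalize w[i₀] = d at *
    rcases d with d | d
    · simp only [zeta] at hy2; split_ifs at hy2
    · exact ⟨d, rfl⟩
  rw [hd] at hy2 hx2 hzL
  have hyl := hyx.1
  obtain ⟨d', hd', hdd⟩ : ∃ d' : ℕ, zeta (.inr d : S ⊕ ℕ) x.length = .inr d' ∧
      (d' = 0 ∨ y.length < d') ∧ (m = 0 ∨ y.length < m) := by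
    simp only [zeta] at hy2 hx2 ⊢
    split_ifs at hy2 hx2 ⊢ <;> simp at hy2 hx2 ⊢ <;> omega
  rw [hd'] at hzL
  obtain ⟨n, hn⟩ := exists_maxNumber hzL
  obtain ⟨h1, h2⟩ := maxNumber_eq_some hn
  have hn0 := precRank_le.1 (h2 d' hzL)
  obtain ⟨i₁, hi₁, h3, h4⟩ := hL.exists h1
  obtain ⟨n', h5, h6⟩ := zeta_eq_inr h4.symm
  have h7 := hxL i₁ hi₁ h3
  rw [← h4] at h7
  -- The `≺`-minimum is positive: `m = n = 0` would make `0` a label of `x` that equals `Z(a, |x|)`.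
  obtain ⟨k, hk⟩ : ∃ k, k + 1 = (if precRank m < precRank n then m else n) := by
    refine ⟨(if precRank m < precRank n then m else n) - 1, ?_⟩
    have : (if precRank m < precRank n then m else n) ≠ 0 := by
      split_ifs with hc
      · rw [precRank_lt] at hc; omega
      · rw [precRank_lt] at hc
        rintro rfl
        have : m = 0 := by omega
        subst this
        exact h7 (zeta_inr_zero _).symm
    omega
  have hk2 : (k + 1 = m ∧ (n = 0 ∨ m < n)) ∨ (k + 1 = n ∧ (m = 0 ∨ n ≤ m)) := by
    split_ifs at hk with hc <;> rw [precRank_lt] at hc <;> omega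
  have hkx : k < x.length := by
    rcases hk2 with ⟨h8, h9⟩ | ⟨h8, h9⟩
    · by_contra hc
      rcases h9 with rfl | h9
      · apply h7
        simp only [zeta]; split_ifs
        · rfl
        · omega
      · omega
    · omega
  have hyk : y.length ≤ k := by omega
  have hmz : zeta (.inr m : S ⊕ ℕ) k = .inr 0 := zeta_inr_eq_zero.2 (by omega)
  have hsx : ∀ l, y.length ≤ l → l ≤ x.length → ∀ i < w.length,
      i ∈ RPos w (rsuf x l) ↔ i ∈ RPos w x := by
    intro l hl hl2 i hi
    refine ⟨fun h6 => (h i hi).1 (RPos_mono ?_ h6), fun h6 => RPos_mono (rsuf_rsuf hl2) h6⟩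
    exact hyx.of_le (rsuf_rsuf hl2) (by rw [rsuf_length hl2]; exact hl)
  refine ⟨m, n, k, rfl, hn, hk, hyk, hkx, hmz, ?_, ?_, ?_⟩
  · rw [RSuf.snoc, rsuf_length hkx.le]
    exact ⟨(rsuf_rsuf hkx.le).trans hxw, hmz.symm⟩
  · refine ⟨i₁ + 1, (succ_mem_RPos_snoc hi₁).2 ⟨(hsx k hyk hkx.le i₁ hi₁).2 h3, ?_⟩⟩
    rw [rsuf_length hkx.le, h5, eq_comm, zeta_inr_eq_zero]
    omega
  · intro z hz hzo
    by_contra hlt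
    simp only [List.length_append, List.length_singleton, rsuf_length hkx.le, not_le] at hlt
    -- It suffices to refute an agreement at length `k + 1`. There either `m` or every number label
    -- of `x` keeps a nonzero value, so the agreement would persist at length `|x|`.
    have h8 : RSuf (rsuf x (k + 1) ++ [zeta (.inr m) ((k + 1 : ℕ) : ℤ)]) z := by
      refine RSuf.of_le (z := w ++ [Sum.inr m]) ?_ hz (by simp [rsuf_length (Nat.succ_le_of_lt hkx)]; omega)
      rw [RSuf.snoc, rsuf_length (Nat.succ_le_of_lt hkx)]
      exact ⟨(rsuf_rsuf (Nat.succ_le_of_lt hkx)).trans hxw, rfl⟩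
    obtain ⟨i, hi⟩ := hzo.of_rsuf h8
    obtain ⟨i, hi', rfl, h9, h10⟩ := mem_RPos_snoc.1 hi
    rw [hsx (k + 1) (by omega) hkx i hi'] at h9
    rw [rsuf_length (Nat.succ_le_of_lt hkx)] at h10
    have h11 := hxL i hi' h9
    have h12 := hL.zeta_mem hi' h9
    generalize w[i] = f at *
    rcases f with f | f
    · simp only [zeta] at h10; split_ifs at h10
    obtain ⟨f', hf'⟩ : ∃ f' : ℕ, zeta (.inr f : S ⊕ ℕ) x.length = .inr f' := by
      simp only [zeta]; split_ifs <;> exact ⟨_, rfl⟩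
    rw [hf'] at h12
    have h13 := precRank_le.1 (h2 f' h12)
    simp only [zeta] at h10 h11 hf'
    split_ifs at h10 h11 hf' <;> simp at h10 h11 hf' <;> omega

end Trans

end Extension

end PDAWG

namespace PDAWG

-- Changes of class along the suffixes of `w`.

section Breaks

variable {S : Type}

open Classical in
/-- The lengths at which the class of the re-encoded suffix of `w` changes. -/
noncomputable def breaks (w : List (S ⊕ ℕ)) : Finset ℕ :=
  (Finset.range w.length).filter fun l => RPos w (rsuf w l) ≠ RPos w (rsuf w (l + 1))

theorem mem_breaks {w : List (S ⊕ ℕ)} {l : ℕ} :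
    l ∈ breaks w ↔ l < w.length ∧ RPos w (rsuf w l) ≠ RPos w (rsuf w (l + 1)) := by
  simp [breaks]

end Breaks

-- Combinatorics of the prev-encoding.

section Prev

variable {S P : Type} [DecidableEq S] [DecidableEq P]

theorem prev_snoc (T : List (S ⊕ P)) (c : S ⊕ P) : prev (T ++ [c]) = prev T ++ [prevSymbol T c] := by
  simp only [prev, List.mapIdx_append]
  congr 1
  · refine List.ext_getElem (by simp) fun i h1 h2 => ?_
    simp only [List.length_mapIdx] at h1 h2
    simp only [List.getElem_mapIdx]
    rw [List.take_append_of_le_length (by omega)]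
  · simp

theorem prev_length (T : List (S ⊕ P)) : (prev T).length = T.length := by simp [prev]

theorem prev_append_take (T U : List (S ⊕ P)) : (prev (T ++ U)).take T.length = prev T := by
  induction U using List.reverseRecOn with
  | nil => simp [← prev_length T]
  | append_singleton U c ih =>
    rw [← List.append_assoc, prev_snoc, List.take_append_of_le_length, ih]
    simp [prev_length]

theorem prev_take (T : List (S ⊕ P)) {i : ℕ} (h : i ≤ T.length) :
    prev (T.take i) = (prev T).take i := by
  have := prev_append_take (T.take i) (T.drop i)
  rw [List.take_append_drop] at this
  simpa [h] using this.symm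

theorem prevSymbol_inr_eq (T : List (S ⊕ P)) (p : P) (b : ℕ) :
    prevSymbol T (.inr p) = .inr (b + 1) ↔
      T.reverse.findIdx? (fun c => decide (c = .inr p)) = some b := by
  simp only [prevSymbol]
  split
  · next r h => simp [h]
  · next h => rw [h]; simp

theorem findIdx?_lt {α : Type} {q : α → Bool} {L : List α} {r : ℕ} (h : L.findIdx? q = some r) :
    r < L.length := by
  rw [List.findIdx?_eq_some_iff_getElem] at h; exact h.1

/-- Deleting a prefix erases exactly the distances that reach back into it. This is the reason why
re-encoded suffixes of a prev-encoding are prev-encodings. -/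
theorem prevSymbol_append (V U : List (S ⊕ P)) (c : S ⊕ P) :
    prevSymbol U c = zeta (prevSymbol (V ++ U) c) U.length := by
  rcases c with x | p
  · rfl
  · simp only [prevSymbol, List.reverse_append, List.findIdx?_append]
    cases h : U.reverse.findIdx? (fun c => decide (c = .inr p)) with
    | some r =>
      have := findIdx?_lt h
      simp only [List.length_reverse] at this
      simp only [Option.some_or, zeta]
      rw [if_neg (by omega)]
    | none =>
      cases h2 : V.reverse.findIdx? (fun c => decide (c = .inr p)) with
      | some r => simp [zeta]
      | none => simp [zeta]

theorem rsuf_prev_append (V U : List (S ⊕ P)) : RSuf (prev U) (prev (V ++ U)) := by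
  induction U using List.reverseRecOn with
  | nil => exact RSuf.nil _
  | append_singleton U c ih =>
    rw [← List.append_assoc, prev_snoc, prev_snoc, RSuf.snoc, prev_length]
    exact ⟨ih, prevSymbol_append V U c⟩

theorem reenc_prev (T : List (S ⊕ P)) : reenc (prev T) = prev T := by
  have := (rsuf_prev_append [] T).2; simpa using this.symm

theorem rsuf_prev {T : List (S ⊕ P)} {l : ℕ} (h : l ≤ T.length) :
    rsuf (prev T) l = prev (T.drop (T.length - l)) := by
  have h1 := rsuf_prev_append (T.take (T.length - l)) (T.drop (T.length - l))
  rw [List.take_append_drop] at h1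
  refine (rsuf_rsuf (by rwa [prev_length])).eq_of_length h1 ?_
  rw [rsuf_length (by rwa [prev_length]), prev_length]; simp; omega

theorem isPV_of_rsuf {T : List (S ⊕ P)} {x : List (S ⊕ ℕ)} (h : RSuf x (prev T)) : IsPV P x := by
  have h1 := h.length_le
  rw [h.eq_rsuf]
  rw [prev_length] at h1
  exact ⟨_, (rsuf_prev h1).symm⟩

theorem isPV_of_occ {T : List (S ⊕ P)} {x : List (S ⊕ ℕ)} (h : Occ (prev T) x) : IsPV P x := by
  obtain ⟨i, hi⟩ := h
  obtain ⟨h1, h2⟩ := mem_RPos.1 hi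
  rw [prev_length] at h1
  rw [← prev_take T h1] at h2
  exact isPV_of_rsuf h2

/-- The encoding determines which positions hold the last occurrence of some parameter symbol,
although not the symbol itself: such a position is a parameter position to which no later code
points back. -/
theorem exists_findIdx?_of_prev_eq {U V : List (S ⊕ P)} (h : prev U = prev V) {q : P} {r : ℕ}
    (hq : V.reverse.findIdx? (fun c => decide (c = .inr q)) = some r) :
    ∃ p : P, U.reverse.findIdx? (fun c => decide (c = .inr p)) = some r := by
  induction U using List.reverseRecOn generalizing V q r with
  | nil =>
    have : V.length = 0 := by rw [← prev_length V, ← h, prev_length]; rfl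
    rw [List.length_eq_zero_iff] at this
    subst this; simp at hq
  | append_singleton U c ih =>
    rcases V.eq_nil_or_concat' with rfl | ⟨V, d, rfl⟩
    · simp at hq
    rw [prev_snoc, prev_snoc] at h
    obtain ⟨h1, h2⟩ := List.append_inj' h rfl
    simp only [List.cons.injEq, and_true] at h2
    rw [List.reverse_append, List.reverse_singleton, List.singleton_append,
      List.findIdx?_cons] at hq
    split_ifs at hq with hd
    · simp only [decide_eq_true_eq] at hd
      subst hd
      simp only [Option.some.injEq] at hq
      subst hq
      rcases c with c | p
      · simp only [prevSymbol] at h2; split at h2 <;> simp at h2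
      · exact ⟨p, by simp [List.findIdx?_cons]⟩
    · simp only [decide_eq_true_eq] at hd
      simp only [Option.map_eq_some_iff] at hq
      obtain ⟨r, hr, rfl⟩ := hq
      obtain ⟨p, hp⟩ := ih h1 hr
      refine ⟨p, ?_⟩
      rw [List.reverse_append, List.reverse_singleton, List.singleton_append, List.findIdx?_cons,
        if_neg, hp]
      · rfl
      · simp only [decide_eq_true_eq]
        rintro rfl
        rw [(prevSymbol_inr_eq _ _ _).2 hp] at h2
        rcases d with d | q'
        · simp [prevSymbol] at h2
        · have h3 := (prevSymbol_inr_eq _ _ _).1 h2.symm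
          rw [List.findIdx?_eq_some_iff_getElem] at hr h3
          obtain ⟨_, h4, _⟩ := hr
          obtain ⟨_, h5, _⟩ := h3
          simp only [decide_eq_true_eq] at h4 h5
          exact hd (h5.symm.trans h4)

/-- The positive numbers that can follow `prev U` are distances to last occurrences in `U` itself,
even if another p-string witnesses the extension. Together with `0` this leaves at most `|Π| + 1` of
them. -/
theorem isPV_snoc_inr {U : List (S ⊕ P)} {b : ℕ} (h : IsPV P (prev U ++ [Sum.inr b])) :
    b = 0 ∨ ∃ p : P, prevSymbol U (.inr p) = .inr b := by
  obtain ⟨V, hV⟩ := h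
  rcases V.eq_nil_or_concat' with rfl | ⟨V, d, rfl⟩
  · simp [prev] at hV
  rw [prev_snoc] at hV
  obtain ⟨h1, h2⟩ := List.append_inj' hV rfl
  simp only [List.cons.injEq, and_true] at h2
  rcases b with _ | b
  · exact Or.inl rfl
  rcases d with d | q
  · simp [prevSymbol] at h2
  obtain ⟨p, hp⟩ := exists_findIdx?_of_prev_eq h1.symm ((prevSymbol_inr_eq _ _ _).1 h2)
  exact Or.inr ⟨p, (prevSymbol_inr_eq _ _ _).2 hp⟩

/-- The number labels that can follow a pv-string. -/
theorem card_numbers_le [Fintype P] {x : List (S ⊕ ℕ)} {A : Finset ℕ}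
    (hA : ∀ b ∈ A, IsPV P (x ++ [Sum.inr b])) : A.card ≤ Fintype.card P + 1 := by
  classical
  rcases A.eq_empty_or_nonempty with rfl | ⟨b₀, hb₀⟩
  · simp
  obtain ⟨V, hV⟩ := hA b₀ hb₀
  rcases V.eq_nil_or_concat' with rfl | ⟨U, d, rfl⟩
  · simp [prev] at hV
  rw [prev_snoc] at hV
  obtain ⟨rfl, _⟩ := List.append_inj' hV rfl
  let f : P → ℕ := fun p => (prevSymbol U (.inr p)).elim (fun _ => 0) id
  have : A ⊆ insert 0 (Finset.univ.image f) := by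
    intro b hb
    rcases isPV_snoc_inr (hA b hb) with rfl | ⟨p, hp⟩
    · simp
    · refine Finset.mem_insert_of_mem (Finset.mem_image.2 ⟨p, Finset.mem_univ _, ?_⟩)
      simp [f, hp]
  refine (Finset.card_le_card this).trans ((Finset.card_insert_le _ _).trans ?_)
  have := Finset.card_image_le (s := Finset.univ) (f := f)
  rw [Finset.card_univ] at this
  omega

theorem card_labels_le [Fintype S] [Fintype P] {x : List (S ⊕ ℕ)} {A : Finset (S ⊕ ℕ)}
    (hA : ∀ c ∈ A, IsPV P (x ++ [c])) : A.card ≤ Fintype.card S + Fintype.card P + 1 := by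
  rw [← Finset.card_toLeft_add_card_toRight (u := A)]
  have h1 : A.toLeft.card ≤ Fintype.card S := Finset.card_le_univ _
  have h2 : A.toRight.card ≤ Fintype.card P + 1 :=
    card_numbers_le (x := x) fun b hb => hA _ (Finset.mem_toRight.1 hb)
  omega

/-! ### Breaks in the chain of suffixes -/

/-- If the suffixes of lengths `l` and `l + 1` share their end positions, appending a letter can
separate them only where two codes agree at length `l` but not at `l + 1`. Such a disagreement
involves the number `l + 1` itself, which is then a distance to a last occurrence. -/
theorem mem_breaks_snoc {T : List (S ⊕ P)} {c : S ⊕ P} {l : ℕ}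
    (h : l + 1 ∈ breaks (prev (T ++ [c]))) :
    l ∈ breaks (prev T) ∨ ∃ p : P, prevSymbol T (.inr p) = .inr (l + 1) := by
  have ha : reenc (prev (T ++ [c])) = prev (T ++ [c]) := reenc_prev _
  rw [prev_snoc] at h ha
  have hs : ∀ l, prevSymbol T c = .inr (l + 1) → ∃ p : P, prevSymbol T (.inr p) = .inr (l + 1) := by
    intro l hl
    rcases c with c | p
    · simp [prevSymbol] at hl
    · exact ⟨p, hl⟩
  revert h ha hs
  generalize prevSymbol T c = a
  intro h ha hs
  obtain ⟨h1, h2⟩ := mem_breaks.1 h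
  have hTl := prev_length T
  set w := prev T with hw
  simp only [List.length_append, List.length_singleton] at h1
  have hl : l < w.length := by omega
  by_contra hc
  push Not at hc
  obtain ⟨hc1, hc2⟩ := hc
  refine h2 (Set.Subset.antisymm ?_ (RPos_mono (rsuf_mono (by omega) (by simp; omega))))
  rw [rsuf_snoc hl.le, rsuf_snoc (Nat.succ_le_of_lt hl)]
  intro i hi
  obtain ⟨i, hi', rfl, h3, h4⟩ := mem_RPos_snoc.1 hi
  simp only [List.length_append, List.length_singleton] at hi'
  rcases Nat.lt_or_ge i w.length with h5 | h5
  · rw [mem_RPos_append_of_le h5.le] at h3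
    have h6 : i ∈ RPos w (rsuf w (l + 1)) := by
      rw [mem_breaks] at hc1
      push Not at hc1
      rw [← hc1 hl]; exact h3
    rw [mem_RPos_append_of_le h5, succ_mem_RPos_snoc h5]
    refine ⟨h6, ?_⟩
    rw [List.getElem_append_left h5, rsuf_length hl.le] at h4
    rw [rsuf_length (Nat.succ_le_of_lt hl)]
    by_contra h7
    -- `Z(·, l)` and `Z(·, l + 1)` differ only on the number `l + 1`.
    have h8 : a = .inr (l + 1) ∨ w[i] = .inr (l + 1) := by
      generalize w[i] = d at *
      rcases a with a | a <;> rcases d with d | d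
      · exact absurd h4 h7
      all_goals
        simp only [zeta] at h4 h7
        split_ifs at h4 h7 <;> simp at h4 h7 ⊢ <;> omega
    rcases h8 with h8 | h8
    · obtain ⟨p, hp⟩ := hs l h8
      exact hc2 p hp
    -- If the code is inside `w`, its occurrence shows that `l + 1` may follow the encoded suffix of
    -- length `l + 1`. It is therefore a last-occurrence distance in that suffix, hence also in `T`.
    · have ho : Occ w (rsuf w (l + 1) ++ [Sum.inr (l + 1)]) := by
        refine ⟨i + 1, (succ_mem_RPos_snoc h5).2 ⟨h6, ?_⟩⟩
        rw [h8, zeta_inr_of_le]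
        rw [rsuf_length (Nat.succ_le_of_lt hl)]
      have h9 := isPV_of_occ (T := T) ho
      rw [hw, rsuf_prev (by omega)] at h9
      obtain ⟨p, hp⟩ := (isPV_snoc_inr h9).resolve_left (by omega)
      refine hc2 p ?_
      rw [prevSymbol_append (T.take (T.length - (l + 1))), List.take_append_drop] at hp
      obtain ⟨m', h10, h11⟩ := zeta_eq_inr hp
      rw [h10]; congr 1; omega
  · obtain rfl : i = w.length := by omega
    have e : w.length + 1 = (w ++ [a]).length := by simp
    rw [e, length_mem_RPos, ← rsuf_snoc (Nat.succ_le_of_lt hl)]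
    exact rsuf_rsuf (by simp; omega)

/-- Old breaks move up by one, and the new ones are among `0` and one number for each parameter
symbol. The set `A` of old breaks that do not survive is what the loops of the phase are charged to.
-/
theorem card_breaks_snoc [Fintype P] (T : List (S ⊕ P)) (c : S ⊕ P) {A : Finset ℕ}
    (hA : A ⊆ breaks (prev T)) (hA' : ∀ l ∈ A, l + 1 ∉ breaks (prev (T ++ [c]))) :
    (breaks (prev (T ++ [c]))).card + A.card ≤ (breaks (prev T)).card + Fintype.card P + 1 := by
  classical
  let f : P → ℕ := fun p => (prevSymbol T (.inr p)).elim (fun _ => 0) id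
  have h : breaks (prev (T ++ [c])) ⊆
      insert 0 ((breaks (prev T) \ A).image (· + 1) ∪ Finset.univ.image f) := by
    intro l hl
    rcases l with _ | l
    · simp
    refine Finset.mem_insert_of_mem (Finset.mem_union.2 ?_)
    rcases mem_breaks_snoc hl with h | ⟨p, hp⟩
    · exact Or.inl (Finset.mem_image.2 ⟨l, Finset.mem_sdiff.2 ⟨h, fun hlA => hA' l hlA hl⟩, rfl⟩)
    · exact Or.inr (Finset.mem_image.2 ⟨p, Finset.mem_univ _, by simp [f, hp]⟩)
  have h1 := Finset.card_le_card h
  have h2 := Finset.card_insert_le 0 ((breaks (prev T) \ A).image (· + 1) ∪ Finset.univ.image f)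
  have h3 := Finset.card_union_le ((breaks (prev T) \ A).image (· + 1)) (Finset.univ.image f)
  have h4 : ((breaks (prev T) \ A).image (· + 1)).card ≤ _ := Finset.card_image_le
  have h5 : (Finset.univ.image f).card ≤ _ := Finset.card_image_le
  have h6 := Finset.card_sdiff_add_card_eq_card hA
  rw [Finset.card_univ] at h5
  omega

end Prev

/-! ### The number of edges -/

section Edges

variable {S : Type}

theorem mem_RPos_prefix {w x y : List (S ⊕ ℕ)} {i : ℕ} (h : i ∈ RPos w (x ++ y)) :
    i - y.length ∈ RPos w x := by
  induction y using List.reverseRecOn generalizing i with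
  | nil => simpa using h
  | append_singleton y c ih =>
    rw [← List.append_assoc] at h
    obtain ⟨j, _, rfl, h1, _⟩ := mem_RPos_snoc.1 h
    have := ih h1
    simpa [Nat.sub_sub, Nat.add_comm] using this

/-- The first start position of `x` in `w`. -/
noncomputable def startPos (w x : List (S ⊕ ℕ)) : ℕ := sInf {i | i + x.length ∈ RPos w x}

theorem startPos_mem {w x : List (S ⊕ ℕ)} (h : Occ w x) : startPos w x + x.length ∈ RPos w x := by
  obtain ⟨i, hi⟩ := h
  have := length_le_of_mem_RPos hi
  exact Nat.sInf_mem (s := {i | i + x.length ∈ RPos w x})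
    ⟨i - x.length, by simpa [Nat.sub_add_cancel this] using hi⟩

theorem startPos_le {w x : List (S ⊕ ℕ)} {i : ℕ} (h : i + x.length ∈ RPos w x) :
    startPos w x ≤ i := Nat.sInf_le h

/-- A common start position makes `x ++ [c]` a prefix of the longer `x'`. Every extension of `x'`
then starts with an occurrence of `x ++ [c]`, hence no earlier than its first start. -/
theorem startPos_snoc_of_eq {w x x' : List (S ⊕ ℕ)} {c c' c'' : S ⊕ ℕ} (h : Occ w (x ++ [c]))
    (h' : Occ w (x' ++ [c'])) (h'' : Occ w (x' ++ [c''])) (hl : x.length < x'.length)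
    (he : startPos w (x ++ [c]) = startPos w (x' ++ [c'])) :
    startPos w (x' ++ [c']) ≤ startPos w (x' ++ [c'']) := by
  have hp : ∀ d, Occ w (x' ++ [d]) →
      startPos w (x' ++ [d]) + (x.length + 1) ∈ RPos w (x'.take (x.length + 1)) := by
    intro d hd
    have := startPos_mem hd
    have e : x' ++ [d] = x'.take (x.length + 1) ++ (x'.drop (x.length + 1) ++ [d]) := by
      rw [← List.append_assoc, List.take_append_drop]
    have h1 := this
    rw [e] at h1
    have h2 := mem_RPos_prefix h1
    rw [← e] at h2
    convert h2 using 1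
    simp; omega
  have h1 := hp c' h'
  have h2 := startPos_mem h
  rw [he, List.length_append, List.length_singleton] at h2
  have e : x'.take (x.length + 1) = x ++ [c] := eq_of_mem_RPos h1 h2 (by simp; omega)
  rw [← he]
  refine startPos_le ?_
  have := hp c'' h''
  rw [e] at this
  simpa using this

/-- An edge whose first start is minimal among the edges of its node is charged to the node, any
other edge to its first start. Of two edges with the same first start and source strings of
different lengths, the one with the longer source is of the first kind by `startPos_snoc_of_eq`, so
the charging is injective. -/
theorem card_edges_le [DecidableEq S] {w : List (S ⊕ ℕ)} {N : Finset ℕ} {X : ℕ → List (S ⊕ ℕ)}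
    (hX : Set.InjOn X N) {E : Finset (ℕ × (S ⊕ ℕ))}
    (hE : ∀ e ∈ E, e.1 ∈ N ∧ Occ w (X e.1 ++ [e.2])) : E.card ≤ N.card + w.length := by
  classical
  let σ : ℕ × (S ⊕ ℕ) → ℕ := fun e => startPos w (X e.1 ++ [e.2])
  let can : ℕ × (S ⊕ ℕ) → Prop := fun e => ∀ c, Occ w (X e.1 ++ [c]) → σ e ≤ σ (e.1, c)
  let f : ℕ × (S ⊕ ℕ) → ℕ ⊕ ℕ := fun e => if can e then .inl e.1 else .inr (σ e)
  have hsame : ∀ x : List (S ⊕ ℕ), ∀ c c', Occ w (x ++ [c]) → Occ w (x ++ [c']) →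
      startPos w (x ++ [c]) = startPos w (x ++ [c']) → c = c' := by
    intro x c c' h1 h2 he
    have h3 := startPos_mem h1
    have h4 := startPos_mem h2
    rw [he] at h3
    have := eq_of_mem_RPos h3 (by simpa using h4) (by simp)
    simpa using this
  have hf : Set.InjOn f E := by
    rintro ⟨p, c⟩ h ⟨p', c'⟩ h' he
    obtain ⟨hp, ho⟩ := hE _ h
    obtain ⟨hp', ho'⟩ := hE _ h'
    simp only at hp ho hp' ho'
    simp only [f] at he
    split_ifs at he with h1 h2 h2
    · simp only [Sum.inl.injEq] at he
      subst he
      rw [hsame _ c c' ho ho' (le_antisymm (h1 _ ho') (h2 _ ho))]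
    · simp only [Sum.inr.injEq] at he
      have key : X p = X p' := by
        rcases lt_trichotomy (X p).length (X p').length with hl | hl | hl
        · exact absurd (fun d hd => startPos_snoc_of_eq ho ho' hd hl he) h2
        · have h3 := startPos_mem ho
          have h4 := startPos_mem ho'
          change startPos w (X p ++ [c]) = startPos w (X p' ++ [c']) at he
          rw [he] at h3
          have := eq_of_mem_RPos h3 (by simpa [hl] using h4) (by simp [hl])
          exact (List.append_inj' this rfl).1
        · exact absurd (fun d hd => startPos_snoc_of_eq ho' ho hd hl he.symm) h1
      obtain rfl := hX hp hp' key
      rw [hsame _ c c' ho ho' he]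
  have h1 : E.card ≤ (N.disjSum (Finset.range w.length)).card := by
    refine Finset.card_le_card_of_injOn f ?_ hf
    rintro ⟨p, c⟩ h
    obtain ⟨hp, ho⟩ := hE _ h
    simp only [f]
    split_ifs
    · simpa using hp
    · have h2 := le_length_of_mem_RPos (startPos_mem ho)
      simp at h2
      simp [σ]; omega
  simpa [Finset.card_disjSum] using h1

end Edges

end PDAWG

namespace PDAWG

-- Operation counts and peak space of programs.

section Logic

variable {S P : Type} [DecidableEq S] [DecidableEq P]

theorem length_insert_le {α β : Type} [DecidableEq α] (T : AList (fun _ : α => β)) (a : α) (b : β) :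
    T.entries.length ≤ (T.insert a b).entries.length := by
  have h1 : ∀ U : AList (fun _ : α => β), U.entries.length = U.keys.length := fun U => by
    simp [AList.keys, List.keys]
  rw [h1, h1, AList.keys_insert, List.length_cons, List.length_erase]
  split_ifs <;> omega

theorem Instr.space_le (s : Store S P) (c : Instr) : s.space ≤ (c.effect s).space := by
  rcases c with _ | _ | _ | _ | ⟨e, n⟩ | ⟨e, f⟩ | ⟨e, l, f⟩ | n
  · exact le_rfl
  · exact le_rfl
  · exact le_rfl
  · simp only [Instr.effect, Store.space]
    rw [Finset.sum_range_succ]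
    have : ∑ p ∈ Finset.range s.size, 2 * ((Function.update s.table s.size ∅) p).entries.length =
        ∑ p ∈ Finset.range s.size, 2 * (s.table p).entries.length := by
      refine Finset.sum_congr rfl fun p hp => ?_
      rw [Function.update_of_ne (Finset.mem_range.1 hp).ne]
    omega
  · simp only [Instr.effect]; split <;> exact le_rfl
  · simp only [Instr.effect]; split <;> exact le_rfl
  · simp only [Instr.effect]
    split
    · next p a q _ _ _ =>
      simp only [Store.space]
      have : ∑ p' ∈ Finset.range s.size, 2 * (s.table p').entries.length ≤
          ∑ p' ∈ Finset.range s.size,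
            2 * ((Function.update s.table p ((s.table p).insert a q)) p').entries.length := by
        refine Finset.sum_le_sum fun p' _ => ?_
        by_cases h : p' = p
        · subst h
          rw [Function.update_self]
          have := length_insert_le (s.table p') a q
          omega
        · rw [Function.update_of_ne h]
      omega
    · exact le_rfl
  · simp only [Instr.effect]
    split
    · next p _ =>
      simp only [Store.space]
      have := length_insert_le s.last p (n.eval s)
      omega
    · exact le_rfl

/-- Space never decreases, so that the peak space is the final space. -/
theorem Exec.space_eq {c : Cmd} {s s' : Store S P} {t m : ℕ} (h : Exec c s s' t m) :
    s.space ≤ s'.space ∧ m = s'.space := by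
  refine Exec.rec (motive_1 := fun _ s s' _ m _ => s.space ≤ s'.space ∧ m = s'.space)
    (motive_2 := fun _ _ _ s s' _ m _ => s.space ≤ s'.space ∧ m = s'.space)
    ?_ ?_ ?_ ?_ ?_ ?_ ?_ ?_ ?_ ?_ h
  · intro c s; have := Instr.space_le s c; exact ⟨this, max_eq_right this⟩
  · rintro c d s s₁ s₂ t₁ t₂ m₁ m₂ _ _ ⟨h1, rfl⟩ ⟨h2, rfl⟩; exact ⟨h1.trans h2, max_eq_right h2⟩
  · rintro b c d s s₁ t m _ _ h; exact h
  · rintro b c d s s₁ t m _ _ h; exact h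
  · intro s; exact ⟨le_rfl, rfl⟩
  · rintro b c s s₁ s₂ t₁ t₂ m₁ m₂ _ _ _ ⟨h1, rfl⟩ ⟨h2, rfl⟩
    exact ⟨h1.trans h2, max_eq_right h2⟩
  · intro b c s _; exact ⟨le_rfl, rfl⟩
  · rintro x e c s s₁ t m _ h; exact h
  · intro x c s; exact ⟨le_rfl, rfl⟩
  · rintro x c a L s s₁ s₂ t₁ t₂ m₁ m₂ _ _ ⟨h1, rfl⟩ ⟨h2, rfl⟩
    exact ⟨h1.trans h2, max_eq_right h2⟩

/-- The number of operations in an expression. -/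
def Exp.weight : {τ : Ty} → Exp τ → ℕ
  | _, .nodeVar _ => 1
  | _, .numVar _ => 1
  | _, .labVar _ => 1
  | _, .null => 1
  | _, .undef => 1
  | _, .zero => 1
  | _, .lit _ => 1
  | _, .add m n => m.weight + n.weight + 1
  | _, .sub m n => m.weight + n.weight + 1
  | _, .zeta l n => l.weight + n.weight + 1
  | _, .ofNum n => n.weight + 1
  | _, .toNum l => l.weight + 1
  | _, .len e => e.weight + 1
  | _, .sl e => e.weight + 1
  | _, .child e l => e.weight + l.weight + 1
  | _, .next e n => e.weight + n.weight + 1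
  | _, .maxNum e => e.weight + 1
  | _, .inputIsStatic => 1
  | _, .inputLab => 1
  | _, .inputSeen => 1
  | _, .inputLast => 1
  | _, .eqNode e f => e.weight + f.weight + 1
  | _, .eqNum m n => m.weight + n.weight + 1
  | _, .eqLab l l' => l.weight + l'.weight + 1
  | _, .prec l l' => l.weight + l'.weight + 1
  | _, .not b => b.weight + 1
  | _, .ite b e f => b.weight + 1 + (e.weight + f.weight)

/-- All dictionaries have at most `M` entries. -/
structure Small (s : Store S P) (M : ℕ) : Prop where
  table : ∀ p, (s.table p).entries.length ≤ M
  last : s.last.entries.length ≤ M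

theorem one_le_dictCost (m : ℕ) : 1 ≤ dictCost m := by simp [dictCost]

theorem dictCost_mono {m n : ℕ} (h : m ≤ n) : dictCost m ≤ dictCost n := by
  have := Nat.log_mono_right (b := 2) (Nat.succ_le_succ h)
  simp only [dictCost]; simp only [Nat.succ_eq_add_one] at this; omega

theorem Small.dictCost_tableOf {s : Store S P} {M : ℕ} (h : Small s M) (o : Option ℕ) :
    dictCost (s.tableOf o).entries.length ≤ dictCost M := by
  rcases o with _ | p
  · exact dictCost_mono (Nat.zero_le _)
  · exact dictCost_mono (h.table p)

/-- Every operation costs at most `dictCost M`. The weight counts both branches of a conditional, so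
that it depends on the program text only and evaluates to a numeral. -/
theorem Exp.cost_le {s : Store S P} {M : ℕ} (h : Small s M) :
    {τ : Ty} → (e : Exp τ) → e.cost s ≤ e.weight * dictCost M := by
  have h1 := one_le_dictCost M
  have h2 := dictCost_mono h.last
  have h3 := h.dictCost_tableOf
  intro τ e
  induction e with
  | child e l ih1 ih2 => have := h3 (e.eval s); simp only [Exp.cost, Exp.weight]; linarith
  | next e l ih1 ih2 => have := h3 (e.eval s); simp only [Exp.cost, Exp.weight]; linarith
  | maxNum e ih => have := h3 (e.eval s); simp only [Exp.cost, Exp.weight]; linarith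
  | ite b e f ih1 ih2 ih3 =>
    simp only [Exp.cost, Exp.weight]
    have : 0 ≤ e.weight * dictCost M := Nat.zero_le _
    have : 0 ≤ f.weight * dictCost M := Nat.zero_le _
    split_ifs <;> linarith
  | _ => simp only [Exp.cost, Exp.weight]; linarith

/-- The number of operations in an instruction. -/
def Instr.weight : Instr → ℕ
  | .setNode _ e => e.weight + 1
  | .setNum _ n => n.weight + 1
  | .setLab _ l => l.weight + 1
  | .newNode _ => 1
  | .setLen e n => e.weight + n.weight + 1
  | .setSL e f => e.weight + f.weight + 1
  | .setChild e l f => e.weight + l.weight + f.weight + 1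
  | .setLast n => n.weight + 1

theorem Instr.cost_le {s : Store S P} {M : ℕ} (h : Small s M) (c : Instr) :
    c.cost s ≤ c.weight * dictCost M := by
  have h1 := one_le_dictCost M
  have h2 := dictCost_mono h.last
  have h3 := h.dictCost_tableOf
  have h4 := fun τ (e : Exp τ) => Exp.cost_le h e
  rcases c with ⟨_, e⟩ | ⟨_, n⟩ | ⟨_, l⟩ | _ | ⟨e, n⟩ | ⟨e, f⟩ | ⟨e, l, f⟩ | n <;>
    simp only [Instr.cost, Instr.weight]
  · have := h4 _ e; linarith
  · have := h4 _ n; linarith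
  · have := h4 _ l; linarith
  · linarith
  · have := h4 _ e; have := h4 _ n; linarith
  · have := h4 _ e; have := h4 _ f; linarith
  · have := h4 _ e; have := h4 _ l; have := h4 _ f; have := h3 (e.eval s); linarith
  · have := h4 _ n; linarith

/-- `c` leads from `s` to `s'` with at most `n` operations, on dictionaries with at most `M`
entries. -/
def Run (M : ℕ) (c : Cmd) (s s' : Store S P) (n : ℕ) : Prop :=
  ∃ t m, Exec c s s' t m ∧ t ≤ n * dictCost M

theorem Run.mono {M : ℕ} {c : Cmd} {s s' : Store S P} {n n' : ℕ} (h : Run M c s s' n) (hn : n ≤ n') :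
    Run M c s s' n' := by
  obtain ⟨t, m, h1, h2⟩ := h
  exact ⟨t, m, h1, h2.trans (Nat.mul_le_mul_right _ hn)⟩

theorem Run.seq {M : ℕ} {c d : Cmd} {s s₁ s₂ : Store S P} {n₁ n₂ : ℕ} (h₁ : Run M c s s₁ n₁)
    (h₂ : Run M d s₁ s₂ n₂) : Run M (c ;; d) s s₂ (n₁ + n₂) := by
  obtain ⟨t, m, h1, h2⟩ := h₁
  obtain ⟨t', m', h1', h2'⟩ := h₂
  exact ⟨_, _, .seq h1 h1', by linarith⟩

theorem Run.atom {M : ℕ} {s : Store S P} (h : Small s M) (c : Instr) :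
    Run M (.atom c) s (c.effect s) c.weight := ⟨_, _, .atom c s, c.cost_le h⟩

theorem Run.condTrue {M : ℕ} {b : Exp .bool} {c d : Cmd} {s s' : Store S P} {n : ℕ}
    (h : Small s M) (hb : b.eval s = true) (hr : Run M c s s' n) :
    Run M (.cond b c d) s s' (b.weight + 1 + n) := by
  obtain ⟨t, m, h1, h2⟩ := hr
  refine ⟨_, _, .condTrue hb h1, ?_⟩
  have := b.cost_le h
  have := one_le_dictCost M
  linarith

theorem Run.condFalse {M : ℕ} {b : Exp .bool} {c d : Cmd} {s s' : Store S P} {n : ℕ}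
    (h : Small s M) (hb : b.eval s = false) (hr : Run M d s s' n) :
    Run M (.cond b c d) s s' (b.weight + 1 + n) := by
  obtain ⟨t, m, h1, h2⟩ := hr
  refine ⟨_, _, .condFalse hb h1, ?_⟩
  have := b.cost_le h
  have := one_le_dictCost M
  linarith

theorem Run.skip {M : ℕ} (s : Store S P) : Run M .skip s s 1 :=
  ⟨_, _, .skip s, by have := one_le_dictCost M; linarith⟩

theorem Run.loopTrue {M : ℕ} {b : Exp .bool} {c : Cmd} {s s₁ s₂ : Store S P} {n₁ n₂ : ℕ}
    (h : Small s M) (hb : b.eval s = true) (h₁ : Run M c s s₁ n₁) (h₂ : Run M (.loop b c) s₁ s₂ n₂) :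
    Run M (.loop b c) s s₂ (b.weight + 1 + n₁ + n₂) := by
  obtain ⟨t, m, h1, h2⟩ := h₁
  obtain ⟨t', m', h1', h2'⟩ := h₂
  refine ⟨_, _, .loopTrue hb h1 h1', ?_⟩
  have := b.cost_le h
  have := one_le_dictCost M
  linarith

theorem Run.loopFalse {M : ℕ} {b : Exp .bool} {c : Cmd} {s : Store S P}
    (h : Small s M) (hb : b.eval s = false) : Run M (.loop b c) s s (b.weight + 1) := by
  refine ⟨_, _, .loopFalse hb, ?_⟩
  have := b.cost_le h
  have := one_le_dictCost M
  linarith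

/-- The analogue of `Run` for the traversal of a dictionary. -/
def RunEach (M : ℕ) (x : LabReg) (c : Cmd) (L : List (S ⊕ ℕ)) (s s' : Store S P) (n : ℕ) : Prop :=
  ∃ t m, ExecEach x c L s s' t m ∧ t ≤ n * dictCost M

theorem RunEach.nil {M : ℕ} {x : LabReg} {c : Cmd} (s : Store S P) : RunEach M x c [] s s 1 :=
  ⟨_, _, .nil x c s, by have := one_le_dictCost M; linarith⟩

theorem RunEach.cons {M : ℕ} {x : LabReg} {c : Cmd} {a : S ⊕ ℕ} {L : List (S ⊕ ℕ)}
    {s s₁ s₂ : Store S P} {n₁ n₂ : ℕ} (h₁ : Run M c (s.setLab x (some a)) s₁ n₁)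
    (h₂ : RunEach M x c L s₁ s₂ n₂) : RunEach M x c (a :: L) s s₂ (1 + n₁ + n₂) := by
  obtain ⟨t, m, h1, h2⟩ := h₁
  obtain ⟨t', m', h1', h2'⟩ := h₂
  refine ⟨_, _, .cons h1 h1', ?_⟩
  have := one_le_dictCost M
  linarith

theorem Run.each {M : ℕ} {x : LabReg} {e : Exp .node} {c : Cmd} {s s' : Store S P} {n : ℕ}
    (h : Small s M) (hr : RunEach M x c (s.tableOf (e.eval s)).keys s s' n) :
    Run M (.each x e c) s s' (e.weight + n) := by
  obtain ⟨t, m, h1, h2⟩ := hr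
  refine ⟨_, _, .each h1, ?_⟩
  have := e.cost_le h
  linarith

/-! ### Atomic instructions with evaluated arguments -/

/-- Assignment to a node register. -/
def Store.putNode (s : Store S P) (x : NodeReg) (o : Option ℕ) : Store S P :=
  { s with nodeReg := Function.update s.nodeReg x o }

/-- Assignment to a number register. -/
def Store.putNum (s : Store S P) (x : NumReg) (n : ℤ) : Store S P :=
  { s with numReg := Function.update s.numReg x n }

/-- Insertion of an edge. -/
def Store.putChild (s : Store S P) (p : ℕ) (a : S ⊕ ℕ) (q : ℕ) : Store S P :=
  { s with table := Function.update s.table p ((s.table p).insert a q) }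

/-- Assignment of a link. -/
def Store.putSL (s : Store S P) (p : ℕ) (o : Option ℕ) : Store S P :=
  { s with sl := Function.update s.sl p o }

/-- Allocation of a node with a given number. -/
def Store.alloc (s : Store S P) (x : NodeReg) (n : ℤ) : Store S P :=
  { s with
    size := s.size + 1
    len := Function.update s.len s.size n
    sl := Function.update s.sl s.size none
    table := Function.update s.table s.size ∅
    nodeReg := Function.update s.nodeReg x (some s.size) }

variable {M : ℕ} {s : Store S P}

theorem Run.setNode (h : Small s M) (x : NodeReg) {e : Exp .node} {o : Option ℕ}
    (he : e.eval s = o) : Run M (.atom (.setNode x e)) s (s.putNode x o) (e.weight + 1) := by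
  subst he; exact Run.atom h (.setNode x e)

theorem Run.setNum (h : Small s M) (x : NumReg) {e : Exp .num} {o : ℤ}
    (he : e.eval s = o) : Run M (.atom (.setNum x e)) s (s.putNum x o) (e.weight + 1) := by
  subst he; exact Run.atom h (.setNum x e)

theorem Run.setLab (h : Small s M) (x : LabReg) {e : Exp .lab} {o : Option (S ⊕ ℕ)}
    (he : e.eval s = o) : Run M (.atom (.setLab x e)) s (s.setLab x o) (e.weight + 1) := by
  subst he; exact Run.atom h (.setLab x e)

theorem Run.setChild (h : Small s M) {e : Exp .node} {l : Exp .lab} {f : Exp .node} {p q : ℕ}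
    {a : S ⊕ ℕ} (he : e.eval s = some p) (hl : l.eval s = some a) (hf : f.eval s = some q) :
    Run M (.atom (.setChild e l f)) s (s.putChild p a q) (e.weight + l.weight + f.weight + 1) := by
  have := Run.atom h (.setChild e l f)
  simp only [Instr.effect, he, hl, hf] at this
  exact this

theorem Run.setSL (h : Small s M) {e f : Exp .node} {p : ℕ} {o : Option ℕ}
    (he : e.eval s = some p) (hf : f.eval s = o) :
    Run M (.atom (.setSL e f)) s (s.putSL p o) (e.weight + f.weight + 1) := by
  have := Run.atom h (.setSL e f)
  simp only [Instr.effect, he, hf] at this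
  exact this

theorem Small.of_eq {s s' : Store S P} (h : Small s M) (h1 : s'.table = s.table)
    (h2 : s'.last = s.last) : Small s' M :=
  ⟨by rw [h1]; exact h.table, by rw [h2]; exact h.last⟩

theorem Small.alloc (h : Small s M) (x : NodeReg) (n : ℤ) : Small (s.alloc x n) M := by
  refine ⟨fun p => ?_, h.last⟩
  by_cases hp : p = s.size
  · subst hp; simp [Store.alloc]
  · simp only [Store.alloc]; rw [Function.update_of_ne hp]; exact h.table p

/-- Allocation followed by an assignment to `len`. -/
theorem Run.newNode (h : Small s M) (x : NodeReg) {n : Exp .num} {m : ℤ}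
    (hn : n.eval (s.alloc x 0) = m) (c : Cmd) {s' : Store S P} {k : ℕ}
    (hr : Run M c (s.alloc x m) s' k) :
    Run M (.atom (.newNode x) ;; .atom (.setLen (.nodeVar x) n) ;; c) s s' (3 + n.weight + k) := by
  have h1 : Run M (.atom (.newNode x)) s (s.alloc x 0) 1 := Run.atom h (.newNode x)
  have h2 := Run.atom (h.alloc x 0) (.setLen (.nodeVar x) n)
  have h3 : (Instr.setLen (.nodeVar x) n).effect (s.alloc x 0) = s.alloc x m := by
    simp [Instr.effect, Exp.eval, Store.alloc] at hn ⊢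
    rw [hn]
  rw [h3] at h2
  refine (h1.seq (h2.seq hr)).mono ?_
  simp only [Instr.weight, Exp.weight]; omega

end Logic

end PDAWG

namespace PDAWG

-- The graph invariant, transitions and the chain of suffix links.

section Graph

variable {S : Type} [DecidableEq S]

/-- The store of nodes below `N`, with the dummy node `0` and the source `1`, is the PDAWG of `w`;
`X p` is the longest string of the class of the node `p`. -/
structure Graph (w : List (S ⊕ ℕ)) (N : ℕ) (X : ℕ → List (S ⊕ ℕ))
    (tb : ℕ → AList (fun _ : S ⊕ ℕ => ℕ)) (sl : ℕ → Option ℕ) (len : ℕ → ℤ) : Prop where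
  two_le : 2 ≤ N
  X_one : X 1 = []
  isMax : ∀ p, 1 ≤ p → p < N → IsMax w (X p)
  inj : ∀ p q, 1 ≤ p → p < N → 1 ≤ q → q < N → X p = X q → p = q
  surj : ∀ x, IsMax w x → ∃ p, 1 ≤ p ∧ p < N ∧ X p = x
  len_zero : len 0 = -1
  len : ∀ p, 1 ≤ p → p < N → len p = (X p).length
  sl_one : sl 1 = some 0
  sl : ∀ p, 2 ≤ p → p < N → ∃ q, 1 ≤ q ∧ q < N ∧ sl p = some q ∧ IsLink w (X p) (X q)
  edge_some : ∀ p c q, 1 ≤ p → p < N → (tb p).lookup c = some q →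
    1 ≤ q ∧ q < N ∧ RPos w (X p ++ [c]) = RPos w (X q)
  edge_none : ∀ p c, 1 ≤ p → p < N → (tb p).lookup c = none → ¬ Occ w (X p ++ [c])
  table_zero : tb 0 = ∅
  table_ge : ∀ p, N ≤ p → tb p = ∅

/-- The value of `Trans`, computed from the dictionary of a node. -/
def transVal (t : AList (fun _ : S ⊕ ℕ => ℕ)) (sl : ℕ → Option ℕ) (j : ℤ) (c : S ⊕ ℕ) : Option ℕ :=
  if c ≠ .inr 0 then t.lookup c
  else match nextNumber t.keys j with
    | none => none
    | some b => if maxNumber t.keys = some b then t.lookup (.inr b)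
        else (t.lookup (.inr b)).bind sl

theorem mem_keys_iff {t : AList (fun _ : S ⊕ ℕ => ℕ)} {c : S ⊕ ℕ} :
    c ∈ t.keys ↔ ∃ q, t.lookup c = some q := by
  rw [← AList.mem_keys, ← AList.lookup_isSome, Option.isSome_iff_exists]

theorem isRex_of_lookup {w x : List (S ⊕ ℕ)} {t : AList (fun _ : S ⊕ ℕ => ℕ)} {X : ℕ → List (S ⊕ ℕ)}
    (hs : ∀ c q, t.lookup c = some q → IsMax w (X q) ∧ RPos w (x ++ [c]) = RPos w (X q))
    (hn : ∀ c, t.lookup c = none → ¬ Occ w (x ++ [c])) : IsRex w x t.keys := by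
  intro c
  rw [mem_keys_iff]
  constructor
  · rintro ⟨q, hq⟩
    obtain ⟨h1, h2⟩ := hs c q hq
    have := h1.1
    rwa [Occ, ← h2] at this
  · intro ho
    rw [← Option.ne_none_iff_exists']
    exact fun h => hn c h ho

/-- A static label, or a positive number at most `|y|`, is matched by the same letters at length
`|y|` and at length `|x|`; only the label `0` behaves differently. -/
theorem RPos_snoc_eq_of_zeta {w x y : List (S ⊕ ℕ)} (hyx : y.length ≤ x.length)
    (h : ∀ i < w.length, i ∈ RPos w y ↔ i ∈ RPos w x) {c : S ⊕ ℕ} (hc : c ≠ .inr 0)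
    (hcy : zeta c y.length = c) : RPos w (y ++ [c]) = RPos w (x ++ [c]) := by
  ext i
  rcases i with _ | i
  · constructor <;> intro h <;> have := length_le_of_mem_RPos h <;> simp at this
  by_cases hi : i < w.length
  · rw [succ_mem_RPos_snoc hi, succ_mem_RPos_snoc hi, h i hi]
    refine and_congr_right fun _ => ?_
    generalize w[i] = d
    rcases c with c | c <;> rcases d with d | d
    · simp [zeta]
    · simp only [zeta]; split_ifs <;> simp
    · simp only [zeta]
    · simp only [ne_eq, Sum.inr.injEq] at hc
      simp only [zeta] at hcy ⊢
      split_ifs at hcy ⊢ <;> simp at hcy ⊢ <;> omega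
  · constructor <;> intro h <;> have := le_length_of_mem_RPos h <;> omega

/-- The meaning of `Trans`: it leads to the class of an extension of the suffix `y` of `x`. -/
theorem transVal_spec {w x y : List (S ⊕ ℕ)} {t : AList (fun _ : S ⊕ ℕ => ℕ)} {sl : ℕ → Option ℕ}
    {X : ℕ → List (S ⊕ ℕ)} {c : S ⊕ ℕ}
    (hs : ∀ c q, t.lookup c = some q → IsMax w (X q) ∧ RPos w (x ++ [c]) = RPos w (X q))
    (hn : ∀ c, t.lookup c = none → ¬ Occ w (x ++ [c]))
    (hyx : RSuf y x) (h : ∀ i < w.length, i ∈ RPos w y ↔ i ∈ RPos w x)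
    (hc : zeta c y.length = c)
    (hsl : ∀ b m q : ℕ, t.lookup (.inr b) = some q → .inr m ∈ t.keys → b ≠ m →
      y.length < b → (m = 0 ∨ y.length < m) → c = .inr 0 →
      ∃ z, sl q = some z ∧ IsLink w (X q) (X z)) :
    (transVal t sl y.length c = none → ¬ Occ w (y ++ [c])) ∧
    ∀ q, transVal t sl y.length c = some q → RPos w (y ++ [c]) = RPos w (X q) ∧
      ((∃ d, t.lookup d = some q) ∨ ∃ d q', t.lookup d = some q' ∧ sl q' = some q ∧
        IsLink w (X q') (X q)) := by
  have hL := isRex_of_lookup hs hn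
  by_cases hc0 : c = .inr 0
  · subst hc0
    simp only [transVal, ne_eq, not_true_eq_false, if_false]
    cases hnx : nextNumber t.keys y.length with
    | none =>
      exact ⟨fun _ => (hL.nextNumber_eq_none_iff hyx.1 h).1 hnx, fun q hq => by simp at hq⟩
    | some b =>
      obtain ⟨h1, h2, h3⟩ := nextNumber_eq_some hnx
      obtain ⟨q', hq'⟩ := mem_keys_iff.1 h1
      obtain ⟨h4, h5⟩ := hs _ _ hq'
      simp only [hq']
      split_ifs with hm
      · refine ⟨fun h => by simp at h, fun q hq => ?_⟩
        simp only [Option.some.injEq] at hq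
        subst hq
        exact ⟨(hL.RPos_of_unique hyx.1 h hnx hm).trans h5, Or.inl ⟨_, hq'⟩⟩
      · obtain ⟨m, hm'⟩ := exists_maxNumber h1
        obtain ⟨h6, h7⟩ := maxNumber_eq_some hm'
        have hmb : m ≠ b := fun e => hm (e ▸ hm')
        have hlt : precRank b < precRank m :=
          lt_of_le_of_ne (h7 b h1) fun e => hmb (precRank_injective e).symm
        rw [precRank_lt] at hlt
        have hyb := h2.resolve_left hlt.1
        obtain ⟨z, hz, hzl⟩ := hsl b m q' hq' h6 hmb.symm (by exact_mod_cast hyb) (by omega) rfl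
        have h8 := hL.RPos_of_link hyx h hnx hm h4 h5 hzl
        simp only [Option.bind_some, hz]
        refine ⟨fun h => by simp at h, fun q hq => ?_⟩
        simp only [Option.some.injEq] at hq
        subst hq
        exact ⟨h8, Or.inr ⟨_, _, hq', hz, hzl⟩⟩
  · have he := RPos_snoc_eq_of_zeta hyx.1 h hc0 hc
    simp only [transVal, ne_eq, hc0, not_false_eq_true, if_true]
    refine ⟨fun h => ?_, fun q hq => ⟨he.trans (hs _ _ hq).2, Or.inl ⟨_, hq⟩⟩⟩
    rw [Occ, he]; exact hn _ h

section

variable {w : List (S ⊕ ℕ)} {N : ℕ} {X : ℕ → List (S ⊕ ℕ)}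
  {tb : ℕ → AList (fun _ : S ⊕ ℕ => ℕ)} {sl : ℕ → Option ℕ} {len : ℕ → ℤ}

theorem Graph.eq_of_RPos (G : Graph w N X tb sl len) {p q : ℕ} (hp : 1 ≤ p) (hp' : p < N)
    (hq : 1 ≤ q) (hq' : q < N) (h : RPos w (X p) = RPos w (X q)) : p = q :=
  G.inj p q hp hp' hq hq' ((G.isMax p hp hp').eq (G.isMax q hq hq') h)

/-- The specification of `Trans` at a node of the graph. -/
theorem Graph.transVal_spec (G : Graph w N X tb sl len) {p : ℕ} (hp : 1 ≤ p) (hp' : p < N)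
    {t : AList (fun _ : S ⊕ ℕ => ℕ)} (ht : ∀ c, t.lookup c = (tb p).lookup c)
    {sl' : ℕ → Option ℕ} (hsl : ∀ q < N, sl' q = sl q)
    {y : List (S ⊕ ℕ)} (hyx : RSuf y (X p)) (h : RPos w y = RPos w (X p)) {c : S ⊕ ℕ}
    (hc : zeta c y.length = c) :
    (transVal t sl' y.length c = none → ¬ Occ w (y ++ [c])) ∧
    ∀ q, transVal t sl' y.length c = some q → 1 ≤ q ∧ q < N ∧ RPos w (y ++ [c]) = RPos w (X q) := by
  have hs : ∀ c q, t.lookup c = some q → IsMax w (X q) ∧ RPos w (X p ++ [c]) = RPos w (X q) := by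
    intro c q hq
    rw [ht] at hq
    obtain ⟨h1, h2, h3⟩ := G.edge_some p c q hp hp' hq
    exact ⟨G.isMax q h1 h2, h3⟩
  -- No edge leads to the source, whose class has the end position `0`. This matters because the
  -- link of the source is the dummy node and not a class.
  have hq2 : ∀ c q, t.lookup c = some q → 2 ≤ q ∧ q < N := by
    intro c q hq
    rw [ht] at hq
    obtain ⟨h1, h2, h3⟩ := G.edge_some p c q hp hp' hq
    refine ⟨?_, h2⟩
    by_contra hc
    obtain rfl : q = 1 := by omega
    rw [G.X_one] at h3
    have : 0 ∈ RPos w (X p ++ [c]) := by rw [h3, RPos_nil]; simp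
    have := length_le_of_mem_RPos this
    simp at this
  have hlink : ∀ c q, t.lookup c = some q → ∃ z, 1 ≤ z ∧ z < N ∧ sl' q = some z ∧
      IsLink w (X q) (X z) := by
    intro c q hq
    obtain ⟨h1, h2⟩ := hq2 c q hq
    rw [hsl q h2]
    exact G.sl q h1 h2
  obtain ⟨h1, h2⟩ := PDAWG.transVal_spec (X := X) (x := X p) (t := t) (sl := sl') hs
    (fun c hq => G.edge_none p c hp hp' (by rw [← ht]; exact hq)) hyx (fun i _ => by rw [h]) hc
    (fun b m q hq _ _ _ _ _ => by
      obtain ⟨z, _, _, h3, h4⟩ := hlink _ q hq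
      exact ⟨z, h3, h4⟩)
  refine ⟨h1, fun q hq => ?_⟩
  obtain ⟨h3, h4⟩ := h2 q hq
  rcases h4 with ⟨d, hd⟩ | ⟨d, q', hd, h5, _⟩
  · obtain ⟨h6, h7⟩ := hq2 d q hd
    exact ⟨by omega, h7, h3⟩
  · obtain ⟨z, h6, h7, h8, _⟩ := hlink d q' hd
    obtain rfl : z = q := by rw [h8] at h5; simpa using h5
    exact ⟨h6, h7, h3⟩

/-- The dummy node and the nodes of the re-encoded suffixes of `w`. -/
def OnChain (w : List (S ⊕ ℕ)) (N : ℕ) (X : ℕ → List (S ⊕ ℕ)) (p : ℕ) : Prop :=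
  p < N ∧ (p = 0 ∨ RSuf (X p) w)

/-- One step along the chain of suffix links. -/
theorem Graph.chain_step (G : Graph w N X tb sl len) {p : ℕ} (hp : 1 ≤ p) (hc : OnChain w N X p) :
    ∃ q, sl p = some q ∧ OnChain w N X q ∧ len q < len p ∧ -1 ≤ len q ∧
      (∀ q', 1 ≤ q' → OnChain w N X q' → len q < len q' → len q' ≤ len p → q' = p) ∧
      ∀ l : ℕ, (l : ℤ) ≤ len p → (len q < l ↔ RPos w (rsuf w l) = RPos w (X p)) := by
  obtain ⟨hpN, hpw⟩ := hc
  replace hpw := hpw.resolve_left (by omega)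
  have hlp := G.len p hp hpN
  have hpx := G.isMax p hp hpN
  have key : ∃ q, sl p = some q ∧ OnChain w N X q ∧ len q < len p ∧ -1 ≤ len q ∧
      ∀ z, RSuf z w → len q < z.length → (z.length : ℤ) ≤ len p → RPos w z = RPos w (X p) := by
    rcases Nat.lt_or_ge 1 p with h | h
    · obtain ⟨q, h1, h2, h3, h4⟩ := G.sl p h hpN
      have h5 := h4.length_lt hpx.1
      have h6 := G.len q h1 h2
      refine ⟨q, h3, ⟨h2, Or.inr (h4.rsuf.trans hpw)⟩, by omega, by omega, fun z hz h7 h8 => ?_⟩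
      exact h4.eq_of_lt z (hz.of_le hpw (by omega)) (by omega)
    -- At the source the chain continues to the dummy node of length `-1`, and the empty string is
    -- the only suffix in the range.
    · obtain rfl : p = 1 := by omega
      have := G.two_le
      have h0 := G.len_zero
      rw [G.X_one] at hlp
      refine ⟨0, G.sl_one, ⟨by omega, Or.inl rfl⟩, by simp [hlp, h0], by omega, fun z _ _ h8 => ?_⟩
      rw [hlp] at h8
      have : z = [] := List.length_eq_zero_iff.1 (by simpa using h8)
      rw [this, G.X_one]
  obtain ⟨q, h1, h2, h3, h4, h5⟩ := key
  refine ⟨q, h1, h2, h3, h4, fun q' hq' hqc h6 h7 => ?_, fun l h7 => ?_⟩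
  · obtain ⟨hqN, hqw⟩ := hqc
    replace hqw := hqw.resolve_left (by omega)
    have h8 := G.len q' hq' hqN
    exact G.eq_of_RPos hq' hqN hp hpN (h5 _ hqw (by omega) (by omega))
  · have hlw : l ≤ w.length := by have := hpw.length_le; omega
    refine ⟨fun h6 => h5 _ (rsuf_rsuf hlw) (by rwa [rsuf_length hlw]) (by rwa [rsuf_length hlw]),
      fun h6 => ?_⟩
    by_contra h8
    push Not at h8
    have hq1 : 1 ≤ q := by
      rcases Nat.eq_zero_or_pos q with rfl | h
      · rw [G.len_zero] at h8; omega
      · exact h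
    have h9 := G.len q hq1 h2.1
    have hqw := h2.2.resolve_left (by omega)
    have h10 : RSuf (rsuf w l) (X q) := (rsuf_rsuf hlw).of_le hqw (by rw [rsuf_length hlw]; omega)
    have h11 : RPos w (X q) = RPos w (X p) := by
      refine Set.Subset.antisymm (by rw [← h6]; exact RPos_mono h10) (RPos_mono ?_)
      exact hqw.of_le hpw (by omega)
    have := G.eq_of_RPos hq1 h2.1 hp hpN h11
    subst this
    omega

/-- Every suffix belongs to the class of a node on the chain. -/
theorem Graph.chain_cover (G : Graph w N X tb sl len) {l : ℕ} (hl : l ≤ w.length) :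
    ∃ p, 1 ≤ p ∧ OnChain w N X p ∧ (l : ℤ) ≤ len p ∧ RPos w (rsuf w l) = RPos w (X p) := by
  obtain ⟨x, hx, hxl⟩ := exists_isMax (occ_of_rsuf (rsuf_rsuf hl))
  obtain ⟨p, h1, h2, rfl⟩ := G.surj x hx
  refine ⟨p, h1, ⟨h2, Or.inr ?_⟩, ?_, hxl.symm⟩
  · rw [← length_mem_RPos, hxl, length_mem_RPos]; exact rsuf_rsuf hl
  · have := hx.2 _ hxl.symm
    rw [rsuf_length hl] at this
    rw [G.len p h1 h2]; exact_mod_cast this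

theorem Graph.eq_rsuf (G : Graph w N X tb sl len) {p : ℕ} (hp : 1 ≤ p) (hc : OnChain w N X p) :
    X p = rsuf w (X p).length ∧ (X p).length ≤ w.length ∧ len p = (X p).length := by
  have h := hc.2.resolve_left (by omega)
  exact ⟨h.eq_rsuf, h.length_le, G.len p hp hc.1⟩

end

end Graph

-- Values of the program's expressions.

section Eval

variable {S P : Type} [DecidableEq S] [DecidableEq P] {s : Store S P}

theorem eval_eqNode {e f : Exp .node} : (Exp.eqNode e f).eval s = true ↔ e.eval s = f.eval s :=
  decide_eq_true_iff

theorem eval_eqNum {e f : Exp .num} : (Exp.eqNum e f).eval s = true ↔ e.eval s = f.eval s :=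
  decide_eq_true_iff

theorem eval_eqLab {e f : Exp .lab} : (Exp.eqLab e f).eval s = true ↔ e.eval s = f.eval s :=
  decide_eq_true_iff

theorem eval_not {b : Exp .bool} : (Exp.not b).eval s = true ↔ ¬ b.eval s = true := by
  simp [Exp.eval]

theorem eval_child (ht : s.nodeReg .top = some 0) (hr : s.nodeReg .root = some 1)
    (e : Exp .node) (l : Exp .lab) : (Alg.child e l).eval s =
      if e.eval s = some 0 then some 1
      else (l.eval s).bind fun a => (s.tableOf (e.eval s)).lookup a := by
  simp only [Alg.child, Exp.eval, Alg.top, Alg.root, ht, hr, decide_eq_true_eq]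

theorem eval_trans (ht : s.nodeReg .top = some 0) (hr : s.nodeReg .root = some 1)
    {e : Exp .node} {n : Exp .num} {l : Exp .lab} {p : ℕ} {c : S ⊕ ℕ} (he : e.eval s = some p)
    (hl : l.eval s = some c) : (Alg.trans e n l).eval s =
      if p = 0 then some 1 else transVal (s.table p) s.sl (n.eval s) c := by
  simp only [Alg.trans, Exp.eval, Alg.top, Alg.root, ht, hr, decide_eq_true_eq, he, hl,
    Store.tableOf, Option.some.injEq, transVal, Option.bind_some]
  refine if_congr Iff.rfl rfl ?_
  by_cases hc : c = .inr 0
  · simp only [hc, decide_true, Bool.not_true, Bool.false_eq_true, if_false, ne_eq,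
      not_true_eq_false]
    cases hb : nextNumber (s.table p).keys (n.eval s) with
    | none => simp
    | some b =>
      simp only [Option.map_some, reduceCtorEq, if_false, Option.bind_some]
      refine if_congr ?_ rfl rfl
      cases hm : maxNumber (s.table p).keys with
      | none => simp
      | some m => simp [eq_comm]
  · simp [hc]

end Eval

end PDAWG

namespace PDAWG

-- Loops that redirect edges along the chain of suffixes.

section Loops

variable {S P : Type} [DecidableEq S] [DecidableEq P]

/-- The store `s` with other dictionaries, and with `u` at the node `p`. -/
def Store.moveTo (s : Store S P) (tb : ℕ → AList (fun _ : S ⊕ ℕ => ℕ)) (p : ℕ) : Store S P :=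
  { s with table := tb, nodeReg := Function.update s.nodeReg .u (some p) }

open Classical in
/-- The dictionaries `tb'` arise from `tb` by directing the edges with label `Z(a, len(p))` from the
nodes `p` on the chain with `lo < len(p) ≤ hi` to `tgt`. -/
def Redirected (w : List (S ⊕ ℕ)) (a : S ⊕ ℕ) (N : ℕ) (X : ℕ → List (S ⊕ ℕ)) (len : ℕ → ℤ)
    (tb tb' : ℕ → AList (fun _ : S ⊕ ℕ => ℕ)) (lo hi : ℤ) (tgt : ℕ) : Prop :=
  ∀ p c, (tb' p).lookup c =
    if 1 ≤ p ∧ OnChain w N X p ∧ lo < len p ∧ len p ≤ hi ∧ c = zeta a (len p) then some tgt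
    else (tb p).lookup c

variable {w : List (S ⊕ ℕ)} {a : S ⊕ ℕ} {N : ℕ} {X : ℕ → List (S ⊕ ℕ)}
  {tb : ℕ → AList (fun _ : S ⊕ ℕ => ℕ)} {sl : ℕ → Option ℕ} {len : ℕ → ℤ}

theorem length_entries {α β : Type} (U : AList (fun _ : α => β)) :
    U.entries.length = U.keys.length := by simp [AList.keys, List.keys]

theorem length_le_of_keys {α β : Type} [DecidableEq α] {T U : AList (fun _ : α => β)} {c₀ : α}
    (h : ∀ c ∈ U.keys, c ∈ T.keys ∨ c = c₀) : U.entries.length ≤ T.entries.length + 1 := by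
  rw [length_entries, length_entries, ← List.toFinset_card_of_nodup U.keys_nodup,
    ← List.toFinset_card_of_nodup T.keys_nodup]
  refine le_trans (Finset.card_le_card ?_) (Finset.card_insert_le c₀ T.keys.toFinset)
  intro c hc
  rw [List.mem_toFinset] at hc
  rw [Finset.mem_insert, List.mem_toFinset]
  exact (h c hc).symm

theorem Redirected.length_le {tb tb' : ℕ → AList (fun _ : S ⊕ ℕ => ℕ)} {lo hi : ℤ} {tgt : ℕ}
    (h : Redirected w a N X len tb tb' lo hi tgt) (p : ℕ) :
    (tb' p).entries.length ≤ (tb p).entries.length + 1 := by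
  refine length_le_of_keys (c₀ := zeta a (len p)) fun c hc => ?_
  obtain ⟨q, hq⟩ := mem_keys_iff.1 hc
  rw [h] at hq
  split_ifs at hq with h1
  · exact Or.inr h1.2.2.2.2
  · exact Or.inl (mem_keys_iff.2 ⟨q, hq⟩)

open Classical in
/-- Redirection of one more edge. -/
theorem Redirected.step {tb₀ tb' : ℕ → AList (fun _ : S ⊕ ℕ => ℕ)}
    {hi : ℤ} {tgt p q : ℕ} (h : Redirected w a N X len tb₀ tb' (len p) hi tgt) (hp : 1 ≤ p)
    (hc : OnChain w N X p) (hhi : len p ≤ hi) (hlt : len q < len p)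
    (hq : ∀ q', 1 ≤ q' → OnChain w N X q' → len q < len q' → len q' ≤ len p → q' = p) :
    Redirected w a N X len tb₀
      (Function.update tb' p ((tb' p).insert (zeta a (len p)) tgt)) (len q) hi tgt := by
  intro p' c
  by_cases hpp : p' = p
  · subst hpp
    rw [Function.update_self]
    by_cases hcc : c = zeta a (len p')
    · subst hcc
      rw [AList.lookup_insert, if_pos ⟨hp, hc, hlt, hhi, rfl⟩]
    · rw [AList.lookup_insert_ne hcc, h]
      simp [hcc]
  · rw [Function.update_of_ne hpp, h]
    refine if_congr ?_ rfl rfl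
    refine and_congr_right fun h1 => and_congr_right fun h2 => ?_
    constructor
    · rintro ⟨h3, h4⟩; exact ⟨by omega, h4⟩
    · rintro ⟨h3, h4⟩
      refine ⟨?_, h4⟩
      by_contra h5
      exact hpp (hq p' h1 h2 h3 (not_lt.1 h5))

theorem Redirected.refl (hi : ℤ) (tgt : ℕ) : Redirected w a N X len tb tb hi hi tgt := by
  intro p c; rw [if_neg]; omega

/-- A loop that redirects edges while it follows the chain of suffix links. -/
theorem run_loop (G : Graph w N X tb sl len) {s : Store S P} {M : ℕ}
    {tb₀ : ℕ → AList (fun _ : S ⊕ ℕ => ℕ)} (hM : ∀ p, (tb₀ p).entries.length + 1 ≤ M)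
    (hlast : s.last.entries.length ≤ M)
    (hlen : ∀ p < N, s.len p = len p) (hsl : ∀ p < N, s.sl p = sl p)
    (ha : s.labReg .a = some a) {x : NodeReg} (hx : x ≠ .u) {tgt : ℕ} (hreg : s.nodeReg x = some tgt)
    {b : Exp .bool} {good : ℕ → Prop} {hi : ℤ} (h0 : ¬ good 0)
    (hb : ∀ p tb', OnChain w N X p → len p ≤ hi →
      Redirected w a N X len tb₀ tb' (len p) hi tgt → 
      (b.eval (s.moveTo tb' p) = true ↔ good p))
    {C : Finset ℕ} (hC : ∀ p, 1 ≤ p → OnChain w N X p → (X p).length ∈ C)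
    {p : ℕ} {tb' : ℕ → AList (fun _ : S ⊕ ℕ => ℕ)} (hp : OnChain w N X p) (hphi : len p ≤ hi)
    (hr : Redirected w a N X len tb₀ tb' (len p) hi tgt) :
    ∃ tb'' p' n, Run M (.loop b (.atom (.setChild Alg.u Alg.aAtU (.nodeVar x)) ;;
        .atom (.setNode .u (.sl Alg.u)))) (s.moveTo tb' p) (s.moveTo tb'' p') n ∧
      OnChain w N X p' ∧ len p' ≤ len p ∧ Redirected w a N X len tb₀ tb'' (len p') hi tgt ∧
      ¬ good p' ∧ (∀ q, 1 ≤ q → OnChain w N X q → len p' < len q → len q ≤ len p → good q) ∧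
      n ≤ (b.weight + 11) * (1 + (C.filter fun l : ℕ => len p' < (l : ℤ) ∧ (l : ℤ) ≤ len p).card) := by
  have hsmall : ∀ p lo tb', Redirected w a N X len tb₀ tb' lo hi tgt → Small (s.moveTo tb' p) M :=
    fun p lo tb' h => ⟨fun q => (h.length_le q).trans (hM q), hlast⟩
  -- Lengths on the chain start at `-1`, so the measure is a natural number that drops with every
  -- link.
  induction hk : (len p + 1).toNat using Nat.strong_induction_on generalizing p tb' with
  | _ k ih =>
    have hs := hsmall p _ _ hr
    by_cases hg : good p
    · have hp1 : 1 ≤ p := by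
        rcases Nat.eq_zero_or_pos p with rfl | h
        · exact absurd hg h0
        · exact h
      obtain ⟨q, h1, h2, h3, h4, h5, h6⟩ := G.chain_step hp1 hp
      have hr' := hr.step hp1 hp hphi h3 h5
      have hs' := hsmall p _ _ hr'
      have hru : ∀ tb', (s.moveTo tb' p).nodeReg .u = some p := fun tb' => by simp [Store.moveTo]
      have e1 : Alg.u.eval (s.moveTo tb' p) = some p := hru _
      have e2 : Alg.aAtU.eval (s.moveTo tb' p) = some (zeta a (len p)) := by
        simp only [Alg.aAtU, Alg.a, Exp.eval, e1]
        simp [Store.moveTo, ha, hlen p hp.1]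
      have e3 : (Exp.nodeVar x).eval (s.moveTo tb' p) = some tgt := by
        simp [Exp.eval, Store.moveTo, hx, hreg]
      have r1 := Run.setChild hs e1 e2 e3
      have r2 := Run.setNode (s := (s.moveTo tb' p).putChild p (zeta a (len p)) tgt)
        (M := M) hs' .u (e := .sl Alg.u) (o := some q) (by
          simp [Exp.eval, Alg.u, Store.putChild, Store.moveTo, hsl p hp.1, h1])
      have e4 : ((s.moveTo tb' p).putChild p (zeta a (len p)) tgt).putNode .u (some q) =
          s.moveTo (Function.update tb' p ((tb' p).insert (zeta a (len p)) tgt)) q := by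
        simp [Store.putNode, Store.putChild, Store.moveTo]
      rw [e4] at r2
      obtain ⟨tb'', p', n, r3, h7, h8, h9, h10, h11, h12⟩ := ih _ (by omega) h2 (by omega) hr' rfl
      refine ⟨tb'', p', _, Run.loopTrue hs ((hb p tb' hp hphi hr).2 hg) (r1.seq r2) r3, h7,
        by omega, h9, h10, fun q' hq1 hq2 hq3 hq4 => ?_, ?_⟩
      · by_cases hqq : len q' ≤ len q
        · exact h11 q' hq1 hq2 hq3 hqq
        · rwa [h5 q' hq1 hq2 (not_le.1 hqq) hq4]
      · have hlp := G.len p hp1 hp.1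
        -- The iteration at `p` is charged to the length of `X p`, which lies in the larger interval
        -- and above `len q`.
        have hcard : (C.filter fun l : ℕ => len p' < (l : ℤ) ∧ (l : ℤ) ≤ len q).card + 1 ≤
            (C.filter fun l : ℕ => len p' < (l : ℤ) ∧ (l : ℤ) ≤ len p).card := by
          rw [← Finset.card_insert_of_notMem (a := (X p).length)]
          · refine Finset.card_le_card fun l hl => ?_
            rw [Finset.mem_insert, Finset.mem_filter] at hl
            rw [Finset.mem_filter]
            rcases hl with rfl | hl
            · exact ⟨hC p hp1 hp, by omega, by omega⟩
            · exact ⟨hl.1, by omega, by omega⟩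
          · rw [Finset.mem_filter]; omega
        have e5 : Alg.u.weight + Alg.aAtU.weight + (Exp.nodeVar x).weight + 1 +
            ((Exp.sl Alg.u).weight + 1) = 10 := rfl
        have := Nat.mul_le_mul_left (b.weight + 11) hcard
        linarith
    · refine ⟨tb', p, _, Run.loopFalse hs ?_, hp, le_rfl, hr, hg, fun q _ _ h1 h2 => by omega, ?_⟩
      · rw [← Bool.not_eq_true, hb p tb' hp hphi hr]; exact hg
      · nlinarith [Nat.zero_le (C.filter fun l : ℕ => len p < (l : ℤ) ∧ (l : ℤ) ≤ len p).card,
          Nat.zero_le b.weight]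

end Loops

end PDAWG

namespace PDAWG

-- Edges into the new sink and the search for the longest repeated suffix.

section Phase

variable {S P : Type} [DecidableEq S] [DecidableEq P]

/-- The store `s` is ready for the extension of the graph of `w` by `a`: the new sink `N` exists. -/
structure Ready (w : List (S ⊕ ℕ)) (a : S ⊕ ℕ) (N : ℕ) (X : ℕ → List (S ⊕ ℕ))
    (tb : ℕ → AList (fun _ : S ⊕ ℕ => ℕ)) (sl : ℕ → Option ℕ) (len : ℕ → ℤ) (M : ℕ)
    (s : Store S P) : Prop where
  graph : Graph w N X tb sl len
  enc : reenc (w ++ [a]) = w ++ [a]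
  size : s.size = N + 1
  top : s.nodeReg .top = some 0
  root : s.nodeReg .root = some 1
  sink : s.nodeReg .sink = some N
  lab : s.labReg .a = some a
  len : ∀ p < N, s.len p = len p
  len_sink : s.len N = w.length + 1
  sl : ∀ p < N, s.sl p = sl p
  sl_sink : s.sl N = none
  small : ∀ p, (tb p).entries.length + 2 ≤ M
  small_last : s.last.entries.length ≤ M

variable {w : List (S ⊕ ℕ)} {a : S ⊕ ℕ} {N : ℕ} {X : ℕ → List (S ⊕ ℕ)}
  {tb : ℕ → AList (fun _ : S ⊕ ℕ => ℕ)} {sl : ℕ → Option ℕ} {len : ℕ → ℤ} {M : ℕ} {s : Store S P}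

/-- `X p` is the longest string of its class, so the next longer suffix of `w`, if there is one,
lies in another class. This lets loop iterations be counted by breaks. -/
theorem mem_insert_breaks (G : Graph w N X tb sl len) {p : ℕ} (hp : 1 ≤ p) (hc : OnChain w N X p) :
    (X p).length ∈ insert w.length (breaks w) := by
  obtain ⟨h1, h2, _⟩ := G.eq_rsuf hp hc
  rw [Finset.mem_insert, mem_breaks, or_iff_not_imp_left]
  intro h3
  have h4 : (X p).length < w.length := by omega
  refine ⟨h4, fun e => ?_⟩
  rw [← h1] at e
  have := (G.isMax p hp hc.1).2 _ e.symm
  rw [rsuf_length h4] at this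
  omega

theorem rsuf_snoc_mono {S : Type} {w : List (S ⊕ ℕ)} {a : S ⊕ ℕ} {l m : ℕ} (h : l ≤ m) (hm : m ≤ w.length) :
    RSuf (rsuf w l ++ [zeta a l]) (rsuf w m ++ [zeta a m]) := by
  rw [← rsuf_snoc hm, ← rsuf_snoc (h.trans hm)]
  exact rsuf_mono (by omega) (by simp; omega)

/-- The loop tests the shortest element of each node on the chain: if its extension does not occur
in `w`, no longer suffix extends either. It stops at the dummy node or at the first node with an
extensible shortest element. -/
theorem Ready.run_sinkEdges (R : Ready w a N X tb sl len M s) {z : ℕ} (hz : 1 ≤ z) (hzN : z < N)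
    (hzw : X z = w) :
    ∃ tb₁ p n, Run M Alg.sinkEdges (s.moveTo tb z) (s.moveTo tb₁ p) n ∧ OnChain w N X p ∧
      Redirected w a N X len tb tb₁ (len p) w.length N ∧
      (∀ l : ℕ, len p < l → l ≤ w.length → ¬ Occ w (rsuf w l ++ [zeta a l])) ∧
      (p = 0 ∨ ∃ l : ℕ, (l : ℤ) ≤ len p ∧ RPos w (rsuf w l) = RPos w (X p) ∧
        Occ w (rsuf w l ++ [zeta a l])) ∧
      n ≤ 100 * (1 + ((insert w.length (breaks w)).filter
        fun l : ℕ => len p < (l : ℤ) ∧ (l : ℤ) ≤ w.length).card) := by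
  have G := R.graph
  have hlz : len z = w.length := by rw [G.len z hz hzN, hzw]
  have hcz : OnChain w N X z := ⟨hzN, Or.inr (by rw [hzw]; exact hzw ▸ (G.isMax z hz hzN).1.refl)⟩
  -- Here `l` is the length of the shortest element of the node, one more than the length of its
  -- link.
  let good : ℕ → Prop := fun p => 1 ≤ p ∧ ∀ q (l : ℕ), sl p = some q → (l : ℤ) = len q + 1 →
    ¬ Occ w (rsuf w l ++ [zeta a l])
  have hb : ∀ p tb', OnChain w N X p → len p ≤ w.length →
      Redirected w a N X len tb tb' (len p) w.length N →
      ((Exp.eqNode (Alg.trans Alg.u Alg.minLen (.zeta Alg.a Alg.minLen)) .null).eval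
        (s.moveTo tb' p) = true ↔ good p) := by
    intro p tb' hp hpl hr
    have e1 : Alg.u.eval (s.moveTo tb' p) = some p := by simp [Alg.u, Exp.eval, Store.moveTo]
    have e2 : (s.moveTo tb' p).nodeReg .top = some 0 := by simp [Store.moveTo, R.top]
    have e3 : (s.moveTo tb' p).nodeReg .root = some 1 := by simp [Store.moveTo, R.root]
    rcases Nat.eq_zero_or_pos p with rfl | hp1
    · have e5 : (Exp.zeta Alg.a Alg.minLen).eval (s.moveTo tb' 0) =
          some (zeta a (Alg.minLen.eval (s.moveTo tb' 0))) := by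
        simp [Exp.eval, Alg.a, Store.moveTo, R.lab]
      have e6 := eval_trans e2 e3 (n := Alg.minLen) e1 e5
      rw [if_pos rfl] at e6
      rw [eval_eqNode, e6]
      simp [Exp.eval, good]
    · obtain ⟨q, h1, h2, h3, h4, h5, h6⟩ := G.chain_step hp1 hp
      obtain ⟨l, hl⟩ : ∃ l : ℕ, (l : ℤ) = len q + 1 := ⟨(len q + 1).toNat, by omega⟩
      obtain ⟨hXp, hXl, hXlen⟩ := G.eq_rsuf hp1 hp
      have hlw : l ≤ w.length := by omega
      have e4 : Alg.minLen.eval (s.moveTo tb' p) = l := by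
        have e7 : (Exp.sl Alg.u).eval (s.moveTo tb' p) = some q := by
          simp only [Exp.eval, e1]; simp [Store.moveTo, R.sl p hp.1, h1]
        simp only [Alg.minLen, Exp.eval]
        simp only [Exp.eval] at e7
        rw [e7, hl]
        simp [Store.moveTo, R.len q h2.1]
      have e5 : (Exp.zeta Alg.a Alg.minLen).eval (s.moveTo tb' p) = some (zeta a l) := by
        simp only [Exp.eval, e4]; simp [Alg.a, Exp.eval, Store.moveTo, R.lab]
      have e6 := eval_trans e2 e3 (n := Alg.minLen) e1 e5
      rw [if_neg (by omega), e4] at e6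
      have hll := rsuf_length hlw
      -- Only nodes longer than `p` have been redirected so far, so the dictionary of `p` still
      -- describes the graph of `w`.
      have h7 := G.transVal_spec hp1 hp.1 (t := (s.moveTo tb' p).table p)
        (sl' := (s.moveTo tb' p).sl) (y := rsuf w l) (c := zeta a l)
        (by intro c; exact (hr p c).trans (if_neg (by omega))) R.sl
        (by rw [hXp]; exact rsuf_mono (by omega) hXl) ((h6 l (by omega)).1 (by omega))
        (by rw [hll]; exact zeta_zeta _ le_rfl)
      rw [hll] at h7
      have h8 : good p ↔ ¬ Occ w (rsuf w l ++ [zeta a l]) := by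
        constructor
        · intro h; exact h.2 q l h1 hl
        · intro h
          refine ⟨hp1, fun q' l' hq' hl' => ?_⟩
          rw [h1] at hq'
          obtain rfl : q = q' := by simpa using hq'
          obtain rfl : l = l' := by omega
          exact h
      rw [h8, eval_eqNode, e6]
      refine ⟨h7.1, fun h => ?_⟩
      by_contra hne
      obtain ⟨q', hq'⟩ := Option.ne_none_iff_exists'.1 hne
      obtain ⟨h9, h10, h11⟩ := h7.2 q' hq'
      rw [Occ, h11] at h
      exact h (G.isMax q' h9 h10).1
  obtain ⟨tb₁, p, n, h1, h2, h3, h4, h5, h6, h7⟩ := run_loop G (s := s) (M := M) (tb₀ := tb)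
    (fun p => by have := R.small p; omega) R.small_last R.len R.sl R.lab
    (x := .sink) (by simp) R.sink (good := good) (by simp [good]) hb
    (C := insert w.length (breaks w)) (fun p hp hc => mem_insert_breaks G hp hc) hcz hlz.le
    (by rw [hlz]; exact Redirected.refl _ _)
  refine ⟨tb₁, p, n, h1, h2, h4, fun l hl hlw => ?_, ?_, ?_⟩
  · obtain ⟨q, hq, hqc, hlq, hqr⟩ := G.chain_cover hlw
    obtain ⟨hXp, hXl, hXlen⟩ := G.eq_rsuf hq hqc
    have hg := h6 q hq hqc (by omega) (by omega)
    obtain ⟨q', g1, g2, g3, g4, g5, g6⟩ := G.chain_step hq hqc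
    obtain ⟨l', hl'⟩ : ∃ l : ℕ, (l : ℤ) = len q' + 1 := ⟨(len q' + 1).toNat, by omega⟩
    have := (g6 l hlq).2 hqr
    exact fun ho => hg.2 q' l' g1 hl' (ho.of_rsuf (rsuf_snoc_mono (by omega) hlw))
  · rcases Nat.eq_zero_or_pos p with rfl | hp1
    · exact Or.inl rfl
    right
    obtain ⟨q', g1, g2, g3, g4, g5, g6⟩ := G.chain_step hp1 h2
    obtain ⟨l', hl'⟩ : ∃ l : ℕ, (l : ℤ) = len q' + 1 := ⟨(len q' + 1).toNat, by omega⟩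
    refine ⟨l', by omega, (g6 l' (by omega)).1 (by omega), ?_⟩
    by_contra hno
    refine h5 ⟨hp1, fun q l hq hl => ?_⟩
    rw [g1] at hq
    obtain rfl : q' = q := by simpa using hq
    obtain rfl : l' = l := by omega
    exact hno
  · rw [hlz] at h7
    refine h7.trans (Nat.mul_le_mul_right _ ?_)
    decide

-- If the final node has an edge with the label `Z(a, len p)`, the repeated suffix is its longest
-- string extended by that label. Otherwise the repeated suffix extends a shorter member of the
-- class by `0`, with the length given by `IsRex.isLRS`, and the node itself still receives an edge
-- to the sink. In both cases the redirected nodes are exactly those on the chain of length at least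
-- `|r|`.
open Classical in
theorem Ready.run_findLRS (R : Ready w a N X tb sl len M s) {tb₁ : ℕ → AList (fun _ : S ⊕ ℕ => ℕ)}
    {p : ℕ} (hp : OnChain w N X p) (hr : Redirected w a N X len tb tb₁ (len p) w.length N)
    (hno : ∀ l : ℕ, len p < l → l ≤ w.length → ¬ Occ w (rsuf w l ++ [zeta a l]))
    (hoc : p = 0 ∨ ∃ l : ℕ, (l : ℤ) ≤ len p ∧ RPos w (rsuf w l) = RPos w (X p) ∧
        Occ w (rsuf w l ++ [zeta a l])) :
    ∃ tb₂ p₂ r v, Run M Alg.findLRS (s.moveTo tb₁ p)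
        (((s.putNum .k (r.length : ℤ)).putNode .v (some v)).moveTo tb₂ p₂) 100 ∧
      IsLRS w a r ∧ 1 ≤ v ∧ v < N ∧ RPos w (X v) = RPos w r ∧ OnChain w N X p₂ ∧
      len p₂ < r.length ∧
      (∀ q, 1 ≤ q → OnChain w N X q → len q < r.length → len q ≤ len p₂) ∧
      Redirected w a N X len tb tb₂ ((r.length : ℤ) - 1) w.length N := by
  have G := R.graph
  have hsm : ∀ (σ : Store S P) tb' lo, σ.last = s.last → σ.table = tb' →
      Redirected w a N X len tb tb' lo w.length N → Small σ M := by
    rintro σ tb' lo h1 rfl h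
    exact ⟨fun q => (h.length_le q).trans (by have := R.small q; omega), by rw [h1]; exact R.small_last⟩
  have hle : ∀ z, RSuf z (w ++ [a]) → Occ w z → (z.length : ℤ) ≤ len p + 1 := by
    intro z hz ho
    rcases z.eq_nil_or_concat' with rfl | ⟨z, c, rfl⟩
    · rcases Nat.eq_zero_or_pos p with rfl | hp1
      · simp [G.len_zero]
      · have := G.len p hp1 hp.1; simp [this]; omega
    rw [RSuf.snoc] at hz
    by_contra hlt
    refine hno z.length (by simp at hlt; omega) hz.1.length_le ?_
    rw [← hz.1.eq_rsuf, ← hz.2]; exact ho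
  have e1 : Alg.u.eval (s.moveTo tb₁ p) = some p := by simp [Alg.u, Exp.eval, Store.moveTo]
  have e2 : (s.moveTo tb₁ p).nodeReg .top = some 0 := by simp [Store.moveTo, R.top]
  have e3 : (s.moveTo tb₁ p).nodeReg .root = some 1 := by simp [Store.moveTo, R.root]
  have e4 : Alg.aAtU.eval (s.moveTo tb₁ p) = some (zeta a (len p)) := by
    simp only [Alg.aAtU, Alg.a, Exp.eval, e1]
    simp [Store.moveTo, R.lab, R.len p hp.1]
  have e5 : (Exp.len Alg.u).eval (s.moveTo tb₁ p) = len p := by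
    simp only [Exp.eval, e1]; simp [Store.moveTo, R.len p hp.1]
  have hs0 := hsm (s.moveTo tb₁ p) tb₁ _ rfl rfl hr
  have e6 := eval_child e2 e3 Alg.u Alg.aAtU
  rw [e1, e4, Option.bind_some] at e6
  -- the first branch
  have branch : ∀ v r, (Alg.child Alg.u Alg.aAtU).eval (s.moveTo tb₁ p) = some v →
      (r.length : ℤ) = len p + 1 → IsLRS w a r → 1 ≤ v → v < N → RPos w (X v) = RPos w r →
      ∃ tb₂ p₂ r v, Run M Alg.findLRS (s.moveTo tb₁ p)
        (((s.putNum .k (r.length : ℤ)).putNode .v (some v)).moveTo tb₂ p₂) 100 ∧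
      IsLRS w a r ∧ 1 ≤ v ∧ v < N ∧ RPos w (X v) = RPos w r ∧ OnChain w N X p₂ ∧
      len p₂ < r.length ∧
      (∀ q, 1 ≤ q → OnChain w N X q → len q < r.length → len q ≤ len p₂) ∧
      Redirected w a N X len tb tb₂ ((r.length : ℤ) - 1) w.length N := by
    intro v r hv hrl hR hv1 hvN hvr
    refine ⟨tb₁, p, r, v, ?_, hR, hv1, hvN, hvr, hp, by omega, fun q _ _ _ => by omega, ?_⟩
    · have r1 := Run.setNum hs0 .k (e := .add (.len Alg.u) (.lit 1)) (o := (r.length : ℤ))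
        (by rw [hrl, ← e5]; rfl)
      have r2 := Run.setNode (hs0.of_eq (s' := (s.moveTo tb₁ p).putNum .k (r.length : ℤ)) rfl rfl) .v
        (e := Alg.child Alg.u Alg.aAtU) (o := some v) hv
      have r3 := Run.condTrue (b := .not (.eqNode (Alg.child Alg.u Alg.aAtU) .null))
        (d := .atom (.setNum .k Alg.lrsLen) ;;
          .atom (.setNode .v (Alg.trans Alg.u (.sub Alg.k (.lit 1)) .zero)) ;;
          .atom (.setChild Alg.u Alg.aAtU Alg.sink) ;; .atom (.setNode .u (.sl Alg.u)))
        hs0 (by rw [eval_not, eval_eqNode, hv]; simp [Exp.eval]) (r1.seq r2)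
      have e7 : ((s.moveTo tb₁ p).putNum .k (r.length : ℤ)).putNode .v (some v) =
          ((s.putNum .k (r.length : ℤ)).putNode .v (some v)).moveTo tb₁ p := by
        simp only [Store.putNode, Store.putNum, Store.moveTo]
        rw [Function.update_comm (by simp)]
      rw [e7] at r3
      exact r3.mono (by decide)
    · rw [hrl, add_sub_cancel_right]; exact hr
  rcases Nat.eq_zero_or_pos p with rfl | hp1
  -- At the dummy node even the extension of the empty string is new, so the repeated suffix is
  -- empty and its node is the source.
  · have h1 : IsLRS w a [] := ⟨RSuf.nil _, occ_of_rsuf (RSuf.nil _), fun z hz ho => by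
      have := hle z hz ho; rw [G.len_zero] at this; simp; simpa using this⟩
    refine branch 1 [] (by rw [e6, if_pos rfl]) (by simp [G.len_zero]) h1 le_rfl
      (by have := G.two_le; omega) (by rw [G.X_one])
  obtain ⟨hXp, hXl, hXlen⟩ := G.eq_rsuf hp1 hp
  have hXw := hp.2.resolve_left (by omega)
  rw [if_neg (by simp; omega)] at e6
  have hlk : ∀ c, (tb₁ p).lookup c = (tb p).lookup c := fun c => (hr p c).trans (if_neg (by omega))
  change _ = (tb₁ p).lookup _ at e6
  rw [hlk] at e6
  cases hv : (tb p).lookup (zeta a (len p)) with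
  | some v =>
    rw [hv] at e6
    obtain ⟨h1, h2, h3⟩ := G.edge_some p _ v hp1 hp.1 hv
    refine branch v (X p ++ [zeta a (len p)]) e6 (by simp [hXlen]) ⟨?_, ?_, fun z hz ho => ?_⟩ h1 h2
      h3.symm
    · rw [RSuf.snoc, ← hXlen]; exact ⟨hXw, rfl⟩
    · rw [Occ, h3]; exact (G.isMax v h1 h2).1
    · have := hle z hz ho; simp; omega
  | none =>
    rw [hv] at e6
    have hnx := G.edge_none p _ hp1 hp.1 hv
    obtain ⟨l, hl1, hl2, hl3⟩ := hoc.resolve_left (by omega)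
    have hlw : l ≤ w.length := by omega
    have hL : IsRex w (X p) (tb₁ p).keys := isRex_of_lookup (X := X) (fun c q hq => by
        rw [hlk] at hq
        obtain ⟨h1, h2, h3⟩ := G.edge_some p c q hp1 hp.1 hq
        exact ⟨G.isMax q h1 h2, h3⟩)
      (fun c hc => G.edge_none p c hp1 hp.1 (by rw [← hlk]; exact hc))
    have hll := rsuf_length hlw
    have hlX : RSuf (rsuf w l) (X p) := by rw [hXp]; exact rsuf_mono (by omega) hXl
    obtain ⟨m, n, k, rfl, hn, hk, hlk1, hkX, hmk, hR⟩ := hL.isLRS (a := a) (y := rsuf w l) hXw hlX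
      (fun i _ => by rw [hl2]) (by rw [hll]; exact hl3) (by rw [← hXlen]; exact hnx)
    rw [hll] at hlk1
    set r := rsuf (X p) k ++ [Sum.inr 0] with hrdef
    have hrl : r.length = k + 1 := by rw [hrdef]; simp [rsuf_length hkX.le]
    have e8 : Alg.lrsLen.eval (s.moveTo tb₁ p) = (r.length : ℤ) := by
      have g1 : (Exp.maxNum Alg.u).eval (s.moveTo tb₁ p) = some (.inr n) := by
        simp only [Exp.eval, e1]; simp [Store.moveTo, Store.tableOf, hn]
      have g2 : Alg.a.eval (s.moveTo tb₁ p) = some (.inr m) := by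
        simp [Alg.a, Exp.eval, Store.moveTo, R.lab]
      have g3 : (Exp.ite (.prec Alg.a (.maxNum Alg.u)) Alg.a (.maxNum Alg.u)).eval (s.moveTo tb₁ p) =
          some (.inr (k + 1)) := by
        have g4 : (Exp.prec Alg.a (.maxNum Alg.u)).eval (s.moveTo tb₁ p) =
            decide (precRank m < precRank n) := by
          simp only [Exp.eval] at g1 ⊢; rw [g1, g2]
        rw [Exp.eval, g4, g1, g2, hk]
        by_cases hc : precRank m < precRank n <;> simp [hc]
      simp only [Alg.lrsLen]
      rw [Exp.eval, g3, hrl]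
    have r1 := Run.setNum hs0 .k e8
    set s1 := (s.moveTo tb₁ p).putNum .k (r.length : ℤ) with hs1
    have hs1' : Small s1 M := hs0.of_eq rfl rfl
    have hkl := rsuf_length hkX.le
    have hkeq : RPos w (rsuf (X p) k) = RPos w (X p) := by
      refine Set.Subset.antisymm ?_ (RPos_mono (rsuf_rsuf hkX.le))
      rw [← hl2]; exact RPos_mono (hlX.of_le (rsuf_rsuf hkX.le) (by rw [hll, hkl]; exact hlk1))
    have htr := G.transVal_spec hp1 hp.1 (t := tb₁ p) hlk (sl' := s.sl) R.sl
        (y := rsuf (X p) k) (c := .inr 0) (rsuf_rsuf hkX.le) hkeq (zeta_inr_zero _)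
    rw [hkl] at htr
    obtain ⟨v, hv⟩ := Option.ne_none_iff_exists'.1 fun h => htr.1 h hR.occ
    obtain ⟨hv1, hvN, hvr⟩ := htr.2 v hv
    have e9 : (Alg.trans Alg.u (.sub Alg.k (.lit 1)) .zero).eval s1 = some v := by
      have g1 : (Exp.sub Alg.k (.lit 1)).eval s1 = (k : ℤ) := by
        simp [Exp.eval, Alg.k, hs1, Store.putNum, hrl]
      rw [eval_trans (s := s1) (p := p) (c := .inr 0) e2 e3
        (by simp [hs1, Store.putNum, Store.moveTo, Alg.u, Exp.eval]) (by simp [Exp.eval]), if_neg (by omega), g1]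
      exact hv
    have r2 := Run.setNode hs1' .v e9
    set s2 := s1.putNode .v (some v) with hs2
    have hs2' : Small s2 M := hs1'.of_eq rfl rfl
    have r3 := Run.setChild (s := s2) hs2' (e := Alg.u) (l := Alg.aAtU) (f := Alg.sink) (p := p)
      (q := N) (a := zeta (.inr m) (len p))
      (by simp [hs2, hs1, Store.putNode, Store.putNum, Store.moveTo, Alg.u, Exp.eval])
      (by simp [hs2, hs1, Store.putNode, Store.putNum, Store.moveTo, Alg.aAtU, Alg.u, Alg.a,
            Exp.eval, R.lab, R.len p hp.1])
      (by simp [hs2, hs1, Store.putNode, Store.putNum, Store.moveTo, Alg.sink, Exp.eval, R.sink])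
    obtain ⟨q, h1, h2, h3, h4, h5, h6⟩ := G.chain_step hp1 hp
    have hr' := hr.step hp1 hp (by omega) h3 h5
    set s3 := s2.putChild p (zeta (.inr m) (len p)) N with hs3
    have hs3' : Small s3 M := hsm _ _ _ rfl rfl hr'
    have r4 := Run.setNode (s := s3) hs3' .u (e := .sl Alg.u) (o := some q)
      (by simp [hs3, hs2, hs1, Store.putNode, Store.putNum, Store.moveTo, Store.putChild, Alg.u,
            Exp.eval, R.sl p hp.1, h1])
    have r5 := Run.condFalse (b := .not (.eqNode (Alg.child Alg.u Alg.aAtU) .null))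
        (c := .atom (.setNum .k (.add (.len Alg.u) (.lit 1))) ;;
          .atom (.setNode .v (Alg.child Alg.u Alg.aAtU)))
        hs0 (by rw [← Bool.not_eq_true, eval_not, eval_eqNode, e6]; simp [Exp.eval])
        (r1.seq (r2.seq (r3.seq r4)))
    have e10 : s3.putNode .u (some q) = ((s.putNum .k (r.length : ℤ)).putNode .v (some v)).moveTo
        (Function.update tb₁ p ((tb₁ p).insert (zeta (.inr m) (len p)) N)) q := by
      simp only [hs3, hs2, hs1, Store.putNode, Store.putNum, Store.moveTo, Store.putChild]
      rw [Function.update_comm (a := NodeReg.v) (by simp), Function.update_idem,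
        Function.update_comm (by simp)]
    rw [e10] at r5
    have hlq : len q < l := (h6 l hl1).2 hl2
    refine ⟨_, q, r, v, r5.mono (by decide), hR, hv1, hvN, hvr.symm, h2, by omega,
      fun q' hq1 hq2 hq3 => ?_, ?_⟩
    · by_contra hc
      have := h5 q' hq1 hq2 (not_le.1 hc) (by omega)
      subst this; omega
    -- The lower bound is raised from `len q` to `|r| - 1`. This changes nothing, since `p` is the
    -- only node on the chain with length above `len q` and at most `len p`, and `len p` exceeds
    -- `|r| - 1`.
    · intro p' c
      rw [hr' p' c]
      refine if_congr ?_ rfl rfl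
      refine and_congr_right fun g1 => and_congr_right fun g2 => and_congr_left fun _ => ?_
      constructor
      · intro g3
        by_cases g4 : len p' ≤ len p
        · have := h5 p' g1 g2 g3 g4
          subst this; omega
        · omega
      · intro; omega

end Phase

end PDAWG

namespace PDAWG

-- Correctness of the graph after one letter.

section NewGraph

variable {S : Type} [DecidableEq S] {w : List (S ⊕ ℕ)} {a : S ⊕ ℕ} {N : ℕ}
  {X : ℕ → List (S ⊕ ℕ)} {tb : ℕ → AList (fun _ : S ⊕ ℕ => ℕ)} {sl : ℕ → Option ℕ} {len : ℕ → ℤ}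
  {r : List (S ⊕ ℕ)}

open Classical in
/-- The dictionaries `tb'` contain the final edges of the old nodes, where `v'` is the node of `r`. -/
def FinalEdges (w : List (S ⊕ ℕ)) (a : S ⊕ ℕ) (N : ℕ) (X : ℕ → List (S ⊕ ℕ)) (r : List (S ⊕ ℕ))
    (tb tb' : ℕ → AList (fun _ : S ⊕ ℕ => ℕ)) (v' : ℕ) : Prop :=
  ∀ p c, 1 ≤ p → p < N → (tb' p).lookup c =
    if RSuf (X p) w ∧ c = zeta a (X p).length then
      if r.length ≤ (X p).length then some N
      else if RPos w (X p ++ [c]) = RPos w r then some v' else (tb p).lookup c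
    else (tb p).lookup c

/-- The strings of the nodes of the new graph. -/
structure NewNodes (w : List (S ⊕ ℕ)) (a : S ⊕ ℕ) (N : ℕ) (X X' : ℕ → List (S ⊕ ℕ))
    (r : List (S ⊕ ℕ)) (v' : ℕ) : Prop where
  old : ∀ p < N, X' p = X p
  sink : X' N = w ++ [a]
  lrs : X' v' = r
  pos : 1 ≤ v'

-- A redirected edge spells a suffix of `w ++ [a]`: one longer than `r` belongs to the sink, one in
-- the old class of `r` to the new class of `r`. The remaining edges keep their targets, because
-- their strings are no suffixes or avoid the class that may be cut.
open Classical in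
theorem edge_some_old (G : Graph w N X tb sl len) (ha : reenc (w ++ [a]) = w ++ [a])
    (hr : IsLRS w a r) {tb' : ℕ → AList (fun _ : S ⊕ ℕ => ℕ)} {v' : ℕ}
    (hF : FinalEdges w a N X r tb tb' v') {X' : ℕ → List (S ⊕ ℕ)} (hX : NewNodes w a N X X' r v')
    {p : ℕ} (hp : 1 ≤ p) (hpN : p < N) {c : S ⊕ ℕ} {q : ℕ} (h : (tb' p).lookup c = some q) :
    ((1 ≤ q ∧ q < N) ∨ q = N ∨ q = v') ∧ RPos (w ++ [a]) (X p ++ [c]) = RPos (w ++ [a]) (X' q) := by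
  rw [hF p c hp hpN] at h
  have hsnoc : RSuf (X p ++ [c]) (w ++ [a]) ↔ RSuf (X p) w ∧ c = zeta a (X p).length := RSuf.snoc
  split_ifs at h with h1 h2 h3
  · obtain rfl : N = q := by simpa using h
    refine ⟨Or.inr (Or.inl rfl), ?_⟩
    rw [hX.sink]
    refine (RPos_append_eq_sink ha).2 ⟨hsnoc.2 h1, fun ho => ?_⟩
    have := hr.le _ (hsnoc.2 h1) ho
    simp at this; omega
  · obtain rfl : v' = q := by simpa using h
    exact ⟨Or.inr (Or.inr rfl), by rw [hX.lrs]; exact hr.edge_append_of_eq h3 (hsnoc.2 h1)⟩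
  · obtain ⟨h4, h5, h6⟩ := G.edge_some p c q hp hpN h
    refine ⟨Or.inl ⟨h4, h5⟩, ?_⟩
    rw [hX.old q h5]
    exact hr.edge_append_of_ne (G.isMax q h4 h5) h6 (hsnoc.2 h1) h3
  · obtain ⟨h4, h5, h6⟩ := G.edge_some p c q hp hpN h
    refine ⟨Or.inl ⟨h4, h5⟩, ?_⟩
    rw [hX.old q h5]
    exact edge_append_of_not (G.isMax q h4 h5) h6 (fun h => h1 (hsnoc.1 h))

open Classical in
theorem edge_none_old (G : Graph w N X tb sl len) (hr : IsLRS w a r)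
    {tb' : ℕ → AList (fun _ : S ⊕ ℕ => ℕ)} {v' : ℕ} (hF : FinalEdges w a N X r tb tb' v')
    {p : ℕ} (hp : 1 ≤ p) (hpN : p < N) {c : S ⊕ ℕ} (h : (tb' p).lookup c = none) :
    ¬ Occ (w ++ [a]) (X p ++ [c]) := by
  rw [hF p c hp hpN] at h
  have hsnoc : RSuf (X p ++ [c]) (w ++ [a]) ↔ RSuf (X p) w ∧ c = zeta a (X p).length := RSuf.snoc
  split_ifs at h with h1 h2 h3
  · exfalso
    refine G.edge_none p c hp hpN h ((hr.occ_iff (hsnoc.2 h1)).2 ?_)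
    simp; omega
  · rw [occ_append, not_or]
    exact ⟨G.edge_none p c hp hpN h, fun h => h1 (hsnoc.1 h)⟩

/-- The graph of `w ⬝ a`. -/
theorem Graph.snoc (G : Graph w N X tb sl len) (ha : reenc (w ++ [a]) = w ++ [a])
    (hr : IsLRS w a r) {tb' : ℕ → AList (fun _ : S ⊕ ℕ => ℕ)} {v' : ℕ}
    (hF : FinalEdges w a N X r tb tb' v') {X' : ℕ → List (S ⊕ ℕ)} (hX : NewNodes w a N X X' r v')
    {N' : ℕ} (hN' : ∀ p, p < N' ↔ p < N ∨ p = N ∨ p = v') (hvN : v' ≠ N)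
    (hinj : ∀ q, 1 ≤ q → q < N → X q = r → q = v')
    {len' : ℕ → ℤ} (hlen : ∀ p < N, len' p = len p) (hlenN : len' N = w.length + 1)
    (hlenv : len' v' = r.length) {sl' : ℕ → Option ℕ} (hslN : sl' N = some v')
    (hsl1 : ∀ p, 1 ≤ p → p < N → (RPos w (X p) = RPos w r → (X p).length ≤ r.length) →
      sl' p = sl p)
    (hsl2 : ∀ p, 1 ≤ p → p < N → RPos w (X p) = RPos w r → r.length < (X p).length →
      sl' p = some v')
    (hsl3 : N < v' → ∃ v, 1 ≤ v ∧ v < N ∧ RPos w (X v) = RPos w r ∧ r.length < (X v).length ∧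
      sl' v' = sl v)
    (ht0 : tb' 0 = ∅) (htN : tb' N = ∅) (htge : ∀ p, N' ≤ p → tb' p = ∅)
    (hv1 : N < v' → ∀ c q, (tb' v').lookup c = some q → 1 ≤ q ∧ q < N' ∧
      RPos (w ++ [a]) (r ++ [c]) = RPos (w ++ [a]) (X' q))
    (hv2 : N < v' → ∀ c, (tb' v').lookup c = none → ¬ Occ (w ++ [a]) (r ++ [c])) :
    Graph (w ++ [a]) N' X' tb' sl' len' := by
  have h2 := G.two_le
  have hpos := hX.pos
  -- Both outcomes of a phase are treated at once: `v' < N` if the node of `r` exists, `v' > N` if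
  -- it is split off. The condition `N < v'` marks the obligations of a newly created node.
  have hmem : ∀ p, p < N' → p < N ∨ p = N ∨ (p = v' ∧ N < v') := by
    intro p hp
    rcases (hN' p).1 hp with h | h | h
    · exact Or.inl h
    · exact Or.inr (Or.inl h)
    · omega
  have hsr : X' N ≠ r := by
    rw [hX.sink]; rintro rfl; exact not_occ_self hr.occ
  have hso : ∀ p, 1 ≤ p → p < N → X' p ≠ X' N := by
    intro p h1 h2 h
    rw [hX.old p h2, hX.sink] at h
    exact not_occ_self (a := a) (h ▸ (G.isMax p h1 h2).1)
  refine ⟨?_, ?_, ?_, ?_, ?_, ?_, ?_, ?_, ?_, ?_, ?_, ht0, htge⟩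
  · have := (hN' 1).2 (Or.inl (by omega)); omega
  · rw [hX.old 1 (by omega), G.X_one]
  · intro p hp1 hp
    rcases hmem p hp with h | rfl | ⟨rfl, _⟩
    · rw [hX.old p h]; exact (G.isMax p hp1 h).append
    · rw [hX.sink]; exact isMax_self ha
    · rw [hX.lrs]; exact hr.isMax
  · intro p q hp1 hp hq1 hq he
    rcases hmem p hp with h | rfl | ⟨rfl, h⟩ <;> rcases hmem q hq with h' | rfl | ⟨rfl, h'⟩
    · rw [hX.old p h, hX.old q h'] at he; exact G.inj p q hp1 h hq1 h' he
    · exact absurd he (hso p hp1 h)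
    · rw [hX.old p h, hX.lrs] at he; exact hinj p hp1 h he
    · exact absurd he.symm (hso q hq1 h')
    · rfl
    · rw [hX.lrs] at he; exact absurd he hsr
    · rw [hX.old q h', hX.lrs] at he; exact (hinj q hq1 h' he.symm).symm
    · rw [hX.lrs] at he; exact absurd he.symm hsr
    · rfl
  · intro x hx
    rcases hr.isMax_cases ha hx with h | rfl | rfl
    · obtain ⟨p, h1, h2, rfl⟩ := G.surj x h
      exact ⟨p, h1, (hN' p).2 (Or.inl h2), hX.old p h2⟩
    · exact ⟨N, by omega, (hN' N).2 (Or.inr (Or.inl rfl)), hX.sink⟩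
    · exact ⟨v', hpos, (hN' v').2 (Or.inr (Or.inr rfl)), hX.lrs⟩
  · rw [hlen 0 (by omega), G.len_zero]
  · intro p hp1 hp
    rcases hmem p hp with h | rfl | ⟨rfl, _⟩
    · rw [hX.old p h, hlen p h, G.len p hp1 h]
    · rw [hX.sink, hlenN]; simp
    · rw [hX.lrs, hlenv]
  · rw [hsl1 1 le_rfl (by omega) (by rw [G.X_one]; simp), G.sl_one]
  · intro p hp1 hp
    rcases hmem p hp with h | rfl | ⟨rfl, h⟩
    · by_cases hc : RPos w (X p) = RPos w r → (X p).length ≤ r.length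
      · obtain ⟨q, h3, h4, h5, h6⟩ := G.sl p hp1 h
        refine ⟨q, h3, (hN' q).2 (Or.inl h4), (hsl1 p (by omega) h hc).trans h5, ?_⟩
        rw [hX.old p h, hX.old q h4]
        exact hr.link_append (G.isMax p (by omega) h).1 h6 hc
      · push Not at hc
        refine ⟨v', hpos, (hN' v').2 (Or.inr (Or.inr rfl)), hsl2 p (by omega) h hc.1 hc.2, ?_⟩
        rw [hX.old p h, hX.lrs]
        exact hr.link_split (G.isMax p (by omega) h) hc.1 hc.2
    · refine ⟨v', hpos, (hN' v').2 (Or.inr (Or.inr rfl)), hslN, ?_⟩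
      rw [hX.sink, hX.lrs]
      exact hr.link_sink ha
    · obtain ⟨v, h3, h4, h5, h6, h7⟩ := hsl3 h
      have hv2 : 2 ≤ v := by
        by_contra hc
        obtain rfl : v = 1 := by omega
        rw [G.X_one] at h6; simp at h6
      obtain ⟨q, h8, h9, h10, h11⟩ := G.sl v hv2 h4
      refine ⟨q, h8, (hN' q).2 (Or.inl h9), h7.trans h10, ?_⟩
      rw [hX.lrs, hX.old q h9]
      exact hr.link_lrs (G.isMax v h3 h4) h5 h11
  · intro p c q hp1 hp he
    rcases hmem p hp with h | rfl | ⟨rfl, h⟩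
    · obtain ⟨h3, h4⟩ := edge_some_old G ha hr hF hX hp1 h he
      rw [hX.old p h]
      exact ⟨by omega, (hN' q).2 (by tauto), h4⟩
    · rw [htN] at he; simp at he
    · rw [hX.lrs]; exact hv1 h c q he
  · intro p c hp1 hp he
    rcases hmem p hp with h | rfl | ⟨rfl, h⟩
    · rw [hX.old p h]; exact edge_none_old G hr hF hp1 h he
    · rw [hX.sink]; intro ho; have := ho.length_le; simp at this
    · rw [hX.lrs]; exact hv2 h c he

open Classical in
/-- The edges of the node that is split off from `v`. -/
theorem split_edges (G : Graph w N X tb sl len) (ha : reenc (w ++ [a]) = w ++ [a])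
    (hr : IsLRS w a r) {tb' : ℕ → AList (fun _ : S ⊕ ℕ => ℕ)}
    (hF : FinalEdges w a N X r tb tb' (N + 1)) {X' : ℕ → List (S ⊕ ℕ)}
    (hX : NewNodes w a N X X' r (N + 1)) {v : ℕ} (hv : 1 ≤ v) (hvN : v < N)
    (hvr : RPos w (X v) = RPos w r) (hlt : r.length < (X v).length)
    {sl' : ℕ → Option ℕ} (hsl : ∀ p < N, sl' p = sl p) (hslN : sl' N = none)
    {t : AList (fun _ : S ⊕ ℕ => ℕ)}
    (ht : ∀ c, t.lookup c = if c = .inr 0 then transVal (tb' v) sl' r.length (.inr 0)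
      else if zeta c r.length = .inr 0 then none else (tb' v).lookup c) :
    (∀ c q, t.lookup c = some q → 1 ≤ q ∧ q < N + 2 ∧
      RPos (w ++ [a]) (r ++ [c]) = RPos (w ++ [a]) (X' q)) ∧
    ∀ c, t.lookup c = none → ¬ Occ (w ++ [a]) (r ++ [c]) := by
  have hG2 := G.two_le
  have hmax := G.isMax v hv hvN
  have hrv : RSuf r (X v) := hmax.rsuf_of_eq hvr.symm
  have hpos : ∀ i < (w ++ [a]).length, i ∈ RPos (w ++ [a]) r ↔ i ∈ RPos (w ++ [a]) (X v) := by
    intro i hi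
    simp only [List.length_append, List.length_singleton] at hi
    rw [mem_RPos_append_of_le (by omega), mem_RPos_append_of_le (by omega), hvr]
  -- the targets of the edges of `v`
  have hold : ∀ c q, (tb' v).lookup c = some q →
      (q = N ∧ RSuf (X v) w ∧ c = zeta a (X v).length) ∨ (2 ≤ q ∧ q < N ∧ Occ w (X v ++ [c]) ∧
        RPos w (X v ++ [c]) = RPos w (X q)) := by
    intro c q h
    rw [hF v c hv hvN] at h
    have hq : (tb v).lookup c = some q → (2 ≤ q ∧ q < N ∧ Occ w (X v ++ [c]) ∧
        RPos w (X v ++ [c]) = RPos w (X q)) := by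
      intro h
      obtain ⟨h1, h2, h3⟩ := G.edge_some v c q hv hvN h
      refine ⟨?_, h2, by rw [Occ, h3]; exact (G.isMax q h1 h2).1, h3⟩
      by_contra hc
      obtain rfl : q = 1 := by omega
      rw [G.X_one] at h3
      have h0 : 0 ∈ RPos w (X v ++ [c]) := by rw [h3, RPos_nil]; simp
      have := length_le_of_mem_RPos h0
      simp at this
    split_ifs at h with h1 h2 h3
    · exact Or.inl ⟨by simpa using h.symm, h1⟩
    · omega
    · omega
    · exact Or.inr (hq h)
  have hs : ∀ c q, (tb' v).lookup c = some q → IsMax (w ++ [a]) (X' q) ∧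
      RPos (w ++ [a]) (X v ++ [c]) = RPos (w ++ [a]) (X' q) := by
    intro c q h
    obtain ⟨h1, h2⟩ := edge_some_old G ha hr hF hX hv hvN h
    refine ⟨?_, h2⟩
    rcases h1 with h1 | rfl | rfl
    · rw [hX.old q h1.2]; exact (G.isMax q h1.1 h1.2).append
    · rw [hX.sink]; exact isMax_self ha
    · rw [hX.lrs]; exact hr.isMax
  have hn : ∀ c, (tb' v).lookup c = none → ¬ Occ (w ++ [a]) (X v ++ [c]) :=
    fun c h => edge_none_old G hr hF hv hvN h
  have htr := transVal_spec (c := .inr 0) (sl := sl') hs hn hrv hpos (zeta_inr_zero _) (by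
    intro b m q hq hm hbm hrb hrm _
    obtain ⟨q', hq'⟩ := mem_keys_iff.1 hm
    -- The link of the target is consulted only if two labels merge into `0` after `r`. Were the
    -- target the new sink, whose link is not yet set, then `r` followed by `0` would be a suffix of
    -- `w ++ [a]` and would occur in `w` through the other label, against the maximality of `r`.
    rcases hold _ _ hq with ⟨rfl, h1, h2⟩ | ⟨h1, h2, h3, h4⟩
    · exfalso
      obtain ⟨b', rfl, h3⟩ := zeta_eq_inr h2.symm
      obtain rfl : b = b' := by omega
      have h4 : Occ w (X v ++ [Sum.inr m]) := by
        rcases hold _ _ hq' with ⟨_, _, h5⟩ | ⟨_, _, h5, _⟩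
        · rw [← h2] at h5; exact absurd (Sum.inr_injective h5).symm hbm
        · exact h5
      have h5 : RSuf (r ++ [Sum.inr 0]) (X v ++ [Sum.inr m]) := by
        rw [RSuf.snoc]; exact ⟨hrv, (zeta_inr_eq_zero.2 (by omega)).symm⟩
      have h6 : RSuf (r ++ [Sum.inr 0]) (w ++ [Sum.inr b]) := by
        rw [RSuf.snoc]; exact ⟨hrv.trans h1, (zeta_inr_eq_zero.2 (by omega)).symm⟩
      have := hr.le _ h6 (h4.of_rsuf h5)
      simp at this
    · obtain ⟨z, h5, h6, h7, h8⟩ := G.sl q h1 h2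
      refine ⟨z, (hsl q h2).trans h7, ?_⟩
      rw [hX.old q h2, hX.old z h6]
      refine hr.link_append (G.isMax q (by omega) h2).1 h8 fun h9 => ?_
      exfalso
      -- The only old link that becomes wrong is that of `v`, and `v` is not its own child since its
      -- edges spell strings longer than its longest.
      have hqv : q = v := G.eq_of_RPos (by omega) h2 hv hvN (h9.trans hvr.symm)
      subst hqv
      have := hmax.2 _ h4
      simp at this)
  constructor
  · intro c q h
    rw [ht] at h
    split_ifs at h with h1 h2
    · subst h1
      obtain ⟨h3, h4⟩ := htr.2 q h
      refine ⟨?_, ?_, h3⟩ <;> rcases h4 with ⟨d, hd⟩ | ⟨d, q', hd, h5, _⟩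
      · rcases hold _ _ hd with h | h <;> omega
      · rcases hold _ _ hd with ⟨rfl, _⟩ | ⟨h6, h7, _⟩
        · rw [hslN] at h5; simp at h5
        · obtain ⟨z, h8, h9, h10, _⟩ := G.sl q' h6 h7
          rw [hsl q' h7, h10] at h5
          simp at h5; omega
      · rcases hold _ _ hd with h | h <;> omega
      · rcases hold _ _ hd with ⟨rfl, _⟩ | ⟨h6, h7, _⟩
        · rw [hslN] at h5; simp at h5
        · obtain ⟨z, h8, h9, h10, _⟩ := G.sl q' h6 h7
          rw [hsl q' h7, h10] at h5
          simp at h5; omega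
    · refine ⟨?_, ?_, ?_⟩
      · rcases hold _ _ h with h | h <;> omega
      · rcases hold _ _ h with h | h <;> omega
      · rw [RPos_snoc_eq_of_zeta hrv.1 hpos h1, (hs _ _ h).2]
        rcases c with c | c
        · rfl
        · simp only [zeta] at h2 ⊢; split_ifs at h2 ⊢ <;> simp_all
  · intro c h
    rw [ht] at h
    split_ifs at h with h1 h2
    · subst h1; exact htr.1 h
    · rintro ⟨i, hi⟩
      obtain ⟨j, hj, _, _, h3⟩ := mem_RPos_snoc.1 hi
      rw [h3, zeta_zeta _ le_rfl, ← h3] at h2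
      exact h1 h2
    · rw [Occ, RPos_snoc_eq_of_zeta hrv.1 hpos h1]
      · exact hn _ h
      · rcases c with c | c
        · rfl
        · simp only [zeta] at h2 ⊢; split_ifs at h2 ⊢ <;> simp_all

end NewGraph

end PDAWG

namespace PDAWG

-- The last step of a phase: linking the sink or splitting a node.

section Finish

variable {S P : Type} [DecidableEq S] [DecidableEq P]

/-- Replacement of the dictionary of a node. -/
def Store.setTable (s : Store S P) (p : ℕ) (t : AList (fun _ : S ⊕ ℕ => ℕ)) : Store S P :=
  { s with table := Function.update s.table p t }

theorem length_le_of_keys_subset {α β : Type} [DecidableEq α] {T U : AList (fun _ : α => β)}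
    (h : ∀ c ∈ U.keys, c ∈ T.keys) : U.entries.length ≤ T.entries.length := by
  rw [length_entries, length_entries]
  exact (U.keys_nodup.subperm h).length_le

theorem AList.eq_empty_of_lookup {α β : Type} [DecidableEq α] {T : AList (fun _ : α => β)}
    (h : ∀ c, T.lookup c = none) : T = ∅ := by
  have : T.entries.length ≤ (∅ : AList (fun _ : α => β)).entries.length := by
    refine length_le_of_keys_subset fun c hc => ?_
    rw [← AList.mem_keys, ← AList.lookup_isSome, h] at hc
    simp at hc
  exact AList.ext (List.length_eq_zero_iff.1 (Nat.le_zero.1 this))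

open Classical in
/-- The traversal that copies the edges of `v` to the new node. -/
theorem run_each {M : ℕ} {s : Store S P} {v v' : ℕ} {K : ℤ} (hv : s.nodeReg .v = some v)
    (hv' : s.nodeReg .vNew = some v') (hne : v ≠ v') (hK : s.numReg .k = K)
    (hM : ∀ p, (s.table p).entries.length ≤ M) (hlast : s.last.entries.length ≤ M)
    (L : List (S ⊕ ℕ)) (hL : ∀ c ∈ L, c ∈ (s.table v).keys) (o : Option (S ⊕ ℕ))
    (t : AList (fun _ : S ⊕ ℕ => ℕ)) (ht : ∀ c ∈ t.keys, c ∈ (s.table v).keys) :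
    ∃ o' t' n, RunEach M .b
      (.cond (.not (.eqLab (.zeta Alg.b Alg.k) .zero))
        (.atom (.setChild Alg.vNew Alg.b (.child Alg.v Alg.b))) .skip) L
      ((s.setLab .b o).setTable v' t) ((s.setLab .b o').setTable v' t') n ∧ n ≤ 50 * L.length + 1 ∧
      (∀ c ∈ t'.keys, c ∈ (s.table v).keys) ∧
      ∀ c, t'.lookup c = if c ∈ L ∧ zeta c K ≠ .inr 0 then (s.table v).lookup c else t.lookup c := by
  induction L generalizing o t with
  | nil => exact ⟨o, t, 1, RunEach.nil _, by simp, ht, fun c => by simp⟩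
  | cons c L ih =>
    -- The growing dictionary only contains keys of `v`, so it never exceeds the bound for `v`.
    have hsmall : ∀ o t, (∀ c ∈ t.keys, c ∈ (s.table v).keys) →
        Small ((s.setLab .b o).setTable v' t) M := by
      intro o t ht
      refine ⟨fun p => ?_, hlast⟩
      by_cases hp : p = v'
      · subst hp
        simp only [Store.setTable, Store.setLab, Function.update_self]
        exact (length_le_of_keys_subset ht).trans (hM v)
      · simp only [Store.setTable, Store.setLab, Function.update_of_ne hp]; exact hM p
    have e0 : ((s.setLab .b o).setTable v' t).setLab .b (some c) =
        (s.setLab .b (some c)).setTable v' t := by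
      simp [Store.setLab, Store.setTable]
    set s1 := (s.setLab .b (some c)).setTable v' t with hs1
    have hsm1 : Small s1 M := hsmall _ _ ht
    obtain ⟨q, hq⟩ := mem_keys_iff.1 (hL c (by simp))
    have e1 : Alg.b.eval s1 = some c := by simp [Alg.b, Exp.eval, hs1, Store.setTable, Store.setLab]
    have e2 : (Exp.zeta Alg.b Alg.k).eval s1 = some (zeta c K) := by
      rw [Exp.eval, e1]; simp [Alg.k, Exp.eval, hs1, Store.setTable, Store.setLab, hK]
    have e3 : Alg.v.eval s1 = some v := by
      simp [Alg.v, Exp.eval, hs1, Store.setTable, Store.setLab, hv]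
    have e4 : (Exp.child Alg.v Alg.b).eval s1 = some q := by
      rw [Exp.eval, e1, e3]
      simp only [Option.bind_some, Store.tableOf, hs1, Store.setTable, Store.setLab]
      rw [Function.update_of_ne hne]; exact hq
    have e5 : Alg.vNew.eval s1 = some v' := by
      simp [Alg.vNew, Exp.eval, hs1, Store.setTable, Store.setLab, hv']
    have e6 : (Exp.not (.eqLab (.zeta Alg.b Alg.k) .zero)).eval s1 = true ↔ zeta c K ≠ .inr 0 := by
      rw [eval_not, eval_eqLab, e2]; simp [Exp.eval]
    by_cases hc : zeta c K = .inr 0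
    · obtain ⟨o', t', n, h1, h2, h3, h4⟩ := ih (fun c hc => hL c (by simp [hc])) (some c) t ht
      refine ⟨o', t', _, RunEach.cons (s₁ := s1) (n₁ := 40) ?_ h1, ?_, h3, fun d => ?_⟩
      · rw [e0]
        refine (Run.condFalse hsm1 ?_ (Run.skip s1)).mono ?_
        · rw [← Bool.not_eq_true, e6]; simpa using hc
        · decide
      · simp only [List.length_cons]; omega
      · rw [h4]
        by_cases hd : d = c
        · subst hd; simp [hc]
        · simp [hd]
    · have ht' : ∀ d ∈ (t.insert c q).keys, d ∈ (s.table v).keys := by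
        intro d hd
        rw [← AList.mem_keys, AList.mem_insert] at hd
        rcases hd with rfl | hd
        · exact hL d (by simp)
        · exact ht d (AList.mem_keys.1 hd)
      obtain ⟨o', t', n, h1, h2, h3, h4⟩ := ih (fun c hc => hL c (by simp [hc])) (some c)
        (t.insert c q) ht'
      have r1 := Run.setChild hsm1 e5 e1 e4
      have e7 : s1.putChild v' c q = (s.setLab .b (some c)).setTable v' (t.insert c q) := by
        simp [hs1, Store.putChild, Store.setTable, Store.setLab]
      rw [e7] at r1
      refine ⟨o', t', _, RunEach.cons (n₁ := 40) ?_ h1, ?_, h3, fun d => ?_⟩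
      · rw [e0]
        refine (Run.condTrue hsm1 (e6.2 hc) r1).mono ?_
        decide
      · simp only [List.length_cons]; omega
      · rw [h4]
        by_cases hd : d = c
        · subst hd; simp [hc, hq]
        · rw [AList.lookup_insert_ne hd]; simp [hd]

variable {w : List (S ⊕ ℕ)} {a : S ⊕ ℕ} {N : ℕ} {X : ℕ → List (S ⊕ ℕ)}
  {tb : ℕ → AList (fun _ : S ⊕ ℕ => ℕ)} {sl : ℕ → Option ℕ} {len : ℕ → ℤ} {M : ℕ} {s : Store S P}
  {r : List (S ⊕ ℕ)}

/-- The number of entries of the dictionaries of the nodes below `N`. -/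
def entryCount (tb : ℕ → AList (fun _ : S ⊕ ℕ => ℕ)) (N : ℕ) : ℕ :=
  ∑ p ∈ Finset.range N, (tb p).entries.length

/-- The store `s'` holds the graph of `w ⬝ a`, with new sink `N`. -/
structure Extended (w : List (S ⊕ ℕ)) (a : S ⊕ ℕ) (N : ℕ) (s s' : Store S P)
    (X' : ℕ → List (S ⊕ ℕ)) : Prop where
  graph : Graph (w ++ [a]) s'.size X' s'.table s'.sl s'.len
  size_gt : N < s'.size
  size_le : s'.size ≤ N + 2
  top : s'.nodeReg .top = some 0
  root : s'.nodeReg .root = some 1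
  sink : s'.nodeReg .sink = some N
  X_sink : X' N = w ++ [a]
  num_i : s'.numReg .i = s.numReg .i
  last : s'.last = s.last

-- Redirection overwrites or adds entries but never removes a key. The amortised bound needs this,
-- since it charges copied edges to the growth of the entry count.
open Classical in
theorem entryCount_le (G : Graph w N X tb sl len) {tb' : ℕ → AList (fun _ : S ⊕ ℕ => ℕ)} {v' : ℕ}
    (hF : FinalEdges w a N X r tb tb' v') (h0 : tb' 0 = ∅) : entryCount tb N ≤ entryCount tb' N := by
  refine Finset.sum_le_sum fun p hp => ?_
  rw [Finset.mem_range] at hp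
  rcases Nat.eq_zero_or_pos p with rfl | hp1
  · rw [h0, G.table_zero]
  · refine length_le_of_keys_subset fun c hc => ?_
    obtain ⟨q, hq⟩ := mem_keys_iff.1 hc
    rw [mem_keys_iff, hF p c hp1 hp]
    split_ifs
    · exact ⟨_, rfl⟩
    · exact ⟨_, rfl⟩
    · exact ⟨q, hq⟩
    · exact ⟨q, hq⟩

open Classical in
/-- The last step if the node of the longest repeated suffix exists. -/
theorem Ready.run_link (R : Ready w a N X tb sl len M s) (hr : IsLRS w a r)
    {tb₂ : ℕ → AList (fun _ : S ⊕ ℕ => ℕ)} {p₂ v : ℕ} (hv : 1 ≤ v) (hvN : v < N)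
    (hvr : RPos w (X v) = RPos w r) (heq : (X v).length = r.length)
    (ht : Redirected w a N X len tb tb₂ ((r.length : ℤ) - 1) w.length N) :
    ∃ s' X', Run M (.cond (.eqNum (.len Alg.v) Alg.k) (.atom (.setSL Alg.sink Alg.v)) Alg.split)
        (((s.putNum .k (r.length : ℤ)).putNode .v (some v)).moveTo tb₂ p₂) s' 30 ∧
      Extended w a N s s' X' ∧ entryCount tb N ≤ entryCount s'.table s'.size := by
  have G := R.graph
  set σ := ((s.putNum .k (r.length : ℤ)).putNode .v (some v)).moveTo tb₂ p₂ with hσ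
  have hXv : X v = r := by
    obtain ⟨i, hi⟩ := hr.occ
    exact eq_of_mem_RPos (hvr ▸ hi) hi heq
  have hsm : Small σ M :=
    ⟨fun q => (ht.length_le q).trans (by have := R.small q; omega), R.small_last⟩
  have e1 : Alg.v.eval σ = some v := by
    simp [Alg.v, Exp.eval, hσ, Store.putNum, Store.putNode, Store.moveTo]
  have e2 : Alg.sink.eval σ = some N := by
    simp [Alg.sink, Exp.eval, hσ, Store.putNum, Store.putNode, Store.moveTo, R.sink]
  have e3 : (Exp.eqNum (.len Alg.v) Alg.k).eval σ = true := by
    rw [eval_eqNum, Exp.eval, e1]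
    simp [Alg.k, Exp.eval, hσ, Store.putNum, Store.putNode, Store.moveTo, R.len v hvN,
      G.len v hv hvN, heq]
  have hF : FinalEdges w a N X r tb tb₂ v := by
    intro p c hp hpN
    have hl := G.len p hp hpN
    have hon : OnChain w N X p ↔ RSuf (X p) w := by
      simp only [OnChain]; constructor
      · rintro ⟨_, h⟩; exact h.resolve_left (by omega)
      · intro h; exact ⟨hpN, Or.inr h⟩
    rw [ht p c, hon, hl]
    by_cases h1 : RSuf (X p) w ∧ c = zeta a (X p).length
    · rw [if_pos h1]
      have := h1.1.length_le
      by_cases h2 : r.length ≤ (X p).length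
      · rw [if_pos h2, if_pos ⟨hp, h1.1, by omega, by omega, h1.2⟩]
      · rw [if_neg h2, if_neg (by omega)]
        split_ifs with h3
        -- An old edge into the class of `r` already leads to `v`, so nothing has to be redirected
        -- when `v` is the node of `r`.
        · cases h4 : (tb p).lookup c with
          | none =>
            refine absurd ?_ (G.edge_none p c hp hpN h4)
            rw [Occ, h3]; exact hr.occ
          | some q =>
            obtain ⟨h5, h6, h7⟩ := G.edge_some p c q hp hpN h4
            rw [G.eq_of_RPos h5 h6 hv hvN (h7.symm.trans (h3.trans hvr.symm))]
        · rfl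
    · rw [if_neg h1, if_neg (by tauto)]
  have htz : tb₂ 0 = ∅ := AList.eq_empty_of_lookup fun c => by
    rw [ht, if_neg (by omega), G.table_zero]; rfl
  have htN : ∀ p, N ≤ p → tb₂ p = ∅ := fun p hp => AList.eq_empty_of_lookup fun c => by
    rw [ht, if_neg (by rintro ⟨_, ⟨h, _⟩, _⟩; omega), G.table_ge p hp]; rfl
  have r1 := Run.condTrue (d := Alg.split) hsm e3 (Run.setSL hsm e2 e1)
  refine ⟨_, Function.update X N (w ++ [a]), r1.mono (by decide), ⟨?_, ?_, ?_, ?_, ?_, ?_, ?_, ?_, ?_⟩, ?_⟩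
  · have hsz : (σ.putSL N (some v)).size = N + 1 := R.size
    rw [hsz]
    refine G.snoc R.enc hr hF (v' := v) ⟨fun p hp => ?_, ?_, ?_, hv⟩ (fun p => by omega) (by omega)
      (fun q h1 h2 h3 => G.inj q v h1 h2 hv hvN (h3.trans hXv.symm)) R.len R.len_sink ?_ ?_ ?_ ?_ ?_
      htz (htN N le_rfl) (fun p hp => htN p (by omega)) (fun h => by omega) (fun h => by omega)
    · rw [Function.update_of_ne (by omega)]
    · rw [Function.update_self]
    · rw [Function.update_of_ne (by omega), hXv]
    · rw [R.len v hvN, G.len v hv hvN, heq]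
    · simp [Store.putSL]
    · intro p _ hp _
      simp only [Store.putSL]
      rw [Function.update_of_ne (by omega)]; exact R.sl p hp
    · intro p h1 h2 h3 h4
      have := G.eq_of_RPos h1 h2 hv hvN (h3.trans hvr.symm)
      subst this; omega
    · intro h; omega
  · have hsz : (σ.putSL N (some v)).size = N + 1 := R.size
    omega
  · have hsz : (σ.putSL N (some v)).size = N + 1 := R.size
    omega
  · simp [hσ, Store.putSL, Store.putNum, Store.putNode, Store.moveTo, R.top]
  · simp [hσ, Store.putSL, Store.putNum, Store.putNode, Store.moveTo, R.root]
  · simp [hσ, Store.putSL, Store.putNum, Store.putNode, Store.moveTo, R.sink]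
  · rw [Function.update_self]
  · simp [hσ, Store.putSL, Store.putNum, Store.putNode, Store.moveTo]
  · rfl
  · have hsz : (σ.putSL N (some v)).size = N + 1 := R.size
    rw [hsz]
    refine (entryCount_le G hF htz).trans ?_
    change entryCount tb₂ N ≤ entryCount tb₂ (N + 1)
    simp only [entryCount]
    rw [Finset.sum_range_succ]; omega

open Classical in
/-- The last step if the node of the longest repeated suffix has to be split off. -/
theorem Ready.run_split (R : Ready w a N X tb sl len M s) (hr : IsLRS w a r)
    {tb₂ : ℕ → AList (fun _ : S ⊕ ℕ => ℕ)} {p₂ v : ℕ} (hv : 1 ≤ v) (hvN : v < N)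
    (hvr : RPos w (X v) = RPos w r) (hlt : r.length < (X v).length) (hp₂ : OnChain w N X p₂)
    (hlp₂ : len p₂ < r.length)
    (htop : ∀ q, 1 ≤ q → OnChain w N X q → len q < r.length → len q ≤ len p₂)
    (ht : Redirected w a N X len tb tb₂ ((r.length : ℤ) - 1) w.length N) {Q : ℕ}
    (hQ : ∀ (A : Finset ℕ) (x : List (S ⊕ ℕ)),
      (∀ b ∈ A, Occ (w ++ [a]) (x ++ [Sum.inr b])) → A.card ≤ Q) :
    ∃ s' X' n p₃ e, Run M (.cond (.eqNum (.len Alg.v) Alg.k) (.atom (.setSL Alg.sink Alg.v)) Alg.split)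
        (((s.putNum .k (r.length : ℤ)).putNode .v (some v)).moveTo tb₂ p₂) s' n ∧
      Extended w a N s s' X' ∧ entryCount tb N + e ≤ entryCount s'.table s'.size ∧
      (∀ q, 1 ≤ q → OnChain w N X q → len p₃ < len q → len q ≤ len p₂ →
        RPos w (X q ++ [zeta a (len q)]) = RPos w r) ∧
      n ≤ 1000 * (1 + ((insert w.length (breaks w)).filter
        fun l : ℕ => len p₃ < (l : ℤ) ∧ (l : ℤ) ≤ len p₂).card + Q + e) := by
  have G := R.graph
  have hG2 := G.two_le
  set σ := ((s.putNum .k (r.length : ℤ)).putNode .v (some v)).moveTo tb₂ p₂ with hσ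
  have hv1 : v ≠ 1 := by rintro rfl; rw [G.X_one] at hlt; simp at hlt
  have hlv := G.len v hv hvN
  have hsm : Small σ M :=
    ⟨fun q => (ht.length_le q).trans (by have := R.small q; omega), R.small_last⟩
  have e3 : (Exp.eqNum (.len Alg.v) Alg.k).eval σ = false := by
    have e1 : Alg.v.eval σ = some v := by
      simp [Alg.v, Exp.eval, hσ, Store.putNum, Store.putNode, Store.moveTo]
    rw [← Bool.not_eq_true, eval_eqNum, Exp.eval, e1]
    simp [Alg.k, Exp.eval, hσ, Store.putNum, Store.putNode, Store.moveTo, R.len v hvN, hlv]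
    omega
  -- the redirecting loop
  set σ₁ := σ.alloc .vNew (r.length : ℤ) with hσ₁
  have hN1 : s.size = N + 1 := R.size
  have hσ₁m : σ₁ = σ₁.moveTo σ₁.table p₂ := by
    have : Function.update σ₁.nodeReg .u (some p₂) = σ₁.nodeReg := by
      rw [Function.update_eq_self_iff]
      simp [hσ₁, hσ, Store.alloc, Store.moveTo, Store.putNode, Store.putNum]
    simp only [Store.moveTo, this]
  have htab : σ₁.table = Function.update tb₂ (N + 1) ∅ := by
    simp [hσ₁, hσ, Store.alloc, Store.moveTo, Store.putNode, Store.putNum, hN1]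
  have hlen₁ : ∀ p < N, σ₁.len p = len p := fun p hp => by
    simp only [hσ₁, hσ, Store.alloc, Store.moveTo, Store.putNode, Store.putNum, hN1]
    rw [Function.update_of_ne (by omega)]; exact R.len p hp
  have hsl₁ : ∀ p < N, σ₁.sl p = sl p := fun p hp => by
    simp only [hσ₁, hσ, Store.alloc, Store.moveTo, Store.putNode, Store.putNum, hN1]
    rw [Function.update_of_ne (by omega)]; exact R.sl p hp
  have hlk₁ : ∀ p < N, ∀ c, (σ₁.table p).lookup c = (tb₂ p).lookup c := fun p hp c => by
    rw [htab, Function.update_of_ne (by omega)]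
  have hreg : ∀ x, x ≠ .u → x ≠ .v → x ≠ .vNew → σ₁.nodeReg x = s.nodeReg x := by
    intro x h1 h2 h3
    simp [hσ₁, hσ, Store.alloc, Store.moveTo, Store.putNode, Store.putNum, h1, h2, h3]
  have hregv : σ₁.nodeReg .v = some v := by
    simp [hσ₁, hσ, Store.alloc, Store.moveTo, Store.putNode, Store.putNum]
  have hregn : σ₁.nodeReg .vNew = some (N + 1) := by
    simp [hσ₁, hσ, Store.alloc, Store.moveTo, Store.putNode, Store.putNum, hN1]
  have hregk : σ₁.numReg .k = (r.length : ℤ) := by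
    simp [hσ₁, hσ, Store.alloc, Store.moveTo, Store.putNode, Store.putNum]
  have htop₁ : σ₁.nodeReg .top = some 0 := by rw [hreg] <;> simp [R.top]
  have hroot₁ : σ₁.nodeReg .root = some 1 := by rw [hreg] <;> simp [R.root]
  have hM₁ : ∀ p, (σ₁.table p).entries.length + 1 ≤ M := by
    intro p
    have h1 := ht.length_le p
    have h2 := R.small p
    rw [htab]
    by_cases hp : p = N + 1
    · subst hp; rw [Function.update_self]; simp; omega
    · rw [Function.update_of_ne hp]; omega
  let good : ℕ → Prop := fun p => 1 ≤ p ∧ RPos w (X p ++ [zeta a (len p)]) = RPos w r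
  have hb : ∀ p tb', OnChain w N X p → len p ≤ (r.length : ℤ) - 1 →
      Redirected w a N X len σ₁.table tb' (len p) ((r.length : ℤ) - 1) (N + 1) →
      ((Exp.eqNode (Alg.child Alg.u Alg.aAtU) Alg.v).eval (σ₁.moveTo tb' p) = true ↔ good p) := by
    intro p tb' hp hpl hr'
    have e1 : Alg.u.eval (σ₁.moveTo tb' p) = some p := by simp [Alg.u, Exp.eval, Store.moveTo]
    have e2 : Alg.v.eval (σ₁.moveTo tb' p) = some v := by
      simp [Alg.v, Exp.eval, Store.moveTo, hregv]
    have e4 : Alg.aAtU.eval (σ₁.moveTo tb' p) = some (zeta a (len p)) := by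
      simp only [Alg.aAtU, Alg.a, Exp.eval, e1]
      have : σ₁.labReg .a = some a := R.lab
      simp [Store.moveTo, hlen₁ p hp.1, this]
    rw [eval_eqNode, e2, eval_child (by simp [Store.moveTo, htop₁]) (by simp [Store.moveTo, hroot₁]),
      e1, e4]
    rcases Nat.eq_zero_or_pos p with rfl | hp1
    · simp only [if_true, good]
      simp only [Option.some.injEq]
      omega
    rw [if_neg (by simp; omega)]
    change (tb' p).lookup _ = some v ↔ _
    rw [hr', if_neg (by omega), hlk₁ p hp.1, ht, if_neg (by omega)]
    constructor
    · intro h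
      obtain ⟨_, _, h3⟩ := G.edge_some p _ v hp1 hp.1 h
      exact ⟨hp1, h3.trans hvr⟩
    · rintro ⟨_, h⟩
      cases h4 : (tb p).lookup (zeta a (len p)) with
      | none =>
        refine absurd ?_ (G.edge_none p _ hp1 hp.1 h4)
        rw [Occ, h]; exact hr.occ
      | some q =>
        obtain ⟨h5, h6, h7⟩ := G.edge_some p _ q hp1 hp.1 h4
        rw [G.eq_of_RPos h5 h6 hv hvN (h7.symm.trans (h.trans hvr.symm))]
  -- The loop starts at the longest node on the chain shorter than `r`, so its initial range of
  -- redirected nodes is empty.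
  have hr0 : Redirected w a N X len σ₁.table σ₁.table (len p₂) ((r.length : ℤ) - 1) (N + 1) := by
    intro p c
    rw [if_neg]
    rintro ⟨h1, h2, h3, h4, _⟩
    have := htop p h1 h2 (by omega); omega
  obtain ⟨tb₃, p₃, n₁, r1, hp₃, hlp₃, hr₃, hg₃, hgood, hn₁⟩ := run_loop G (s := σ₁) hM₁ R.small_last
    hlen₁ hsl₁ R.lab (x := .vNew) (by simp) hregn (good := good) (by simp [good]) hb
    (C := insert w.length (breaks w)) (fun p hp hc => mem_insert_breaks G hp hc) hp₂ (by omega) hr0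
  rw [← hσ₁m] at r1
  have hF : ∀ tb', (∀ p < N, tb' p = tb₃ p) → FinalEdges w a N X r tb tb' (N + 1) := by
    intro tb' htb' p c hp hpN
    have hl := G.len p hp hpN
    have hon : OnChain w N X p ↔ RSuf (X p) w := by
      simp only [OnChain]; constructor
      · rintro ⟨_, h⟩; exact h.resolve_left (by omega)
      · intro h; exact ⟨hpN, Or.inr h⟩
    rw [htb' p hpN, hr₃ p c, hlk₁ p hpN, ht p c, hon, hl]
    by_cases h1 : RSuf (X p) w ∧ c = zeta a (X p).length
    · rw [if_pos h1]
      have hpw := h1.1.length_le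
      by_cases h2 : r.length ≤ (X p).length
      · rw [if_pos h2, if_neg (by omega), if_pos ⟨hp, h1.1, by omega, by omega, h1.2⟩]
      · rw [if_neg h2]
        by_cases h3 : len p₃ < (X p).length
        · rw [if_pos ⟨hp, h1.1, h3, by omega, h1.2⟩, if_pos]
          have := hgood p hp (hon.2 h1.1) (by omega) (htop p hp (hon.2 h1.1) (by omega))
          rw [h1.2, ← hl]; exact this.2
        · rw [if_neg (by omega), if_neg (by omega), if_neg]
          intro h4
          have hp31 : 1 ≤ p₃ := by
            rcases Nat.eq_zero_or_pos p₃ with rfl | h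
            · rw [G.len_zero] at h3; omega
            · exact h
          obtain ⟨h5, h6, h7⟩ := G.eq_rsuf hp31 hp₃
          have h8 : RSuf (X p₃) w := hp₃.2.resolve_left (by omega)
          -- The nodes to be redirected are consecutive on the chain: if a node no longer than `p₃`
          -- extended into the class of `r`, the extension at `p₃`, lying between that string and
          -- `r`, would be in this class too, and the loop would not have stopped.
          refine hg₃ ⟨hp31, Set.Subset.antisymm ?_ ?_⟩
          · rw [← h4]
            refine RPos_mono ?_
            rw [h1.2, h7, h1.1.eq_rsuf, h8.eq_rsuf, rsuf_length h6, rsuf_length hpw]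
            exact rsuf_snoc_mono (by omega) h6
          · refine RPos_mono (RSuf.of_le (z := w ++ [a]) ?_ hr.rsuf (by simp; omega))
            rw [RSuf.snoc, h7]; exact ⟨h8, rfl⟩
    · rw [if_neg h1, if_neg (by tauto), if_neg (by tauto)]
  have htz : tb₃ 0 = ∅ := AList.eq_empty_of_lookup fun c => by
    rw [hr₃, if_neg (by omega), hlk₁ 0 (by omega), ht, if_neg (by omega), G.table_zero]; rfl
  have htge : ∀ p, N ≤ p → tb₃ p = ∅ := fun p hp => AList.eq_empty_of_lookup fun c => by
    rw [hr₃, if_neg (by rintro ⟨_, ⟨h, _⟩, _⟩; omega), htab]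
    by_cases hpN : p = N + 1
    · subst hpN; rw [Function.update_self]; rfl
    · rw [Function.update_of_ne hpN, ht, if_neg (by rintro ⟨_, ⟨h, _⟩, _⟩; omega), G.table_ge p hp]
      rfl
  have hM₃ : ∀ p, (tb₃ p).entries.length ≤ M := fun p => (hr₃.length_le p).trans (hM₁ p)
  -- the edges of the new node
  set σ₃ := σ₁.moveTo tb₃ p₃ with hσ₃
  have hs₃ : Small σ₃ M := ⟨hM₃, R.small_last⟩
  have hreg₃ : ∀ x, x ≠ .u → σ₃.nodeReg x = σ₁.nodeReg x := by
    intro x h1; simp [hσ₃, Store.moveTo, h1]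
  have htop₃ : σ₃.nodeReg .top = some 0 := by rw [hreg₃ _ (by simp), htop₁]
  have hroot₃ : σ₃.nodeReg .root = some 1 := by rw [hreg₃ _ (by simp), hroot₁]
  have hv₃ : σ₃.nodeReg .v = some v := by rw [hreg₃ _ (by simp), hregv]
  have hn₃ : σ₃.nodeReg .vNew = some (N + 1) := by rw [hreg₃ _ (by simp), hregn]
  have hsink₃ : σ₃.nodeReg .sink = some N := by
    rw [hreg₃ _ (by simp), hreg _ (by simp) (by simp) (by simp), R.sink]
  obtain ⟨o, t₄, n₂, r2, hn₂, hk₄, ht₄⟩ := run_each (s := σ₃) (v' := N + 1) hv₃ hn₃ (by omega)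
    (K := r.length) hregk hM₃ R.small_last (tb₃ v).keys (fun c hc => hc)
    (σ₃.labReg .b) ∅ (by simp)
  have e5 : (σ₃.setLab .b (σ₃.labReg .b)).setTable (N + 1) ∅ = σ₃ := by
    simp only [Store.setTable, Store.setLab, Function.update_eq_self]
    have : Function.update σ₃.table (N + 1) ∅ = σ₃.table := by
      rw [Function.update_eq_self_iff]; exact (htge _ (by omega)).symm
    rw [this]
  rw [e5] at r2
  have hv₃' : Alg.v.eval σ₃ = some v := by simp [Alg.v, Exp.eval, hv₃]
  have r2' := Run.each (e := Alg.v) hs₃ (by rw [hv₃']; exact r2)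
  set σ₄ := (σ₃.setLab .b o).setTable (N + 1) t₄ with hσ₄
  have htv : σ₄.table v = tb₃ v := by
    simp only [hσ₄, Store.setTable]; rw [Function.update_of_ne (by omega)]; rfl
  have hs₄ : Small σ₄ M := by
    refine ⟨fun p => ?_, R.small_last⟩
    by_cases hp : p = N + 1
    · subst hp; simp only [hσ₄, Store.setTable, Function.update_self]
      exact (length_le_of_keys_subset hk₄).trans (hM₃ v)
    · simp only [hσ₄, Store.setTable]; rw [Function.update_of_ne hp]; exact hM₃ p
  have e6 : (Alg.trans Alg.v Alg.k .zero).eval σ₄ = transVal (tb₃ v) σ₁.sl r.length (.inr 0) := by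
    have g1 : Alg.k.eval σ₄ = (r.length : ℤ) := hregk
    rw [eval_trans (s := σ₄) (p := v) (c := .inr 0) htop₃ hroot₃
      (by simp only [Alg.v, Exp.eval]; exact hv₃) (by simp [Exp.eval]), if_neg (by omega), g1, htv]
    rfl
  have step : ∃ t₅ n₃, Run M (.cond (.not (.eqNode (Alg.trans Alg.v Alg.k .zero) .null))
      (.atom (.setChild Alg.vNew .zero (Alg.trans Alg.v Alg.k .zero))) .skip) σ₄
      ((σ₃.setLab .b o).setTable (N + 1) t₅) n₃ ∧ n₃ ≤ 200 ∧
      (∀ c, t₅.lookup c = if c = .inr 0 then transVal (tb₃ v) σ₁.sl r.length (.inr 0)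
        else if zeta c r.length = .inr 0 then none else (tb₃ v).lookup c) ∧
      t₅.entries.length ≤ M := by
    have h4 : ∀ c, c ≠ .inr 0 → t₄.lookup c =
        if zeta c r.length = .inr 0 then none else (tb₃ v).lookup c := by
      intro c hc
      rw [ht₄]
      by_cases h : zeta c r.length = .inr 0
      · simp [h]
      · by_cases h' : c ∈ (tb₃ v).keys
        · rw [if_pos ⟨h', h⟩, if_neg h]; rfl
        · rw [if_neg (by tauto), if_neg h]
          rw [mem_keys_iff] at h'
          push Not at h'
          rw [Option.eq_none_iff_forall_ne_some.2 h']; rfl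
    have hl4 : t₄.entries.length + 1 ≤ M := by
      have h1 := length_le_of_keys_subset hk₄
      have h2 : (tb₃ v).entries.length ≤ (tb₂ v).entries.length := by
        refine length_le_of_keys_subset fun c hc => ?_
        obtain ⟨q, hq⟩ := mem_keys_iff.1 hc
        rw [hr₃, if_neg (by omega), hlk₁ v hvN] at hq
        exact mem_keys_iff.2 ⟨q, hq⟩
      have h3 := ht.length_le v
      have h4 := R.small v
      change _ ≤ (tb₃ v).entries.length at h1
      omega
    cases hq : transVal (tb₃ v) σ₁.sl r.length (.inr 0) with
    | none =>
      rw [hq] at e6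
      refine ⟨t₄, _, Run.condFalse hs₄ ?_ (Run.skip σ₄), by decide, fun c => ?_, by omega⟩
      · rw [← Bool.not_eq_true, eval_not, eval_eqNode, e6]; simp [Exp.eval]
      · split_ifs with h1 h2
        · subst h1; rw [ht₄, if_neg (by simp [zeta_inr_zero])]; rfl
        · rw [h4 c h1, if_pos h2]
        · rw [h4 c h1, if_neg h2]
    | some q =>
      rw [hq] at e6
      have r3 := Run.setChild (e := Alg.vNew) (l := .zero) hs₄ (p := N + 1) (a := .inr 0)
        (by simp only [Alg.vNew, Exp.eval]; exact hn₃) (by simp [Exp.eval]) e6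
      have e7 : σ₄.putChild (N + 1) (.inr 0) q =
          (σ₃.setLab .b o).setTable (N + 1) (t₄.insert (.inr 0) q) := by
        simp [hσ₄, Store.putChild, Store.setTable]
      rw [e7] at r3
      refine ⟨t₄.insert (.inr 0) q, _, Run.condTrue hs₄ ?_ r3, by decide, fun c => ?_, ?_⟩
      · rw [eval_not, eval_eqNode, e6]; simp [Exp.eval]
      · split_ifs with h1 h2
        · subst h1; rw [AList.lookup_insert]
        · rw [AList.lookup_insert_ne h1, h4 c h1, if_pos h2]
        · rw [AList.lookup_insert_ne h1, h4 c h1, if_neg h2]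
      · refine le_trans (length_le_of_keys (T := t₄) (c₀ := .inr 0) fun c hc => ?_) hl4
        rw [← AList.mem_keys, AList.mem_insert, AList.mem_keys] at hc
        exact hc.symm
  obtain ⟨t₅, n₃, r3, hn₃', ht₅, hl₅⟩ := step
  set σ₅ := (σ₃.setLab .b o).setTable (N + 1) t₅ with hσ₅
  have htab₅ : σ₅.table = Function.update tb₃ (N + 1) t₅ := rfl
  have hs₅ : Small σ₅ M := by
    refine ⟨fun p => ?_, R.small_last⟩
    rw [htab₅]
    by_cases hp : p = N + 1
    · subst hp; rw [Function.update_self]; exact hl₅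
    · rw [Function.update_of_ne hp]; exact hM₃ p
  -- the links
  obtain ⟨z, hz1, hzN, hz, _⟩ := G.sl v (by omega) hvN
  have r4 := Run.setSL hs₅ (e := Alg.vNew) (f := .sl Alg.v) (p := N + 1) (o := sl v)
    (by simp only [Alg.vNew, Exp.eval]; exact hn₃)
    (by
      have : Alg.v.eval σ₅ = some v := by simp only [Alg.v, Exp.eval]; exact hv₃
      rw [Exp.eval, this]; exact hsl₁ v hvN)
  set σ₆ := σ₅.putSL (N + 1) (sl v) with hσ₆
  have hs₆ : Small σ₆ M := hs₅.of_eq rfl rfl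
  have r5 := Run.setSL hs₆ (e := Alg.v) (f := Alg.vNew) (p := v) (o := some (N + 1))
    (by simp only [Alg.v, Exp.eval]; exact hv₃) (by simp only [Alg.vNew, Exp.eval]; exact hn₃)
  set σ₇ := σ₆.putSL v (some (N + 1)) with hσ₇
  have hs₇ : Small σ₇ M := hs₆.of_eq rfl rfl
  have r6 := Run.setSL hs₇ (e := Alg.sink) (f := Alg.vNew) (p := N) (o := some (N + 1))
    (by simp only [Alg.sink, Exp.eval]; exact hsink₃) (by simp only [Alg.vNew, Exp.eval]; exact hn₃)
  set σ₈ := σ₇.putSL N (some (N + 1)) with hσ₈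
  have hsz : σ₈.size = N + 2 := by
    change s.size + 1 = N + 2; omega
  have hsl₈ : σ₈.sl = Function.update (Function.update (Function.update σ₁.sl (N + 1) (sl v)) v
      (some (N + 1))) N (some (N + 1)) := rfl
  have htab₈ : σ₈.table = Function.update tb₃ (N + 1) t₅ := rfl
  have rr := Run.newNode (x := .vNew) (n := Alg.k) (m := (r.length : ℤ)) hsm
    (by simp [Alg.k, Exp.eval, hσ, Store.alloc, Store.moveTo, Store.putNode, Store.putNum])
    _ (r1.seq (r2'.seq (r3.seq (r4.seq (r5.seq r6)))))
  have rall := Run.condFalse (c := .atom (.setSL Alg.sink Alg.v)) hsm e3 rr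
  let X' : ℕ → List (S ⊕ ℕ) := Function.update (Function.update X N (w ++ [a])) (N + 1) r
  have hX' : NewNodes w a N X X' r (N + 1) := by
    refine ⟨fun p hp => ?_, ?_, ?_, by omega⟩
    · simp only [X']; rw [Function.update_of_ne (by omega), Function.update_of_ne (by omega)]
    · simp only [X']; rw [Function.update_of_ne (by omega), Function.update_self]
    · simp only [X']; rw [Function.update_self]
  have hF₈ : FinalEdges w a N X r tb σ₈.table (N + 1) := hF _ fun p hp => by
    rw [htab₈, Function.update_of_ne (by omega)]
  have hslN : σ₁.sl N = none := by
    simp only [hσ₁, hσ, Store.alloc, Store.moveTo, Store.putNode, Store.putNum, hN1]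
    rw [Function.update_of_ne (by omega)]; exact R.sl_sink
  obtain ⟨hE1, hE2⟩ := split_edges G R.enc hr (hF tb₃ fun _ _ => rfl) hX' hv hvN hvr hlt hsl₁ hslN
    ht₅
  have hnode : ∀ x, x ≠ .u → σ₈.nodeReg x = σ₁.nodeReg x := hreg₃
  refine ⟨σ₈, X', _, p₃, t₅.entries.length, rall, ⟨?_, by omega, by omega, ?_, ?_, ?_, hX'.sink, ?_, rfl⟩,
    ?_, fun q h1 h2 h3 h4 => (hgood q h1 h2 h3 h4).2, ?_⟩
  · rw [hsz]
    refine G.snoc R.enc hr hF₈ hX' (fun p => by omega) (by omega) (fun q h1 h2 h3 => ?_) hlen₁ ?_ ?_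
      ?_ ?_ ?_ ?_ ?_ ?_ ?_ ?_ ?_
    · exfalso
      have := G.eq_of_RPos h1 h2 hv hvN (by rw [h3, hvr])
      subst this; rw [h3] at hlt; omega
    · simp only [hσ₁, hσ, Store.alloc, Store.moveTo, Store.putNode, Store.putNum, hN1]
      rw [Function.update_of_ne (by omega)]; exact R.len_sink
    · simp [hσ₁, hσ, Store.alloc, Store.moveTo, Store.putNode, Store.putNum, hN1]
    · rw [hsl₈, Function.update_self]
    · intro p h1 h2 h3
      have : p ≠ v := by rintro rfl; have := h3 hvr; omega
      rw [hsl₈, Function.update_of_ne (by omega), Function.update_of_ne this,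
        Function.update_of_ne (by omega), hsl₁ p h2]
    · intro p h1 h2 h3 _
      obtain rfl := G.eq_of_RPos h1 h2 hv hvN (h3.trans hvr.symm)
      rw [hsl₈, Function.update_of_ne (by omega), Function.update_self]
    · intro _
      refine ⟨v, hv, hvN, hvr, hlt, ?_⟩
      rw [hsl₈, Function.update_of_ne (by omega), Function.update_of_ne (by omega),
        Function.update_self]
    · rw [htab₈, Function.update_of_ne (by omega), htz]
    · rw [htab₈, Function.update_of_ne (by omega), htge N le_rfl]
    · intro p hp
      rw [htab₈, Function.update_of_ne (by omega), htge p (by omega)]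
    · intro _ c q h
      rw [htab₈, Function.update_self] at h
      exact hE1 c q h
    · intro _ c h
      rw [htab₈, Function.update_self] at h
      exact hE2 c h
  · rw [hnode _ (by simp), htop₁]
  · rw [hnode _ (by simp), hroot₁]
  · exact hsink₃
  · simp [hσ₈, hσ₇, hσ₆, hσ₅, hσ₃, hσ₁, hσ, Store.putSL, Store.setTable, Store.setLab, Store.alloc,
      Store.moveTo, Store.putNode, Store.putNum]
  · rw [hsz]
    have h1 := entryCount_le G hF₈ (by rw [htab₈, Function.update_of_ne (by omega), htz])
    have h2 : entryCount σ₈.table (N + 2) = entryCount σ₈.table N + (σ₈.table N).entries.length +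
        (σ₈.table (N + 1)).entries.length := by
      simp only [entryCount]; rw [Finset.sum_range_succ, Finset.sum_range_succ]
    rw [h2]
    have h3 : σ₈.table (N + 1) = t₅ := by rw [htab₈, Function.update_self]
    rw [h3]; omega
  -- All static labels of `v` reappear in the new dictionary and pay for themselves. Numbers may
  -- merge into `0`, so they are bounded separately by `Q`.
  · have hkeys : (tb₃ v).keys.length ≤ Q + t₅.entries.length := by
      rw [length_entries, ← List.toFinset_card_of_nodup (tb₃ v).keys_nodup,
        ← List.toFinset_card_of_nodup t₅.keys_nodup,
        ← Finset.card_toLeft_add_card_toRight (u := (tb₃ v).keys.toFinset)]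
      have h1 : (tb₃ v).keys.toFinset.toRight.card ≤ Q := by
        refine hQ _ (X v) fun b hb => ?_
        rw [Finset.mem_toRight, List.mem_toFinset, mem_keys_iff] at hb
        obtain ⟨q, hq⟩ := hb
        by_contra hno
        obtain ⟨h5, h6⟩ := edge_some_old G R.enc hr (hF tb₃ fun _ _ => rfl) hX' hv hvN hq
        rw [Occ, h6] at hno
        refine hno ?_
        rcases h5 with h5 | rfl | rfl
        · rw [hX'.old q h5.2]; exact (G.isMax q h5.1 h5.2).append.1
        · rw [hX'.sink]; exact (isMax_self R.enc).1
        · rw [hX'.lrs]; exact hr.isMax.1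
      have h2 : (tb₃ v).keys.toFinset.toLeft.card ≤ t₅.keys.toFinset.card := by
        refine Finset.card_le_card_of_injOn Sum.inl (fun x hx => ?_) Sum.inl_injective.injOn
        simp only [Finset.mem_coe, Finset.mem_toLeft, List.mem_toFinset, mem_keys_iff] at hx ⊢
        obtain ⟨q, hq⟩ := hx
        exact ⟨q, by rw [ht₅]; simp [zeta_inl, hq]⟩
      omega
    have w1 : (Exp.eqNum (.len Alg.v) Alg.k).weight = 4 := by rfl
    have w2 : Alg.k.weight = 1 := by rfl
    have w3 : (Exp.eqNode (Alg.child Alg.u Alg.aAtU) Alg.v).weight ≤ 20 := by decide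
    have w4 : Alg.v.weight = 1 := by rfl
    have w5 : Alg.vNew.weight = 1 := by rfl
    have w6 : Alg.v.sl.weight = 2 := by rfl
    have w7 : Alg.sink.weight = 1 := by rfl
    rw [w1, w2, w4, w5, w6, w7]
    have := Nat.mul_le_mul_right (1 + ((insert w.length (breaks w)).filter
        fun l : ℕ => len p₃ < (l : ℤ) ∧ (l : ℤ) ≤ len p₂).card) (Nat.add_le_add_right w3 11)
    omega

end Finish

end PDAWG

namespace PDAWG

-- Charging loop iterations to vanishing breaks.

section Visited

variable {S P : Type} [DecidableEq S] [DecidableEq P]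

/-- A number that the two loops of a phase visit is a break that the phase removes. -/
theorem card_visited_le [Fintype P] {T : List (S ⊕ P)} {c : S ⊕ P} {w r : List (S ⊕ ℕ)}
    {a : S ⊕ ℕ} (hw : prev T = w) (ha : prevSymbol T c = a) {N : ℕ} {X : ℕ → List (S ⊕ ℕ)}
    {tb : ℕ → AList (fun _ : S ⊕ ℕ => ℕ)} {sl : ℕ → Option ℕ} {len : ℕ → ℤ}
    (G : Graph w N X tb sl len) (hr : IsLRS w a r) {lo lo' hi : ℤ} (hhi : hi < r.length)
    (h1 : ∀ l : ℕ, lo < l → l ≤ w.length → ¬ Occ w (rsuf w l ++ [zeta a l]))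
    (h2 : ∀ q, 1 ≤ q → OnChain w N X q → lo' < len q → len q ≤ hi →
      RPos w (X q ++ [zeta a (len q)]) = RPos w r) :
    (breaks (prev (T ++ [c]))).card +
        ((insert w.length (breaks w)).filter fun l : ℕ => lo < (l : ℤ) ∧ (l : ℤ) ≤ w.length).card +
        ((insert w.length (breaks w)).filter fun l : ℕ => lo' < (l : ℤ) ∧ (l : ℤ) ≤ hi).card ≤
      (breaks w).card + Fintype.card P + 3 := by
  classical
  have hrw : r.length ≤ w.length := hr.occ.length_le
  have hlen : ∀ l, l ≤ w.length → (rsuf (w ++ [a]) (l + 1)).length = l + 1 := fun l hl =>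
    rsuf_length (by simpa using hl)
  have hsuf : ∀ l, l ≤ w.length → RSuf (rsuf (w ++ [a]) (l + 1)) (w ++ [a]) := fun l hl =>
    rsuf_rsuf (by simpa using hl)
  have hocc : ∀ l, l ≤ w.length → (Occ w (rsuf (w ++ [a]) (l + 1)) ↔ l + 1 ≤ r.length) :=
    fun l hl => by rw [hr.occ_iff (hsuf l hl), hlen l hl]
  -- For `l` in `A₁` the suffixes of `w ++ [a]` of lengths `l + 1` and `l + 2` both fall into the
  -- class of the sink. For `l` in `A₂` both fall into the class of `r`. In either case the shifted
  -- break disappears.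
  let A₁ := (breaks w).filter fun l => r.length ≤ l
  let A₂ := (breaks w).filter fun l => l + 1 < r.length ∧
    RPos w (rsuf (w ++ [a]) (l + 1)) = RPos w r
  have hd : Disjoint A₁ A₂ := by
    rw [Finset.disjoint_left]
    intro l h3 h4
    simp only [A₁, A₂, Finset.mem_filter] at h3 h4
    omega
  -- The exceptional lengths `|w|` here and `|r| - 1` in the second loop account for two of the
  -- units in the final `+ 3`.
  have hV₁ : (insert w.length (breaks w)).filter
      (fun l : ℕ => lo < (l : ℤ) ∧ (l : ℤ) ≤ w.length) ⊆ insert w.length A₁ := by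
    intro l hl
    simp only [Finset.mem_filter, Finset.mem_insert, A₁] at hl ⊢
    rcases hl.1 with h | h
    · exact Or.inl h
    · have hlw : l ≤ w.length := by omega
      have := h1 l hl.2.1 hlw
      rw [← rsuf_snoc hlw, hocc l hlw] at this
      exact Or.inr ⟨h, by omega⟩
  have hV₂ : (insert w.length (breaks w)).filter
      (fun l : ℕ => lo' < (l : ℤ) ∧ (l : ℤ) ≤ hi) ⊆ insert (r.length - 1) A₂ := by
    intro l hl
    simp only [Finset.mem_filter, Finset.mem_insert, A₂] at hl ⊢
    rcases hl.1 with h | h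
    · omega
    · have hlw : l ≤ w.length := by omega
      obtain ⟨q, hq, hc, hlq, he⟩ := G.chain_cover hlw
      have hlen' := G.len q hq hc.1
      have hXw : RSuf (X q) w := hc.2.resolve_left (by omega)
      -- At a break the suffix of that length is the longest of its class: otherwise the suffix
      -- longer by one would have the same end positions.
      have hlq' : (X q).length = l := by
        by_contra hne
        have hlt : l + 1 ≤ (X q).length := by omega
        refine (mem_breaks.1 h).2 ((RPos_mono ?_).antisymm' ?_)
        · exact rsuf_mono (by omega) (by have := hXw.length_le; omega)
        · rw [he]
          refine RPos_mono ((rsuf_rsuf ?_).of_le hXw ?_)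
          · have := hXw.length_le; omega
          · rw [rsuf_length (by have := hXw.length_le; omega)]; exact hlt
      have hXq : X q = rsuf w l := by rw [hXw.eq_rsuf, hlq']
      have := h2 q hq hc (by omega) (by omega)
      rw [hlen', hlq', hXq, ← rsuf_snoc hlw] at this
      by_cases hl' : l + 1 < r.length
      · exact Or.inr ⟨h, hl', this⟩
      · exact Or.inl (by omega)
  have hcard := card_breaks_snoc T c (A := A₁ ∪ A₂)
    (by rw [hw]; exact Finset.union_subset (Finset.filter_subset _ _) (Finset.filter_subset _ _)) (by
    intro l hl
    rw [prev_snoc, hw, ha, mem_breaks]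
    rintro ⟨h3, h4⟩
    simp only [List.length_append, List.length_singleton] at h3
    refine h4 ?_
    have hlw : l ≤ w.length := by omega
    have hlw' : l + 1 ≤ w.length := by omega
    rw [RPos_append_inj]
    refine ⟨?_, iff_of_true (hsuf l hlw) (hsuf _ hlw')⟩
    rw [Finset.mem_union] at hl
    simp only [A₁, A₂, Finset.mem_filter] at hl
    rcases hl with ⟨_, h5⟩ | ⟨_, h5, h6⟩
    · rw [not_occ_iff.1 (mt (hocc l hlw).1 (by omega)),
        not_occ_iff.1 (mt (hocc _ hlw').1 (by omega))]
    · refine (RPos_mono ?_).antisymm' ?_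
      · exact rsuf_mono (by omega) (by simp; omega)
      · rw [h6]
        exact RPos_mono ((hsuf _ hlw').of_le hr.rsuf (by rw [hlen _ hlw']; omega)))
  rw [Finset.card_union_of_disjoint hd, hw] at hcard
  have := Finset.card_le_card hV₁
  have := Finset.card_le_card hV₂
  have := Finset.card_insert_le w.length A₁
  have := Finset.card_insert_le (r.length - 1) A₂
  omega

end Visited

end PDAWG

namespace PDAWG

-- A complete phase and its amortised cost.

section Phase

variable {S P : Type} [DecidableEq S] [DecidableEq P]

/-- The dictionary `l` holds the last occurrences of the parameter symbols in `T`. -/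
def LastOf (T : List (S ⊕ P)) (l : AList (fun _ : P => ℤ)) : Prop :=
  ∀ p, (l.lookup p = none ∧ prevSymbol T (.inr p) = .inr 0) ∨
    ∃ b : ℕ, l.lookup p = some ((T.length : ℤ) - b) ∧ prevSymbol T (.inr p) = .inr (b + 1)

theorem prevSymbol_concat_self (T : List (S ⊕ P)) (p : P) :
    prevSymbol (T ++ [.inr p]) (.inr p) = .inr 1 := by
  simp [prevSymbol, List.findIdx?_cons]

theorem prevSymbol_concat_of_ne (T : List (S ⊕ P)) {c : S ⊕ P} {p : P} (h : c ≠ .inr p) :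
    (prevSymbol T (.inr p) = .inr 0 → prevSymbol (T ++ [c]) (.inr p) = .inr 0) ∧
    ∀ b, prevSymbol T (.inr p) = .inr (b + 1) →
      prevSymbol (T ++ [c]) (.inr p) = .inr (b + 1 + 1) := by
  simp only [prevSymbol, List.reverse_append, List.reverse_singleton, List.singleton_append,
    List.findIdx?_cons, decide_eq_true_eq, h, if_false]
  cases h' : T.reverse.findIdx? (fun c => decide (c = Sum.inr p)) with
  | none => simp
  | some b => simp

theorem LastOf.concat_of_ne {T : List (S ⊕ P)} {l l' : AList (fun _ : P => ℤ)} (h : LastOf T l)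
    {c : S ⊕ P} {p : P} (hc : c ≠ .inr p) (hl : l'.lookup p = l.lookup p) :
    (l'.lookup p = none ∧ prevSymbol (T ++ [c]) (.inr p) = .inr 0) ∨
    ∃ b : ℕ, l'.lookup p = some (((T ++ [c]).length : ℤ) - b) ∧
      prevSymbol (T ++ [c]) (.inr p) = .inr (b + 1) := by
  obtain ⟨h1, h2⟩ := prevSymbol_concat_of_ne T hc
  rw [hl]
  rcases h p with ⟨h3, h4⟩ | ⟨b, h3, h4⟩
  · exact Or.inl ⟨h3, h1 h4⟩
  · refine Or.inr ⟨b + 1, ?_, h2 b h4⟩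
    rw [h3]; simp

theorem length_last_le [Fintype P] (l : AList (fun _ : P => ℤ)) :
    l.entries.length ≤ Fintype.card P := by
  rw [length_entries]; exact l.keys_nodup.length_le_card

theorem run_encode [Fintype P] {M : ℕ} {s : Store S P} (hM : Fintype.card P ≤ M)
    (hs : ∀ p, (s.table p).entries.length ≤ M) {T : List (S ⊕ P)} {c : S ⊕ P}
    (hc : s.input = some c) (hi : s.numReg .i = T.length + 1) (hl : LastOf T s.last) :
    ∃ l', Run M Alg.encode s { s.setLab .a (some (prevSymbol T c)) with last := l' } 20 ∧
      LastOf (T ++ [c]) l' ∧ l'.entries.length ≤ s.last.entries.length + 1 := by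
  have hsm : Small s M := ⟨hs, (length_last_le _).trans hM⟩
  rcases c with x | p
  · refine ⟨s.last, (Run.condTrue hsm (by simp [Exp.eval, hc])
      (Run.setLab hsm .a (e := .inputLab) (o := some (.inl x)) (by simp [Exp.eval, hc]))).mono
      (by decide), fun p => hl.concat_of_ne (by simp) rfl, by omega⟩
  · have key : ∀ σ : Store S P, σ = s.setLab .a (some (prevSymbol T (.inr p))) →
        Run M (.atom (.setLast Alg.i)) σ
          { s.setLab .a (some (prevSymbol T (.inr p))) with
            last := s.last.insert p ((T.length : ℤ) + 1) } 3 := by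
      rintro _ rfl
      have := Run.atom (M := M) (s := s.setLab .a (some (prevSymbol T (.inr p))))
        (hsm.of_eq rfl rfl) (.setLast Alg.i)
      have he : (s.setLab .a (some (prevSymbol T (.inr p)))).input = some (.inr p) := hc
      simp only [Instr.effect, he] at this
      have hi' : Alg.i.eval (s.setLab .a (some (prevSymbol T (.inr p)))) = (T.length : ℤ) + 1 := by
        simp [Alg.i, Exp.eval, Store.setLab, hi]
      rw [hi', ← he] at this
      exact this.mono (n' := 3) (by decide)
    have hstat : (Exp.inputIsStatic).eval s = false := by simp [Exp.eval, hc]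
    have hlab : ∃ n ≤ 14, Run M (.cond .inputSeen
        (.atom (.setLab .a (.ofNum (.sub Alg.i .inputLast)))) (.atom (.setLab .a .zero))) s
        (s.setLab .a (some (prevSymbol T (.inr p)))) n := by
      rcases hl p with ⟨h1, h2⟩ | ⟨b, h1, h2⟩
      · refine ⟨_, ?_, Run.condFalse hsm (by simp [Exp.eval, hc, h1]) (Run.setLab hsm .a ?_)⟩
        · decide
        · simp [Exp.eval, h2]
      · refine ⟨_, ?_, Run.condTrue hsm (by simp [Exp.eval, hc, h1]) (Run.setLab hsm .a ?_)⟩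
        · decide
        -- The register `i` already holds `|T| + 1` and the dictionary holds `|T| - b`, so the
        -- difference is the code `b + 1`.
        · simp only [Exp.eval, Alg.i, hc, h1, hi, h2, Option.getD_some, Option.some.injEq,
            Sum.inr.injEq]
          omega
    obtain ⟨n, hn, hlab⟩ := hlab
    refine ⟨s.last.insert p ((T.length : ℤ) + 1),
      (Run.condFalse hsm hstat (hlab.seq (key _ rfl))).mono ?_, fun q => ?_, ?_⟩
    · have : (Exp.inputIsStatic).weight = 1 := rfl
      omega
    · by_cases hq : q = p
      · subst hq
        refine Or.inr ⟨0, ?_, by rw [prevSymbol_concat_self]⟩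
        rw [AList.lookup_insert]; simp
      · exact hl.concat_of_ne (by simpa using Ne.symm hq) (AList.lookup_insert_ne hq)
    · have := length_le_of_keys (T := s.last) (U := s.last.insert p ((T.length : ℤ) + 1)) (c₀ := p)
        fun c hc => by
          rw [← AList.mem_keys, AList.mem_insert, AList.mem_keys] at hc
          exact hc.symm
      exact this

/-- The store `s` holds the PDAWG of `T`; `X p` is the longest string of the node `p`. -/
structure Inv (T : List (S ⊕ P)) (s : Store S P) (X : ℕ → List (S ⊕ ℕ)) (z : ℕ) : Prop where
  graph : Graph (prev T) s.size X s.table s.sl s.len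
  top : s.nodeReg .top = some 0
  root : s.nodeReg .root = some 1
  sink : s.nodeReg .sink = some z
  one_le : 1 ≤ z
  lt_size : z < s.size
  X_sink : X z = prev T
  num_i : s.numReg .i = T.length
  last : LastOf T s.last
  last_le : s.last.entries.length ≤ T.length
  size_le : s.size ≤ 2 * T.length + 2

theorem Inv.table_le [Fintype S] [Fintype P] {T : List (S ⊕ P)} {s : Store S P}
    {X : ℕ → List (S ⊕ ℕ)} {z : ℕ} (h : Inv T s X z) (p : ℕ) :
    (s.table p).entries.length ≤ Fintype.card S + Fintype.card P + 1 := by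
  have G := h.graph
  rcases Nat.eq_zero_or_pos p with rfl | hp
  · rw [G.table_zero]; simp
  rcases Nat.lt_or_ge p s.size with hpN | hpN
  · rw [length_entries, ← List.toFinset_card_of_nodup (s.table p).keys_nodup]
    refine card_labels_le (x := X p) fun c hc => ?_
    rw [List.mem_toFinset, mem_keys_iff] at hc
    obtain ⟨q, hq⟩ := hc
    obtain ⟨h1, h2, h3⟩ := G.edge_some p c q hp hpN hq
    refine isPV_of_occ (T := T) ?_
    rw [Occ, h3]; exact (G.isMax q h1 h2).1
  · rw [G.table_ge p hpN]; simp

theorem run_setup (M : ℕ) : ∃ s : Store S P, Run M Alg.setup (Store.empty S P) s 30 ∧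
    Inv [] s (fun _ => []) 1 := by
  have h0 : Small (Store.empty S P) M := ⟨fun p => by simp [Store.empty], by simp [Store.empty]⟩
  have h1 := h0.alloc .top (-1)
  have h2 := h1.alloc .root 0
  set s₂ := ((Store.empty S P).alloc .top (-1)).alloc .root 0 with hs₂
  have r1 := Run.setSL h2 (e := Alg.root) (f := Alg.top) (p := 1) (o := some 0)
    (by simp [Alg.root, Exp.eval, hs₂, Store.alloc, Store.empty])
    (by simp [Alg.top, Exp.eval, hs₂, Store.alloc, Store.empty])
  set s₃ := s₂.putSL 1 (some 0) with hs₃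
  have h3 : Small s₃ M := h2.of_eq rfl rfl
  have r2 := Run.setNode h3 .sink (e := Alg.root) (o := some 1)
    (by simp [Alg.root, Exp.eval, hs₃, Store.putSL, hs₂, Store.alloc, Store.empty])
  have r3 := Run.setNum (s := s₃.putNode .sink (some 1)) (h3.of_eq rfl rfl) .i (e := .lit 0) rfl
  have r4 := Run.newNode h1 .root (n := .lit 0) rfl _ (r1.seq (r2.seq r3))
  have r5 := Run.newNode h0 .top (n := .lit (-1)) rfl _ r4
  refine ⟨_, r5.mono (by decide), ?_⟩
  have htab : ∀ p, (s₂.table p) = ∅ := fun p => by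
    simp only [hs₂, Store.alloc, Store.empty, Function.update_apply]; split_ifs <;> rfl
  refine ⟨⟨le_rfl, rfl, fun p _ _ => isMax_nil _, fun p q h1 h2 h3 h4 _ => ?_, fun x hx => ?_, ?_,
    fun p h1 h2 => ?_, ?_, fun p h1 h2 => ?_, fun p c q _ _ h => ?_, fun p c _ _ _ h => ?_, htab 0,
    fun p _ => htab p⟩, ?_, ?_, ?_, le_rfl, ?_, rfl, ?_, fun p => Or.inl ⟨rfl, rfl⟩, ?_, le_rfl⟩
  · change p < 2 at h2; change q < 2 at h4; omega
  · refine ⟨1, le_rfl, by change 1 < 2; omega, ?_⟩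
    have := hx.1.length_le
    exact (List.length_eq_zero_iff.1 (Nat.le_zero.1 this)).symm
  · simp [hs₃, hs₂, Store.putNum, Store.putNode, Store.putSL, Store.alloc, Store.empty]
  · change p < 2 at h2
    obtain rfl : p = 1 := by omega
    simp [hs₃, hs₂, Store.putNum, Store.putNode, Store.putSL, Store.alloc, Store.empty]
  · simp [hs₃, Store.putNum, Store.putNode, Store.putSL]
  · change p < 2 at h2; omega
  · change (s₂.table p).lookup c = some q at h
    rw [htab] at h; simp at h
  · have := h.length_le
    simp [prev] at this
  · simp [hs₃, hs₂, Store.putNum, Store.putNode, Store.putSL, Store.alloc, Store.empty]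
  · simp [hs₃, hs₂, Store.putNum, Store.putNode, Store.putSL, Store.alloc, Store.empty]
  · simp [hs₃, hs₂, Store.putNum, Store.putNode, Store.putSL, Store.alloc, Store.empty]
  · change 1 < 2; omega
  · simp [Store.putNum]; rfl
  · simp [hs₃, hs₂, Store.putNum, Store.putNode, Store.putSL, Store.alloc, Store.empty]

/-- The entry count minus the number of breaks serves as potential. Loop iterations are paid by lost
breaks and copied static edges by new entries. What remains is linear in `|Π|`: up to `|Π| + 1` new
breaks, and up to `|Π| + 1` number labels traversed in a split. -/
theorem Inv.run_extend [Fintype S] [Fintype P] {T : List (S ⊕ P)} {s : Store S P}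
    {X : ℕ → List (S ⊕ ℕ)} {z : ℕ} (h : Inv T s X z) (c : S ⊕ P) :
    ∃ s' X' z' n, Run (Fintype.card S + Fintype.card P + 3) Alg.extend (s.feed c) s' n ∧
      Inv (T ++ [c]) s' X' z' ∧
      n + 1000 * (breaks (prev (T ++ [c]))).card + 1000 * entryCount s.table s.size ≤
        1000 * (breaks (prev T)).card + 1000 * entryCount s'.table s'.size +
          1000 * (2 * Fintype.card P + 10) := by
  have G := h.graph
  -- Dictionaries of the graph have at most `|Σ| + |Π| + 1` entries. `Ready` reserves two more for
  -- insertions during the phase.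
  set M := Fintype.card S + Fintype.card P + 3 with hM
  have htab := h.table_le
  have hsm : Small (s.feed c) M := ⟨fun p => (htab p).trans (by omega),
    (length_last_le _).trans (by omega)⟩
  have r1 := Run.setNum hsm .i (e := .add Alg.i (.lit 1)) (o := (T.length : ℤ) + 1)
    (by simp [Exp.eval, Alg.i, Store.feed, h.num_i])
  obtain ⟨l', r2, hl', hll⟩ := run_encode (s := (s.feed c).putNum .i ((T.length : ℤ) + 1)) (M := M)
    (by omega) hsm.table (T := T) (c := c) rfl (by simp [Store.putNum]) h.last
  set a := prevSymbol T c with ha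
  set σ₂ : Store S P := { ((s.feed c).putNum .i ((T.length : ℤ) + 1)).setLab .a (some a) with
    last := l' } with hσ₂
  have hsm₂ : Small σ₂ M := ⟨hsm.table, (length_last_le _).trans (by omega)⟩
  have r3 := Run.setNode hsm₂ .u (e := Alg.sink) (o := some z)
    (by simp [Alg.sink, Exp.eval, hσ₂, Store.setLab, Store.putNum, Store.feed, h.sink])
  have hsm₃ : Small (σ₂.putNode .u (some z)) M := hsm₂.of_eq rfl rfl
  set σ₄ := (σ₂.putNode .u (some z)).alloc .sink ((T.length : ℤ) + 1) with hσ₄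
  have hwa : prev (T ++ [c]) = prev T ++ [a] := prev_snoc T c
  have R : Ready (prev T) a s.size X s.table s.sl s.len M σ₄ := by
    refine ⟨G, by rw [← hwa]; exact reenc_prev _, rfl, ?_, ?_, ?_, ?_, fun p hp => ?_, ?_,
      fun p hp => ?_, ?_, fun p => by have := htab p; omega, (length_last_le _).trans (by omega)⟩
    · simp [hσ₄, hσ₂, Store.alloc, Store.putNode, Store.setLab, Store.putNum, Store.feed, h.top]
    · simp [hσ₄, hσ₂, Store.alloc, Store.putNode, Store.setLab, Store.putNum, Store.feed, h.root]
    · simp [hσ₄, hσ₂, Store.alloc, Store.putNode, Store.setLab, Store.putNum, Store.feed]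
    · simp [hσ₄, hσ₂, Store.alloc, Store.putNode, Store.setLab, Store.putNum, Store.feed]
    · change Function.update s.len s.size _ p = _
      rw [Function.update_of_ne (by omega)]
    · change Function.update s.len s.size _ s.size = _
      rw [Function.update_self, prev_length]; rfl
    · change Function.update s.sl s.size _ p = _
      rw [Function.update_of_ne (by omega)]
    · change Function.update s.sl s.size _ s.size = _
      rw [Function.update_self]
  have hmove : σ₄ = σ₄.moveTo s.table z := by
    have e1 : Function.update σ₄.nodeReg .u (some z) = σ₄.nodeReg := by
      rw [Function.update_eq_self_iff]
      simp [hσ₄, Store.alloc, Store.putNode]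
    have e2 : s.table = σ₄.table := by
      change _ = Function.update s.table s.size ∅
      rw [eq_comm, Function.update_eq_self_iff]
      exact (G.table_ge _ le_rfl).symm
    rw [Store.moveTo, e1, e2]
  obtain ⟨tb₁, p₁, n₁, r4, hp₁, hred₁, hno, hoc, hn₁⟩ := R.run_sinkEdges h.one_le h.lt_size h.X_sink
  obtain ⟨tb₂, p₂, r, v, r5, hr, hv, hvN, hvr, hp₂, hlp₂, htop, hred₂⟩ :=
    R.run_findLRS hp₁ hred₁ hno hoc
  have hfin : ∃ s' X' n p₃ e, Run M
      (.cond (.eqNum (.len Alg.v) Alg.k) (.atom (.setSL Alg.sink Alg.v)) Alg.split)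
      (((σ₄.putNum .k (r.length : ℤ)).putNode .v (some v)).moveTo tb₂ p₂) s' n ∧
      Extended (prev T) a s.size σ₄ s' X' ∧
      entryCount s.table s.size + e ≤ entryCount s'.table s'.size ∧
      (∀ q, 1 ≤ q → OnChain (prev T) s.size X q → s.len p₃ < s.len q → s.len q ≤ s.len p₂ →
        RPos (prev T) (X q ++ [zeta a (s.len q)]) = RPos (prev T) r) ∧
      n ≤ 1000 * (1 + ((insert (prev T).length (breaks (prev T))).filter
        fun l : ℕ => s.len p₃ < (l : ℤ) ∧ (l : ℤ) ≤ s.len p₂).card + (Fintype.card P + 1) + e) := by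
    -- `r` lies in the class of `v`, so either it is the longest string of `v` or `v` has to be
    -- split.
    have hvle : r.length ≤ (X v).length := (G.isMax v hv hvN).2 r hvr.symm
    rcases hvle.eq_or_lt with heq | hlt
    · obtain ⟨s', X', h1, h2, h3⟩ := R.run_link (p₂ := p₂) hr hv hvN hvr heq.symm hred₂
      exact ⟨s', X', 30, p₂, 0, h1, h2, h3, fun q _ _ h4 h5 => by omega, by omega⟩
    · exact R.run_split hr hv hvN hvr hlt hp₂ hlp₂ htop hred₂ fun A x hA =>
        card_numbers_le (x := x) fun b hb => isPV_of_occ (T := T ++ [c]) (by rw [hwa]; exact hA b hb)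
  obtain ⟨s', X', n₃, p₃, e, r6, hE, he, hgood, hn₃⟩ := hfin
  rw [← hmove] at r4
  have hcard := card_visited_le (T := T) (c := c) rfl rfl G hr hlp₂ hno hgood
  have r7 := Run.newNode (x := .sink) (n := Alg.i) (m := (T.length : ℤ) + 1) hsm₃
    (by simp [Alg.i, Exp.eval, Store.alloc, hσ₂, Store.putNode, Store.setLab, Store.putNum])
    _ (r4.seq (r5.seq r6))
  refine ⟨s', X', s.size, _, r1.seq (r2.seq (r3.seq r7)), ⟨?_, hE.top, hE.root, hE.sink, ?_,
    hE.size_gt, ?_, ?_, ?_, ?_, ?_⟩, ?_⟩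
  · rw [hwa]; exact hE.graph
  · have := G.two_le; omega
  · rw [hE.X_sink, hwa]
  · rw [hE.num_i]
    simp [hσ₄, Store.alloc, hσ₂, Store.putNode, Store.setLab, Store.putNum]
  · rw [hE.last]; exact hl'
  · rw [hE.last]
    change l'.entries.length ≤ _
    change l'.entries.length ≤ s.last.entries.length + 1 at hll
    have := h.last_le
    simp; omega
  · have := hE.size_le
    have := h.size_le
    simp; omega
  · have w1 : (Exp.add Alg.i (.lit 1)).weight = 3 := rfl
    have w2 : Alg.sink.weight = 1 := rfl
    have w3 : Alg.i.weight = 1 := rfl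
    rw [w1, w2, w3]
    omega

end Phase

end PDAWG

namespace PDAWG

-- From the invariant to the PDAWG, and the linear size bound.

section Correctness

variable {S P : Type} [DecidableEq S] [DecidableEq P] {T : List (S ⊕ P)}

theorem mem_cls_self {x : List (S ⊕ ℕ)} (h : Occ (prev T) x) : x ∈ cls P (prev T) x :=
  ⟨isPV_of_occ h, rfl⟩

theorem cls_eq_iff {x y : List (S ⊕ ℕ)} (h : Occ (prev T) x) :
    cls P (prev T) x = cls P (prev T) y ↔ RPos (prev T) x = RPos (prev T) y := by
  constructor
  · intro e
    have := mem_cls_self h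
    rw [e] at this
    exact this.2
  · intro e
    simp only [cls, e]

theorem mem_nodes {u : Set (List (S ⊕ ℕ))} :
    u ∈ nodes T ↔ ∃ x, Occ (prev T) x ∧ u = cls P (prev T) x := by
  simp only [nodes, Set.mem_ofPred_eq, mem_PFactor]

theorem isLongest_cls {x y : List (S ⊕ ℕ)} (h : IsMax (prev T) x) :
    IsLongest (cls P (prev T) x) y ↔ y = x := by
  constructor
  · rintro ⟨h1, h2⟩
    obtain ⟨i, hi⟩ := h.1
    exact eq_of_mem_RPos (h1.2 ▸ hi) hi (le_antisymm (h.2 y h1.2) (h2 x (mem_cls_self h.1)))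
  · rintro rfl
    exact ⟨mem_cls_self h.1, fun z hz => h.2 z hz.2⟩

theorem rsuf_reenc_tail {y : List (S ⊕ ℕ)} (h : y ≠ []) : reenc y.tail = rsuf y (y.length - 1) := by
  have := List.length_pos_iff.2 h
  rw [rsuf, ← List.drop_one]
  congr 2; omega

/-- The class of `x` consists of the suffixes of `x` longer than `x'`, so its shortest element has
length `|x'| + 1`. Dropping the first letter and re-encoding gives `x'`. -/
theorem reenc_tail_of_isShortest {x x' y : List (S ⊕ ℕ)} (hx : IsMax (prev T) x)
    (h : IsLink (prev T) x x') (hy : IsShortest (cls P (prev T) x) y) : reenc y.tail = x' := by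
  have hyx := hx.rsuf_of_eq hy.1.2
  have hlt := h.length_lt hx.1
  have h1 := (h.RPos_eq hyx).1 hy.1.2
  have h2 : RSuf (rsuf x (x'.length + 1)) x := rsuf_rsuf hlt
  have h3 : (rsuf x (x'.length + 1)).length = x'.length + 1 := rsuf_length hlt
  have h4 := hy.2 (rsuf x (x'.length + 1))
    ⟨isPV_of_occ (hx.1.of_rsuf h2), (h.RPos_eq h2).2 (by omega)⟩
  have h5 : y ≠ [] := by rintro rfl; simp at h1
  rw [rsuf_reenc_tail h5]
  refine ((rsuf_rsuf (by omega)).trans hyx).eq_of_length h.rsuf ?_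
  rw [rsuf_length (by omega)]; omega

theorem exists_isShortest {x x' : List (S ⊕ ℕ)} (hx : IsMax (prev T) x)
    (h : IsLink (prev T) x x') : ∃ y, IsShortest (cls P (prev T) x) y := by
  have hlt := h.length_lt hx.1
  have h2 : RSuf (rsuf x (x'.length + 1)) x := rsuf_rsuf hlt
  have h3 : (rsuf x (x'.length + 1)).length = x'.length + 1 := rsuf_length hlt
  refine ⟨rsuf x (x'.length + 1), ⟨isPV_of_occ (hx.1.of_rsuf h2), (h.RPos_eq h2).2 (by omega)⟩,
    fun z hz => ?_⟩
  have := (h.RPos_eq (hx.rsuf_of_eq hz.2)).1 hz.2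
  omega

variable {s : Store S P} {X : ℕ → List (S ⊕ ℕ)} {z : ℕ}

theorem Inv.holds (h : Inv T s X z) : Holds s T := by
  have G := h.graph
  have hmax : ∀ {p}, p < s.size → p ≠ 0 → IsMax (prev T) (X p) := fun hp h0 =>
    G.isMax _ (Nat.one_le_iff_ne_zero.2 h0) hp
  have hinj : ∀ {p q}, p < s.size → p ≠ 0 → q < s.size → q ≠ 0 →
      RPos (prev T) (X p) = RPos (prev T) (X q) → p = q := fun hp h0 hq h0' e =>
    G.eq_of_RPos (Nat.one_le_iff_ne_zero.2 h0) hp (Nat.one_le_iff_ne_zero.2 h0') hq e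
  have h2 := G.two_le
  have hz := h.one_le
  have hnode : ∀ {p}, p < s.size → p ≠ 0 → cls P (prev T) (X p) ∈ nodes T := fun hp h0 =>
    mem_nodes.2 ⟨_, (hmax hp h0).1, rfl⟩
  -- The dummy node is allocated first and the source second; a node is sent to the class of its
  -- longest string.
  refine ⟨0, 1, z, fun p => cls P (prev T) (X p), by omega, h.top, ⟨?_, ?_, ?_⟩,
    ⟨by omega, by omega, h.root, by simp only [G.X_one, source], G.sl_one⟩,
    ⟨h.lt_size, by omega, h.sink, by simp only [h.X_sink, PDAWG.sink]⟩, ?_, ?_, ?_⟩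
  · rintro p ⟨hp, h0⟩
    exact hnode hp h0
  · rintro p ⟨hp, h0⟩ q ⟨hq, h0'⟩ e
    exact hinj hp h0 hq h0' ((cls_eq_iff (hmax hp h0).1).1 e)
  · intro u hu
    obtain ⟨x, hx, rfl⟩ := mem_nodes.1 hu
    obtain ⟨y, hy, hyx⟩ := exists_isMax hx
    obtain ⟨p, h1, h3, rfl⟩ := G.surj y hy
    exact ⟨p, ⟨h3, by omega⟩, (cls_eq_iff hy.1).2 hyx⟩
  · intro p c q hp h0
    constructor
    · intro hl
      obtain ⟨h1, h3, h4⟩ := G.edge_some p c q (by omega) hp hl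
      refine ⟨h3, by omega, hnode hp h0, hnode h3 (by omega), X p,
        (isLongest_cls (hmax hp h0)).2 rfl, (cls_eq_iff (hmax h3 (by omega)).1).2 h4.symm⟩
    · rintro ⟨hq, h0', _, _, y, hy, he⟩
      obtain rfl := (isLongest_cls (hmax hp h0)).1 hy
      rw [cls_eq_iff (hmax hq h0').1] at he
      cases hl : (s.table p).lookup c with
      | none =>
        refine absurd ?_ (G.edge_none p c (by omega) hp hl)
        rw [Occ, ← he]; exact (hmax hq h0').1
      | some q' =>
        obtain ⟨h1, h3, h4⟩ := G.edge_some p c q' (by omega) hp hl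
        rw [hinj hq h0' h3 (by omega) (he.trans h4)]
  · intro p q hp h0 h1
    obtain ⟨q', h3, h4, h5, h6⟩ := G.sl p (by omega) hp
    have hp' := hmax hp h0
    rw [h5, Option.some.injEq]
    constructor
    · rintro rfl
      obtain ⟨y, hy⟩ := exists_isShortest hp' h6
      refine ⟨h4, by omega, hnode hp h0, fun e => h1 ?_, y, hy, ?_⟩
      · refine hinj hp h0 (by omega) one_ne_zero ?_
        rw [G.X_one]
        exact (cls_eq_iff hp'.1).1 e
      · rw [reenc_tail_of_isShortest hp' h6 hy]
    · rintro ⟨hq, h0', _, _, y, hy, he⟩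
      rw [reenc_tail_of_isShortest hp' h6 hy, cls_eq_iff (hmax hq h0').1] at he
      exact (hinj hq h0' h4 (by omega) he).symm
  · intro p y hp h0 hy
    rw [(isLongest_cls (hmax hp h0)).1 hy, G.len p (by omega) hp]

/-- Every dictionary entry is an edge whose string occurs, and distinct nodes have distinct longest
strings, so `card_edges_le` applies to the nodes other than the dummy. -/
theorem Inv.entryCount_le (h : Inv T s X z) : entryCount s.table s.size ≤ s.size + T.length := by
  have G := h.graph
  let E := ((Finset.range s.size).sigma fun p => (s.table p).keys.toFinset).map
    (Equiv.sigmaEquivProd ℕ (S ⊕ ℕ)).toEmbedding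
  have hE : E.card = entryCount s.table s.size := by
    simp only [E, Finset.card_map, Finset.card_sigma, entryCount]
    exact Finset.sum_congr rfl fun p _ => by
      rw [List.toFinset_card_of_nodup (s.table p).keys_nodup, length_entries]
  rw [← hE, ← prev_length T]
  refine (card_edges_le (w := prev T) (N := Finset.Ico 1 s.size) (X := X) ?_ ?_).trans
    (by rw [Nat.card_Ico]; omega)
  · intro p hp q hq e
    simp only [Finset.coe_Ico, Set.mem_Ico] at hp hq
    exact G.inj p q hp.1 hp.2 hq.1 hq.2 e
  · rintro ⟨p, c⟩ he
    simp only [E, Finset.mem_map, Finset.mem_sigma, Finset.mem_range, List.mem_toFinset] at he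
    obtain ⟨⟨p', c'⟩, ⟨h1, h2⟩, h3⟩ := he
    simp only [Equiv.coe_toEmbedding, Equiv.sigmaEquivProd_apply, Prod.mk.injEq] at h3
    obtain ⟨rfl, rfl⟩ := h3
    obtain ⟨q, hq⟩ := mem_keys_iff.1 h2
    have h0 : 1 ≤ p' := by
      rw [Nat.one_le_iff_ne_zero]
      rintro rfl
      rw [G.table_zero] at hq; simp at hq
    obtain ⟨h4, h5, h6⟩ := G.edge_some p' c' q h0 h1 hq
    refine ⟨Finset.mem_Ico.2 ⟨h0, h1⟩, ?_⟩
    rw [Occ, h6]; exact (G.isMax q h4 h5).1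

theorem Inv.space_le (h : Inv T s X z) : s.space ≤ 31 * max 1 T.length := by
  have h1 := h.entryCount_le
  have h2 := h.size_le
  have h3 := h.last_le
  simp only [Store.space, ← Finset.mul_sum]
  change 2 * s.size + 2 * entryCount s.table s.size + _ + _ ≤ _
  -- With `n = |T|` there are at most `2n + 2` nodes, `3n + 2` edges and `n` last occurrences. This
  -- gives `12n + 19` cells, at most `31 max(1, n)`.
  have := le_max_left 1 T.length
  have := le_max_right 1 T.length
  omega

end Correctness

-- Complete runs and the final bounds.

section Runs

variable {S P : Type} [DecidableEq S] [DecidableEq P]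

/-- The algorithm runs, keeps the invariant, and the time is bounded by a potential. -/
theorem exists_onlineRun [Fintype S] [Fintype P] (T : List (S ⊕ P)) :
    ∃ (s : ℕ → Store S P) (t m : ℕ → ℕ), OnlineRun T s t m ∧ ∀ j ≤ T.length,
      m j = (s j).space ∧ ∃ X z, Inv (T.take j) (s j) X z ∧
        ∃ n, ∑ l ∈ Finset.range (j + 1), t l ≤ n * dictCost (Fintype.card S + Fintype.card P + 3) ∧
          n + 1000 * (breaks (prev (T.take j))).card ≤ 1000 * entryCount (s j).table (s j).size +
            1000 * (2 * Fintype.card P + 10) * j + 30 := by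
  induction T using List.reverseRecOn with
  | nil =>
    obtain ⟨s, ⟨t, m, h1, h2⟩, h3⟩ := run_setup (S := S) (P := P) (Fintype.card S + Fintype.card P + 3)
    refine ⟨fun _ => s, fun _ => t, fun _ => m, ⟨h1, fun j hj => by simp at hj⟩, fun j hj => ?_⟩
    obtain rfl : j = 0 := by simpa using hj
    refine ⟨h1.space_eq.2, _, _, h3, 30, by simpa using h2, ?_⟩
    have : (breaks (prev (([] : List (S ⊕ P)).take 0))).card = 0 := by simp [breaks, prev]
    omega
  | append_singleton T c ih =>
    obtain ⟨s, t, m, hrun, hinv⟩ := ih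
    obtain ⟨_, X, z, hI, n, hn, hpot⟩ := hinv T.length le_rfl
    rw [List.take_length] at hI hpot
    obtain ⟨s', X', z', n', ⟨t', m', hex, ht'⟩, hI', hpot'⟩ := hI.run_extend c
    have hlt : ∀ j ≤ T.length, j ≠ T.length + 1 := fun j hj => by omega
    -- Only the entry of the new phase is overwritten, so the run on the shorter input is kept; this
    -- is what makes the algorithm online.
    refine ⟨Function.update s (T.length + 1) s', Function.update t (T.length + 1) t',
      Function.update m (T.length + 1) m', ⟨?_, fun j hj => ?_⟩, fun j hj => ?_⟩
    · rw [Function.update_of_ne (by omega), Function.update_of_ne (by omega),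
        Function.update_of_ne (by omega)]
      exact hrun.1
    · rw [List.length_append, List.length_singleton] at hj
      rw [Function.update_of_ne (by omega)]
      rcases Nat.lt_or_ge j T.length with h | h
      · rw [Function.update_of_ne (by omega), Function.update_of_ne (by omega),
          Function.update_of_ne (by omega), List.getElem_append_left h]
        exact hrun.2 j h
      · obtain rfl : j = T.length := by omega
        rw [Function.update_self, Function.update_self, Function.update_self]
        simpa using hex
    · rw [List.length_append, List.length_singleton] at hj
      have hsum : ∀ k ≤ T.length, ∑ l ∈ Finset.range (k + 1), Function.update t (T.length + 1) t' l =
          ∑ l ∈ Finset.range (k + 1), t l := fun k hk => by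
        refine Finset.sum_congr rfl fun l hl => ?_
        rw [Finset.mem_range] at hl
        rw [Function.update_of_ne (by omega)]
      rcases Nat.lt_or_ge T.length j with h | h
      · obtain rfl : j = T.length + 1 := by omega
        rw [Finset.sum_range_succ, hsum _ le_rfl, Function.update_self, Function.update_self,
          Function.update_self, List.take_of_length_le (by simp)]
        refine ⟨hex.space_eq.2, X', z', hI', n + n', by rw [Nat.add_mul]; omega, ?_⟩
        rw [Nat.mul_succ]; omega
      · rw [hsum j h, Function.update_of_ne (by omega), Function.update_of_ne (by omega),
          List.take_append_of_le_length h]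
        exact hinv j h

/-- For `x ≥ 1` one has `x + 4 ≤ 8x`, so the cost is at most `4 + log₂ x`. For `x = 0` the cost is
`3`, and the maximum with `1` absorbs it. -/
theorem dictCost_le (x : ℕ) : (dictCost (x + 3) : ℝ) ≤ 5 * max 1 (Real.logb 2 x) := by
  have h0 := le_max_left 1 (Real.logb 2 x)
  have h1 := le_max_right 1 (Real.logb 2 x)
  rcases Nat.eq_zero_or_pos x with rfl | hx
  · have : dictCost 3 = 3 := by
      rw [dictCost, show 3 + 1 = 2 ^ 2 from rfl, Nat.log_pow (by norm_num)]
    norm_num [this]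
  · have h2 : Nat.log 2 (x + 3 + 1) ≤ Nat.log 2 x + 3 := by
      have h3 : Nat.log 2 (x * 2 * 2 * 2) = Nat.log 2 x + 3 := by
        rw [Nat.log_mul_base, Nat.log_mul_base, Nat.log_mul_base] <;> omega
      rw [← h3]
      exact Nat.log_mono_right (by omega)
    have h3 := Real.natLog_le_logb x 2
    have h4 : (dictCost (x + 3) : ℝ) ≤ 1 + (Nat.log 2 x + 3) := by
      rw [dictCost]; exact_mod_cast Nat.add_le_add_left h2 1
    push_cast at h3
    linarith

end Runs

end PDAWG

theorem mainTheorem3 :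
    ∃ C : ℕ, ∀ (S P : Type) [Fintype S] [DecidableEq S] [Fintype P] [DecidableEq P]
      (T : List (S ⊕ P)),
      ∃ (s : ℕ → PDAWG.Store S P) (t m : ℕ → ℕ), PDAWG.OnlineRun T s t m ∧
        ∀ j ≤ T.length,
          PDAWG.Holds (s j) (T.take j) ∧
          ((∑ l ∈ Finset.range (j + 1), t l : ℕ) : ℝ) ≤
            C * max 1 (j : ℝ) * max 1 (Fintype.card P : ℝ) *
              max 1 (Real.logb 2 (Fintype.card S + Fintype.card P)) ∧
          m j ≤ C * max 1 j := by
  -- The constant is the product of `20000` from the operation count and `5` from the dictionary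
  -- cost.
  refine ⟨100000, fun S P _ _ _ _ T => ?_⟩
  obtain ⟨s, t, m, hrun, h⟩ := PDAWG.exists_onlineRun T
  refine ⟨s, t, m, hrun, fun j hj => ?_⟩
  obtain ⟨hm, X, z, hI, n, hn, hpot⟩ := h j hj
  have hlen : (T.take j).length = j := by simpa using hj
  have hsp := hI.space_le
  have hen := hI.entryCount_le
  have hsz := hI.size_le
  rw [hlen] at hsp hen hsz
  refine ⟨hI.holds, ?_, by omega⟩
  have hn' : (n : ℝ) ≤ 20000 * (max 1 (j : ℝ) * max 1 (Fintype.card P : ℝ)) := by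
    -- The entry count is at most `3j + 2`, which adds `3000j + 2000` to the accumulated phase costs
    -- `10000j` and the initial `30`. The three coefficients sum to less than `20000`.
    have h1 : n ≤ 2000 * (Fintype.card P * j) + 13000 * j + 2030 := by
      have : 1000 * (2 * Fintype.card P + 10) * j = 2000 * (Fintype.card P * j) + 10000 * j := by
        ring
      omega
    have h2 : (n : ℝ) ≤ 2000 * (Fintype.card P * j) + 13000 * j + 2030 := by exact_mod_cast h1
    have a1 := le_max_left 1 (j : ℝ)
    have a2 := le_max_right 1 (j : ℝ)
    have b1 := le_max_left 1 (Fintype.card P : ℝ)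
    have b2 := le_max_right 1 (Fintype.card P : ℝ)
    have c1 : (Fintype.card P : ℝ) * j ≤ max 1 (Fintype.card P : ℝ) * max 1 (j : ℝ) :=
      mul_le_mul b2 a2 (by positivity) (by positivity)
    have c2 : max 1 (j : ℝ) ≤ max 1 (j : ℝ) * max 1 (Fintype.card P : ℝ) :=
      le_mul_of_one_le_right (by positivity) b1
    linarith
  have hd := PDAWG.dictCost_le (Fintype.card S + Fintype.card P)
  push_cast at hd
  calc ((∑ l ∈ Finset.range (j + 1), t l : ℕ) : ℝ)
      ≤ n * (PDAWG.dictCost (Fintype.card S + Fintype.card P + 3) : ℝ) := by exact_mod_cast hn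
    _ ≤ 20000 * (max 1 (j : ℝ) * max 1 (Fintype.card P : ℝ)) *
        (5 * max 1 (Real.logb 2 (Fintype.card S + Fintype.card P))) :=
      mul_le_mul hn' hd (by positivity) (by positivity)
    _ = _ := by push_cast; ring
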